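/- Let $d\in\mathbb N$ and let $\mu$ be a probability distribution on $\mathbb R^d$ with density proportional to $e^{-V}$. For $t\ge 0$ let $\xi_t$ be the law at time $t$ of the Ornstein–Uhlenbeck process $dX(t)=-X(t)\,dt+\sqrt2\,dB(t)$ started from $X(0)\sim\mu$, that is, the law of $e^{-t}X+\sqrt{1-e^{-2t}}\,\zeta$ with $X\sim\mu$ and $\zeta\sim\mathcal N(0,\mathrm{Id}_d)$ independent. Suppose that 1. $V$ is differentiable and $L$-smooth: $\|\nabla V(x)-\nabla V(y)\|\le L\|x-y\|$ for all $x,y$; 2. for every $t\ge 0$ the potential $-\log\xi_t$ is differentiable and $L^{\mathrm{OU}}_t$-smooth; 3. for some $\lambda>0$, $\mathbb E_{X\sim\mu}\,e^{r^2\|X\|^2}\le e^{r^2\lambda^2}$ for all $r\in[-1/\lambda,1/\lambda]$. Write $L_s=L^{\mathrm{OU}}_t$ with $t=\log\sqrt{(s+1)/s}$, and let $C^{\mathrm{PI}}_\mu=\sup_f \mathrm{Var}_\mu(f)/\mathbb E_\mu\|\nabla f\|^2\in[0,\infty]$ be the Poincaré constant of $\mu$ (the supremum is over differentiable $f:\mathbb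 R^d\to\mathbb R$; $0/0=0$). Then $$C^{\mathrm{PI}}_\mu\le \min_{s_0\in\left(0,\frac{\log 2}{4\lambda^2}\right]}\frac{1}{2-e^{4s_0\lambda^2}}\cdot\frac{2}{s_0}\cdot\exp\left\{\int_{s_0}^{2L}\frac{L_s}{s(1+s)}\,ds\right\},$$ where the right-hand side takes values in $[0,\infty]$ (it is $\infty$ at $s_0=\frac{\log2}{4\lambda^2}$ and when the integral diverges) and the minimum is attained. Moreover there is a universal constant $K>0$, independent of $d,V,\mu,L,\lambda$ and $(L^{\mathrm{OU}}_t)_{t\ge0}$, such that whenever $\overline L=\sup_{t\ge 0}L^{\mathrm{OU}}_t<\infty$, $$C^{\mathrm{PI}}_\mu\le \left(K\max\{1,\lambda\}\right)^{2(\overline L+1)};$$ in particular $C^{\mathrm{PI}}_\mu\le (K\lambda)^{2(\overline L+1)}$ for $\lambda\ge 1$. -/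

import Mathlib

open MeasureTheory ProbabilityTheory Set
open scoped ENNReal Gradient

noncomputable section

namespace OUPoincare

/-- `ℝ^d` with its Euclidean norm. -/
abbrev Space (d : ℕ) := EuclideanSpace ℝ (Fin d)

/-- `V` is a potential function of `μ`: the measure `μ` has a density proportional to `exp (-V)`
with respect to Lebesgue measure. (Up to an additive constant, `V` is minus the logarithm of the
density.) -/
def HasPotential {d : ℕ} (μ : Measure (Space d)) (V : Space d → ℝ) : Prop :=
  ∃ Z : ℝ, 0 < Z ∧ μ = volume.withDensity (fun x => ENNReal.ofReal (Real.exp (-V x) / Z))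

/-- `V` is differentiable and `L`-smooth: its gradient is `L`-Lipschitz. -/
def IsSmoothWith {d : ℕ} (L : ℝ) (V : Space d → ℝ) : Prop :=
  Differentiable ℝ V ∧ ∀ x y, ‖∇ V x - ∇ V y‖ ≤ L * ‖x - y‖

/-- The law at time `t` of the Ornstein-Uhlenbeck process `dX(t) = -X(t) dt + √2 dB(t)` started
from `X(0) ∼ μ`, that is, the law of `e^{-t} X(0) + √(1 - e^{-2t}) ζ` where `ζ` is a standard
Gaussian vector independent of `X(0)`. -/
def ouMarginal {d : ℕ} (μ : Measure (Space d)) (t : ℝ) : Measure (Space d) :=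
  (μ.prod (stdGaussian (Space d))).map
    (fun p => Real.exp (-t) • p.1 + Real.sqrt (1 - Real.exp (-2 * t)) • p.2)

/-- For every `t ≥ 0` the potential function of the law of the Ornstein-Uhlenbeck process at time
`t`, started from `μ`, is differentiable and `Lt t`-smooth. -/
def OUSmooth {d : ℕ} (μ : Measure (Space d)) (Lt : ℝ → ℝ) : Prop :=
  ∀ t : ℝ, 0 ≤ t → ∃ U : Space d → ℝ, HasPotential (ouMarginal μ t) U ∧ IsSmoothWith (Lt t) U

/-- For `X ∼ μ`, the norm `‖X‖` is `lam`-sub-Gaussian: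
`E exp (r² ‖X‖²) ≤ exp (r² lam²)` for all `r ∈ [-1/lam, 1/lam]`. -/
def NormSubGaussian {d : ℕ} (μ : Measure (Space d)) (lam : ℝ) : Prop :=
  0 < lam ∧ ∀ r ∈ Icc (-(1 / lam)) (1 / lam),
    ∫⁻ x, ENNReal.ofReal (Real.exp (r ^ 2 * ‖x‖ ^ 2)) ∂μ
      ≤ ENNReal.ofReal (Real.exp (r ^ 2 * lam ^ 2))

/-- The classical Poincaré constant `sup_f Var_μ(f) / E_μ ‖∇ f‖²`, over all differentiable `f`, as
an element of `[0, ∞]`. The variance of a function that is not square integrable is `∞`, and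
`0 / 0` counts as `0`. -/
def poincareConst {d : ℕ} (μ : Measure (Space d)) : ℝ≥0∞ :=
  ⨆ (f : Space d → ℝ) (_ : Differentiable ℝ f),
    evariance f μ / ∫⁻ x, ‖∇ f x‖ₑ ^ 2 ∂μ

/-- The smoothness parameter on the stochastic localization time scale:
`L_s = L^{OU}_t` with `t = log √((s+1)/s)`. -/
def slSmoothness (Lt : ℝ → ℝ) (s : ℝ) : ℝ :=
  Lt (Real.log (Real.sqrt ((s + 1) / s)))

/-- The quantity `1 / (2 - e^{4 s₀ lam²}) · (2 / s₀) · exp (∫_{s₀}^{2L} L_s / (s (1+s)) ds)` in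
`[0, ∞]`. It is `∞` at the end point `s₀ = log 2 / (4 lam²)`, where the first denominator is `0`,
and wherever the integral is infinite. -/
def piBound (L lam : ℝ) (Lt : ℝ → ℝ) (s₀ : ℝ) : ℝ≥0∞ :=
  (1 / ENNReal.ofReal (2 - Real.exp (4 * s₀ * lam ^ 2))) * ENNReal.ofReal (2 / s₀) *
    EReal.exp ((∫⁻ s in Ioc s₀ (2 * L),
      ENNReal.ofReal (slSmoothness Lt s / (s * (1 + s))) : ℝ≥0∞) : EReal)

end OUPoincare

end

/-!
The proof runs the stochastic localization of `μ`. For `X ∼ μ` observe `y = s X + √s ζ` with an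
independent standard Gaussian `ζ`. The conditional law of `X` given `y` is `μ` reweighted by
`slWeight s y`, and `residualVar μ f s` is the expected conditional variance of `f(X)`. For a
bounded test function `f`, three facts about this quantity give a Poincaré inequality.

* *Decay rate* (`TiltBound.residualVar_sub_le`, `residualVar_le_of_tiltBound`). If all conditional
  laws at time `s` have covariance at most `c s • Id`, then `-(log residualVar)' ≤ c s`. In one step
  of length `δ` the posterior mean of `f` can only pick up what `f` has in common with the linear
  functions, up to `O(δ²)`; this is an explicit computation with the kernel
  `exp (δ ⟪x - E X, x' - E X⟫)`, whose remainder is controlled by sub-Gaussian tails of the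
  conditional law. Since `s ↦ c s` need not be measurable, the rates are integrated by a fundamental
  theorem of calculus for Dini derivatives with a lower integral on the right.
* *Covariance bounds*, stated as bounds on second differences of the log-partition function
  (`TiltBound`). The partition function is, up to rescaling and a Gaussian factor, the density of an
  Ornstein–Uhlenbeck marginal, so `L_s`-smoothness of the latter gives
  `c s = 1 / s + L_s / (s (1 + s))` (`tiltBound_of_ouSmooth`). For `s > L` the conditional laws are
  `(s - L)`-strongly log-concave, and the Prékopa–Leindler inequality gives `c s = 1 / (s - L)`
  (`tiltBound_of_isSmoothWith`).
* *The two ends of the time interval.* For `s ≤ log 2 / (4 λ²)` the posterior mean carries at most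
  the fraction `e ^ (4 s λ²) - 1` of the variance, whence
  `(2 - e ^ (4 s λ²)) Var f ≤ residualVar μ f s` (`variance_le_residualVar`). As `s → ∞`, comparing
  the posterior mean with the predictor `f (y / s)` shows that `s * residualVar μ f s` is
  asymptotically at most `E ‖∇ f‖²` (`residualVar_le_channel`, `eventually_channel_le`).

Integrating the first covariance bound from `s₀` to `max s₀ (2 L)` and the second from there to `∞`
bounds `Var f` by `piBound L λ Lt s₀ * E ‖∇ f‖²` (`evariance_le_of_bounded`); truncation and Fatou's
lemma remove the boundedness of `f` (`evariance_le_of_forall_bounded`). The minimum over `s₀` is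
attained because `piBound` is lower semicontinuous and blows up as `s₀ → 0`
(`exists_isLeast_piBound`), and `s₀ = 1 / (8 max(1, λ)²)` gives the universal constant
(`piBound_le_of_bddAbove`). In dimension zero, where smoothness constants may be negative, the
Poincaré constant vanishes.
-/

noncomputable section

namespace OUPoincare

open scoped RealInnerProductSpace

variable {d : ℕ}

/-! ### Centred Gaussian measures with covariance `s • Id` -/

/-- The centred Gaussian measure on `ℝ^d` with covariance `s • Id`, for `s ≥ 0`. (For `s < 0` it is
the point mass at the origin, since `√s = 0`.) -/
def heatGaussian (d : ℕ) (s : ℝ) : Measure (Space d) :=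
  (stdGaussian (Space d)).map (fun z => Real.sqrt s • z)

instance isProbabilityMeasure_heatGaussian (s : ℝ) : IsProbabilityMeasure (heatGaussian d s) :=
  Measure.isProbabilityMeasure_map (by fun_prop)

lemma lintegral_heatGaussian (s : ℝ) {F : Space d → ℝ≥0∞} (hF : Measurable F) :
    ∫⁻ y, F y ∂heatGaussian d s = ∫⁻ z, F (Real.sqrt s • z) ∂stdGaussian (Space d) := by
  rw [heatGaussian, lintegral_map hF (by fun_prop)]

lemma charFun_heatGaussian {s : ℝ} (hs : 0 ≤ s) (t : Space d) :
    charFun (heatGaussian d s) t = Complex.exp (-(s * ‖t‖ ^ 2 / 2 : ℝ)) := by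
  rw [heatGaussian, charFun_map_smul, charFun_stdGaussian, norm_smul, Real.norm_eq_abs,
    abs_of_nonneg (Real.sqrt_nonneg s)]
  congr 1
  push_cast
  rw [mul_pow, ← Complex.ofReal_pow (Real.sqrt s), Real.sq_sqrt hs]
  ring

/-- The Lebesgue density of `heatGaussian d s`. -/
def gaussDensity (d : ℕ) (s : ℝ) (x : Space d) : ℝ :=
  (2 * Real.pi * s) ^ (-(d : ℝ) / 2) * Real.exp (-(1 / (2 * s)) * ‖x‖ ^ 2)

lemma continuous_gaussDensity (s : ℝ) : Continuous (gaussDensity d s) := by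
  unfold gaussDensity; fun_prop

lemma gaussDensity_pos {s : ℝ} (hs : 0 < s) (x : Space d) : 0 < gaussDensity d s x := by
  unfold gaussDensity; positivity

lemma integrable_gaussDensity {s : ℝ} (hs : 0 < s) : Integrable (gaussDensity d s) := by
  have h := GaussianFourier.integrable_cexp_neg_mul_sq_norm_add (V := Space d)
    (b := ((1 / (2 * s) : ℝ) : ℂ)) (by rw [Complex.ofReal_re]; positivity) 0 0
  have h2 := h.norm.const_mul ((2 * Real.pi * s) ^ (-(d : ℝ) / 2))
  refine h2.congr (.of_forall fun x => ?_)
  simp only [gaussDensity, Complex.norm_exp]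
  congr 2
  norm_cast
  simp

lemma heatGaussian_eq_withDensity {s : ℝ} (hs : 0 < s) :
    heatGaussian d s = volume.withDensity (fun x => ENNReal.ofReal (gaussDensity d s x)) := by
  have hI := integrable_gaussDensity (d := d) hs
  have : IsFiniteMeasure (volume.withDensity (fun x => ENNReal.ofReal (gaussDensity d s x))) :=
    isFiniteMeasure_withDensity_ofReal hI.2
  refine Measure.ext_of_charFun (funext fun t => ?_)
  rw [charFun_heatGaussian hs.le, charFun_apply,
    integral_withDensity_eq_integral_toReal_smul (by
      exact (continuous_gaussDensity s).measurable.ennreal_ofReal) (by simp)]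
  have h := GaussianFourier.integral_cexp_neg_mul_sq_norm_add (V := Space d)
    (b := ((1 / (2 * s) : ℝ) : ℂ)) (by rw [Complex.ofReal_re]; positivity) Complex.I t
  have e1 : ∀ x : Space d, (ENNReal.ofReal (gaussDensity d s x)).toReal •
      Complex.exp (⟪x, t⟫ * Complex.I) = (((2 * Real.pi * s) ^ (-(d : ℝ) / 2) : ℝ) : ℂ) *
      Complex.exp (-((1 / (2 * s) : ℝ) : ℂ) * ‖x‖ ^ 2 + Complex.I * ⟪t, x⟫) := by
    intro x
    rw [ENNReal.toReal_ofReal (gaussDensity_pos hs x).le, Complex.real_smul, gaussDensity,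
      Complex.ofReal_mul, mul_assoc, Complex.ofReal_exp, ← Complex.exp_add, real_inner_comm]
    push_cast
    ring_nf
  simp_rw [e1]
  rw [integral_const_mul, h]
  have hb : (Real.pi : ℂ) / ((1 / (2 * s) : ℝ) : ℂ) = ((2 * Real.pi * s : ℝ) : ℂ) := by
    push_cast; field_simp
  rw [hb]
  have hp : (0:ℝ) < 2 * Real.pi * s := by positivity
  have e2 : ((2 * Real.pi * s : ℝ) : ℂ) ^ ((Module.finrank ℝ (Space d) : ℂ) / 2) =
      (((2 * Real.pi * s) ^ ((d : ℝ) / 2) : ℝ) : ℂ) := by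
    rw [Complex.ofReal_cpow hp.le]; simp
  rw [e2, ← mul_assoc, ← Complex.ofReal_mul, ← Real.rpow_add hp]
  have e3 : -(d : ℝ) / 2 + (d : ℝ) / 2 = 0 := by ring
  rw [e3, Real.rpow_zero, Complex.ofReal_one, one_mul, Complex.I_sq]
  congr 1
  push_cast
  have : (s : ℂ) ≠ 0 := by exact_mod_cast hs.ne'
  field_simp
  ring

/-- The exponential weight by which observing `s X + √s ζ = y` reweights the law of `X`, up to
normalization. -/
def slWeight (s : ℝ) (y x : Space d) : ℝ := Real.exp (⟪y, x⟫ - s / 2 * ‖x‖ ^ 2)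

lemma slWeight_pos (s : ℝ) (y x : Space d) : 0 < slWeight s y x := Real.exp_pos _

lemma slWeight_le {s : ℝ} (hs : 0 < s) (y x : Space d) :
    slWeight s y x ≤ Real.exp (‖y‖ ^ 2 / (2 * s)) := by
  unfold slWeight
  gcongr
  have h1 := real_inner_le_norm y x
  have h2 : ‖y‖ * ‖x‖ ≤ ‖y‖ ^ 2 / (2 * s) + s / 2 * ‖x‖ ^ 2 := by
    have : ‖y‖ ^ 2 / (2 * s) + s / 2 * ‖x‖ ^ 2 - ‖y‖ * ‖x‖ = (‖y‖ - s * ‖x‖) ^ 2 / (2 * s) := by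
      field_simp; ring
    have h3 : 0 ≤ (‖y‖ - s * ‖x‖) ^ 2 / (2 * s) := by positivity
    linarith
  linarith

lemma continuous_slWeight : Continuous fun p : ℝ × Space d × Space d =>
    slWeight p.1 p.2.1 p.2.2 := by
  unfold slWeight; fun_prop

@[fun_prop]
lemma measurable_slWeight {α : Type*} [MeasurableSpace α] {s : α → ℝ} {y x : α → Space d}
    (hs : Measurable s) (hy : Measurable y) (hx : Measurable x) :
    Measurable fun a => slWeight (s a) (y a) (x a) := by
  unfold slWeight; fun_prop

/-- **Cameron–Martin**: reweighting `N(0, s Id)` by `slWeight s · x` translates it by `s x`. -/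
lemma lintegral_slWeight_heatGaussian {s : ℝ} (hs : 0 < s) (x : Space d) {F : Space d → ℝ≥0∞}
    (hF : Measurable F) :
    ∫⁻ y, F y * ENNReal.ofReal (slWeight s y x) ∂heatGaussian d s =
      ∫⁻ y, F (y + s • x) ∂heatGaussian d s := by
  have hm : Measurable fun x => ENNReal.ofReal (gaussDensity d s x) :=
    (continuous_gaussDensity s).measurable.ennreal_ofReal
  rw [heatGaussian_eq_withDensity hs, lintegral_withDensity_eq_lintegral_mul _ hm (by fun_prop),
    lintegral_withDensity_eq_lintegral_mul _ hm (by fun_prop),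
    ← lintegral_add_right_eq_self (μ := (volume : Measure (Space d)))  _ (s • x)]
  refine lintegral_congr fun y => ?_
  simp only [Pi.mul_apply]
  rw [mul_comm (F (y + s • x)), ← mul_assoc, ← ENNReal.ofReal_mul (gaussDensity_pos hs _).le]
  congr 2
  unfold gaussDensity slWeight
  rw [mul_assoc, ← Real.exp_add]
  congr 2
  rw [norm_add_sq_real, inner_add_left, inner_smul_left, inner_smul_right, norm_smul, mul_pow,
    real_inner_self_eq_norm_sq]
  simp
  field_simp
  ring

lemma lintegral_exp_inner_heatGaussian {s : ℝ} (hs : 0 < s) (x : Space d) :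
    ∫⁻ y, ENNReal.ofReal (Real.exp ⟪y, x⟫) ∂heatGaussian d s =
      ENNReal.ofReal (Real.exp (s / 2 * ‖x‖ ^ 2)) := by
  have h := lintegral_slWeight_heatGaussian hs x (F := fun _ => 1) (by fun_prop)
  simp only [one_mul, lintegral_const, measure_univ, mul_one] at h
  have e : ∀ y, ENNReal.ofReal (Real.exp ⟪y, x⟫) =
      ENNReal.ofReal (Real.exp (s / 2 * ‖x‖ ^ 2)) * ENNReal.ofReal (slWeight s y x) := by
    intro y
    rw [← ENNReal.ofReal_mul (by positivity), slWeight, ← Real.exp_add]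
    congr 2; ring
  simp_rw [e]
  rw [lintegral_const_mul _ (by fun_prop), h, mul_one]

lemma lintegral_heatGaussian_add {s δ : ℝ} (hs : 0 ≤ s) (hδ : 0 ≤ δ) {F : Space d → ℝ≥0∞}
    (hF : Measurable F) :
    ∫⁻ y, ∫⁻ z, F (y + z) ∂heatGaussian d δ ∂heatGaussian d s =
      ∫⁻ y, F y ∂heatGaussian d (s + δ) := by
  have : heatGaussian d (s + δ) = heatGaussian d s ∗ heatGaussian d δ := by
    refine Measure.ext_of_charFun (funext fun t => ?_)
    rw [charFun_conv, charFun_heatGaussian hs, charFun_heatGaussian hδ,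
      charFun_heatGaussian (by positivity), ← Complex.exp_add]
    congr 1
    push_cast; ring
  rw [this, Measure.lintegral_conv hF]

lemma lintegral_inner_sq_stdGaussian (v : Space d) :
    ∫⁻ z, ENNReal.ofReal (⟪v, z⟫ ^ 2) ∂stdGaussian (Space d) = ENNReal.ofReal (‖v‖ ^ 2) := by
  have h := variance_dual_stdGaussian (innerSL ℝ v : StrongDual ℝ (Space d))
  have hm : MemLp (innerSL ℝ v : StrongDual ℝ (Space d)) 2 (stdGaussian (Space d)) :=
    IsGaussian.memLp_dual _ _ _ (by simp)
  have h2 := evariance_eq_lintegral_ofReal (innerSL ℝ v : StrongDual ℝ (Space d))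
    (stdGaussian (Space d))
  rw [← ofReal_variance hm, h, integral_strongDual_stdGaussian] at h2
  simpa using h2.symm

lemma lintegral_norm_sq_stdGaussian_lt_top :
    ∫⁻ z, ENNReal.ofReal (‖z‖ ^ 2) ∂stdGaussian (Space d) < ∞ := by
  have h : MemLp (id : Space d → Space d) 2 (stdGaussian (Space d)) := IsGaussian.memLp_two_id
  exact (h.integrable_norm_pow (by norm_num)).lintegral_lt_top

/-! ### The Prékopa–Leindler inequality at midpoints -/

/-- One-dimensional Brunn–Minkowski at midpoints for compact sets: `K₁ + K₂` contains two translates of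
`K₁` and `K₂` that overlap in a single point. -/
lemma volume_add_volume_le_of_isCompact {K₁ K₂ C : Set ℝ} (h₁ : IsCompact K₁) (h₂ : IsCompact K₂)
    (n₁ : K₁.Nonempty) (n₂ : K₂.Nonempty)
    (hC : ∀ a ∈ K₁, ∀ b ∈ K₂, (a + b) / 2 ∈ C) :
    volume K₁ + volume K₂ ≤ 2 * volume C := by
  obtain ⟨M, hM, hMmax⟩ := h₁.exists_isGreatest n₁
  obtain ⟨m, hm, hmmin⟩ := h₂.exists_isLeast n₂
  -- Two translates of `K₁` and `K₂` inside `K₁ + K₂` that meet only in the point `M + m`.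
  set P : Set ℝ := (fun x => x + m) '' K₁
  set Q : Set ℝ := (fun x => x + M) '' K₂
  have hP : volume P = volume K₁ := by simp [P]
  have hQ : volume Q = volume K₂ := by simp [Q]
  have hQm : MeasurableSet Q := (h₂.image (by fun_prop)).measurableSet
  have hPQ : volume (P ∩ Q) = 0 := by
    refine measure_mono_null (t := {M + m}) ?_ (by simp)
    rintro x ⟨⟨a, ha, rfl⟩, ⟨b, hb, hab⟩⟩
    have h1 := hMmax ha
    have h2 := hmmin hb
    simp only at hab ⊢
    rw [mem_singleton_iff]; linarith
  have hun := measure_union_add_inter (μ := (volume : Measure ℝ)) P hQm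
  rw [hPQ, add_zero, hP, hQ] at hun
  rw [← hun]
  have hsub : P ∪ Q ⊆ (fun x : ℝ => 2⁻¹ * x) ⁻¹' C := by
    rintro x (⟨a, ha, rfl⟩ | ⟨b, hb, rfl⟩)
    · have := hC a ha m hm
      simpa [div_eq_inv_mul] using this
    · have := hC M hM b hb
      simpa [div_eq_inv_mul, add_comm] using this
  refine (measure_mono hsub).trans_eq ?_
  rw [Real.volume_preimage_mul_left (by norm_num)]
  simp

/-- One-dimensional Brunn–Minkowski at midpoints. -/
lemma volume_add_volume_le {A B C : Set ℝ} (hA : MeasurableSet A) (hB : MeasurableSet B)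
    (nA : A.Nonempty) (nB : B.Nonempty) (hC : ∀ a ∈ A, ∀ b ∈ B, (a + b) / 2 ∈ C) :
    volume A + volume B ≤ 2 * volume C := by
  obtain ⟨a₀, ha₀⟩ := nA
  obtain ⟨b₀, hb₀⟩ := nB
  have inner : ∀ {A : Set ℝ}, MeasurableSet A →
      volume A = ⨆ (K : Set ℝ) (_ : K ⊆ A ∧ IsCompact K), volume K := fun hA => by
    rw [hA.measure_eq_iSup_isCompact]; simp only [iSup_and]
  rw [inner hA, inner hB]
  refine ENNReal.biSup_add_biSup_le' ⟨∅, by simp⟩ ⟨∅, by simp⟩ ?_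
  rintro K₁ ⟨hK₁, cK₁⟩ K₂ ⟨hK₂, cK₂⟩
  refine le_trans (add_le_add (measure_mono (subset_insert a₀ K₁))
    (measure_mono (subset_insert b₀ K₂))) ?_
  exact volume_add_volume_le_of_isCompact (cK₁.insert a₀) (cK₂.insert b₀) ⟨a₀, by simp⟩
    ⟨b₀, by simp⟩ fun a ha b hb =>
      hC a (insert_subset ha₀ hK₁ ha) b (insert_subset hb₀ hK₂ hb)

lemma four_mul_mul_le_add_sq (p q : ℝ≥0∞) : 4 * (p * q) ≤ (p + q) ^ 2 := by
  wlog h : p ≤ q generalizing p q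
  · rw [mul_comm p, add_comm p]; exact this q p (le_of_not_ge h)
  obtain ⟨r, rfl⟩ := le_iff_exists_add.1 h
  calc 4 * (p * (p + r)) ≤ 4 * (p * (p + r)) + r ^ 2 := le_self_add
    _ = (p + (p + r)) ^ 2 := by ring

/-- The additive form of the Prékopa–Leindler inequality on the line, for functions with supremum one,
by the layer cake formula and Brunn–Minkowski for the superlevel sets. -/
lemma lintegral_add_le_of_midpoint {f g h : ℝ → ℝ} (hf : Measurable f) (hg : Measurable g)
    (hh : Measurable h) (f0 : ∀ x, 0 ≤ f x) (g0 : ∀ x, 0 ≤ g x) (h0 : ∀ x, 0 ≤ h x)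
    (f1 : ∀ x, f x ≤ 1) (g1 : ∀ x, g x ≤ 1)
    (fs : ∀ t < 1, ∃ x, t < f x) (gs : ∀ t < 1, ∃ x, t < g x)
    (hfg : ∀ x y, f x * g y ≤ h ((x + y) / 2) ^ 2) :
    (∫⁻ x, ENNReal.ofReal (f x)) + ∫⁻ x, ENNReal.ofReal (g x) ≤
      2 * ∫⁻ x, ENNReal.ofReal (h x) := by
  have key : ∀ f : ℝ → ℝ, Measurable f → (∀ x, 0 ≤ f x) → (∀ x, f x ≤ 1) →
      ∫⁻ x, ENNReal.ofReal (f x) = ∫⁻ t in Ioo 0 1, volume {x | t < f x} := by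
    intro f hf f0 f1
    rw [lintegral_eq_lintegral_meas_lt volume (.of_forall f0) hf.aemeasurable,
      ← Ioo_union_Ici_eq_Ioi (zero_lt_one (α := ℝ)), lintegral_union measurableSet_Ici]
    · have : ∫⁻ t in Ici (1 : ℝ), volume {x | t < f x} = 0 := by
        rw [setLIntegral_congr_fun (g := fun _ => 0) measurableSet_Ici]
        · simp
        · intro t ht
          have : {x | t < f x} = ∅ := by
            ext x; simpa using (f1 x).trans ht
          simp [this]
      rw [this, add_zero]
    · rw [Set.disjoint_left]; intro t ht ht'; exact absurd ht.2 (not_lt.2 ht')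
  have mm : ∀ f : ℝ → ℝ, Measurable (fun t => volume {x | t < f x}) := fun f =>
    Antitone.measurable fun s t hst => measure_mono fun x hx => lt_of_le_of_lt hst hx
  rw [key f hf f0 f1, key g hg g0 g1, lintegral_eq_lintegral_meas_lt volume (.of_forall h0)
    hh.aemeasurable, ← lintegral_add_left (mm f), ← lintegral_const_mul _ (mm h)]
  refine le_trans ?_ (lintegral_mono_set (Ioo_subset_Ioi_self : Ioo (0 : ℝ) 1 ⊆ Ioi 0))
  refine setLIntegral_mono ((mm h).const_mul 2) fun t ht => ?_
  refine volume_add_volume_le (measurableSet_lt measurable_const hf)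
    (measurableSet_lt measurable_const hg) (fs t ht.2) (gs t ht.2) ?_
  intro a ha b hb
  have h1 : t ^ 2 < h ((a + b) / 2) ^ 2 := by
    refine lt_of_lt_of_le ?_ (hfg a b)
    have ha' : t < f a := ha
    have hb' : t < g b := hb
    rw [sq]; exact mul_lt_mul'' ha' hb' ht.1.le ht.1.le
  exact lt_of_pow_lt_pow_left₀ 2 (h0 _) h1

/-- Normalizing both functions to supremum one reduces the multiplicative inequality to the additive
one, by the inequality between arithmetic and geometric mean. -/
lemma prekopa_leindler_real_of_bounded {f g h : ℝ → ℝ≥0∞} (hf : Measurable f) (hg : Measurable g)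
    (hh : Measurable h) (fb : ⨆ x, f x ≠ ∞) (gb : ⨆ x, g x ≠ ∞)
    (hfg : ∀ x y, f x * g y ≤ h ((x + y) / 2) ^ 2) :
    (∫⁻ x, f x) * ∫⁻ x, g x ≤ (∫⁻ x, h x) ^ 2 := by
  set a := ⨆ x, f x with ha
  set b := ⨆ x, g x with hb
  rcases eq_or_ne a 0 with ha0 | ha0
  · have : ∀ x, f x = 0 := by simpa [ha] using ha0
    simp [this]
  rcases eq_or_ne b 0 with hb0 | hb0
  · have : ∀ x, g x = 0 := by simpa [hb] using hb0
    simp [this]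
  obtain ⟨c, hc⟩ : ∃ c : ℝ≥0∞, c ^ 2 = a * b :=
    ⟨(a * b) ^ (2⁻¹ : ℝ), by rw [← ENNReal.rpow_natCast, ← ENNReal.rpow_mul]; simp⟩
  have hab0 : a * b ≠ 0 := mul_ne_zero ha0 hb0
  have habt : a * b ≠ ∞ := ENNReal.mul_ne_top fb gb
  have hc0 : c ≠ 0 := by rintro rfl; simp at hc; tauto
  have hct : c ≠ ∞ := by rintro rfl; simp at hc; exact habt hc.symm
  have fa : ∀ x, f x / a ≤ 1 := fun x => ENNReal.div_le_of_le_mul (by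
    rw [one_mul]; exact le_iSup f x)
  have ga : ∀ x, g x / b ≤ 1 := fun x => ENNReal.div_le_of_le_mul (by
    rw [one_mul]; exact le_iSup g x)
  have sup : ∀ (f : ℝ → ℝ≥0∞) (a : ℝ≥0∞), a = ⨆ x, f x → a ≠ 0 → a ≠ ∞ → (∀ x, f x / a ≤ 1) →
      ∀ t < (1 : ℝ), ∃ x, t < (f x / a).toReal := by
    intro f a ha ha0 hat hfa t ht
    have h1 : a * ENNReal.ofReal t < ⨆ x, f x := by
      rw [← ha]
      conv_rhs => rw [← mul_one a]
      exact ENNReal.mul_lt_mul_right ha0 hat (by simpa using ht)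
    obtain ⟨x, hx⟩ := lt_iSup_iff.1 h1
    refine ⟨x, ?_⟩
    rcases lt_or_ge t 0 with ht0 | ht0
    · exact ht0.trans_le ENNReal.toReal_nonneg
    refine (ENNReal.ofReal_lt_iff_lt_toReal ht0 (ne_top_of_le_ne_top (by simp) (hfa x))).1 ?_
    rwa [ENNReal.lt_div_iff_mul_lt (.inl ha0) (.inl hat), mul_comm]
  have main := lintegral_add_le_of_midpoint (f := fun x => (f x / a).toReal)
    (g := fun x => (g x / b).toReal) (h := fun x => (min (h x / c) 1).toReal)
    (by fun_prop) (by fun_prop) (by fun_prop) (fun _ => ENNReal.toReal_nonneg)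
    (fun _ => ENNReal.toReal_nonneg) (fun _ => ENNReal.toReal_nonneg)
    (fun x => ENNReal.toReal_mono (by simp) (fa x)) (fun x => ENNReal.toReal_mono (by simp) (ga x))
    (sup f a ha ha0 fb fa) (sup g b hb hb0 gb ga) (by
      intro x y
      rw [← ENNReal.toReal_mul, ← ENNReal.toReal_pow]
      refine ENNReal.toReal_mono (by simp) ?_
      have e : f x / a * (g y / b) = f x * g y / c ^ 2 := by
        rw [hc, div_eq_mul_inv, div_eq_mul_inv, div_eq_mul_inv,
          ENNReal.mul_inv (.inl ha0) (.inl fb)]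
        ring
      rcases le_total (h ((x + y) / 2) / c) 1 with h1 | h1
      · rw [min_eq_left h1, e, div_eq_mul_inv (h _), mul_pow, ← ENNReal.inv_pow, ← div_eq_mul_inv]
        gcongr
        exact hfg x y
      · rw [min_eq_right h1, one_pow]
        exact mul_le_one' (fa x) (ga y))
  have fin : ∀ {u : ℝ≥0∞}, u ≤ 1 → ENNReal.ofReal u.toReal = u := fun hu =>
    ENNReal.ofReal_toReal (ne_top_of_le_ne_top (by simp) hu)
  simp only [fin (fa _), fin (ga _), fin (min_le_right _ _)] at main
  have main2 : (∫⁻ x, f x) / a + (∫⁻ x, g x) / b ≤ 2 * ((∫⁻ x, h x) / c) := by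
    simp only [div_eq_mul_inv] at main ⊢
    rw [lintegral_mul_const _ hf, lintegral_mul_const _ hg] at main
    refine main.trans ?_
    rw [← lintegral_mul_const _ hh]
    gcongr with x
    exact min_le_left _ _
  have main3 : 4 * ((∫⁻ x, f x) / a * ((∫⁻ x, g x) / b)) ≤ 4 * ((∫⁻ x, h x) / c) ^ 2 := by
    refine (four_mul_mul_le_add_sq _ _).trans ?_
    calc _ ≤ (2 * ((∫⁻ x, h x) / c)) ^ 2 := by gcongr
      _ = _ := by ring
  have main4 := (ENNReal.mul_le_mul_iff_right (by norm_num) (by norm_num)).1 main3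
  have e : (∫⁻ x, f x) / a * ((∫⁻ x, g x) / b) = ((∫⁻ x, f x) * (∫⁻ x, g x)) / c ^ 2 := by
    rw [hc, div_eq_mul_inv, div_eq_mul_inv, div_eq_mul_inv,
      ENNReal.mul_inv (.inl ha0) (.inl fb)]
    ring
  rw [e, div_eq_mul_inv (∫⁻ x, h x), mul_pow, ← ENNReal.inv_pow, ← div_eq_mul_inv] at main4
  rw [div_eq_mul_inv, div_eq_mul_inv] at main4
  exact (ENNReal.mul_le_mul_iff_left (by simpa using hct) (by simpa using hc0)).1 main4

lemma prekopa_leindler_real {f g h : ℝ → ℝ≥0∞} (hf : Measurable f) (hg : Measurable g)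
    (hh : Measurable h) (hfg : ∀ x y, f x * g y ≤ h ((x + y) / 2) ^ 2) :
    (∫⁻ x, f x) * ∫⁻ x, g x ≤ (∫⁻ x, h x) ^ 2 := by
  have trunc : ∀ f : ℝ → ℝ≥0∞, Measurable f →
      ∫⁻ x, f x = ⨆ k : ℕ, ∫⁻ x, min (f x) k := by
    intro f hf
    rw [← lintegral_iSup (by fun_prop)]
    · refine lintegral_congr fun x => ?_
      rw [← inf_iSup_eq, ENNReal.iSup_natCast]; simp
    · intro k l hkl x
      exact min_le_min_left _ (by exact_mod_cast hkl)
  rw [trunc f hf, trunc g hg, ENNReal.iSup_mul]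
  refine iSup_le fun k => ?_
  rw [ENNReal.mul_iSup]
  refine iSup_le fun l => ?_
  have bd : ∀ (f : ℝ → ℝ≥0∞) (k : ℕ), ⨆ x, min (f x) (k : ℝ≥0∞) ≠ ∞ := fun f k =>
    ne_top_of_le_ne_top (ENNReal.natCast_ne_top k) (iSup_le fun x => min_le_right _ _)
  exact prekopa_leindler_real_of_bounded (by fun_prop) (by fun_prop) hh (bd f k) (bd g l)
    fun x y => (mul_le_mul' (min_le_left _ _) (min_le_left _ _)).trans (hfg x y)

/-- Tensorization: the integrals over the last `n` coordinates satisfy the one-dimensional hypothesis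
by induction. -/
lemma prekopa_leindler_pi (n : ℕ) {f g h : (Fin n → ℝ) → ℝ≥0∞} (hf : Measurable f)
    (hg : Measurable g) (hh : Measurable h)
    (hfg : ∀ x y, f x * g y ≤ h ((2⁻¹ : ℝ) • (x + y)) ^ 2) :
    (∫⁻ x, f x) * ∫⁻ x, g x ≤ (∫⁻ x, h x) ^ 2 := by
  induction n with
  | zero =>
    simp only [Measure.volume_pi_eq_dirac 0, lintegral_dirac]
    simpa using hfg 0 0
  | succ n ih =>
    have e := (volume_preserving_piFinSuccAbove (fun _ : Fin (n + 1) => ℝ) 0).symm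
    have split : ∀ f : (Fin (n + 1) → ℝ) → ℝ≥0∞, Measurable f →
        ∫⁻ x, f x = ∫⁻ t : ℝ, ∫⁻ x : Fin n → ℝ, f (Fin.cons t x) := by
      intro f hf
      rw [← e.lintegral_comp hf, Measure.volume_eq_prod, lintegral_prod _ (by
        exact (hf.comp e.measurable).aemeasurable)]
      simp [MeasurableEquiv.piFinSuccAbove, Fin.insertNthEquiv]
    have mc : Measurable (fun p : ℝ × (Fin n → ℝ) => (Fin.cons p.1 p.2 : Fin (n + 1) → ℝ)) := by
      refine measurable_pi_lambda _ fun i => ?_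
      refine Fin.cases ?_ (fun j => ?_) i
      · simpa using measurable_fst
      · exact (measurable_pi_apply j).comp measurable_snd
    rw [split f hf, split g hg, split h hh]
    have ms : ∀ f : (Fin (n + 1) → ℝ) → ℝ≥0∞, Measurable f →
        Measurable fun t : ℝ => ∫⁻ x : Fin n → ℝ, f (Fin.cons t x) := fun f hf =>
      (hf.comp mc).lintegral_prod_right'
    have mt : ∀ f : (Fin (n + 1) → ℝ) → ℝ≥0∞, Measurable f → ∀ t : ℝ,
        Measurable fun x : Fin n → ℝ => f (Fin.cons t x) := fun f hf t =>
      (hf.comp mc).comp measurable_prodMk_left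
    refine prekopa_leindler_real (ms f hf) (ms g hg) (ms h hh) fun t u => ?_
    refine ih (mt f hf t) (mt g hg u) (mt h hh _) fun x y => ?_
    refine (hfg _ _).trans_eq ?_
    congr 2
    ext i
    refine Fin.cases ?_ (fun j => ?_) i
    · simp; ring
    · simp; ring

/-- The **Prékopa–Leindler inequality** at midpoints in Euclidean space. -/
theorem prekopa_leindler {d : ℕ} {f g h : Space d → ℝ≥0∞} (hf : Measurable f)
    (hg : Measurable g) (hh : Measurable h)
    (hfg : ∀ x y, f x * g y ≤ h ((2⁻¹ : ℝ) • (x + y)) ^ 2) :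
    (∫⁻ x, f x) * ∫⁻ x, g x ≤ (∫⁻ x, h x) ^ 2 := by
  have e := PiLp.volume_preserving_toLp (Fin d)
  rw [← e.lintegral_comp hf, ← e.lintegral_comp hg, ← e.lintegral_comp hh]
  refine prekopa_leindler_pi d (hf.comp e.measurable) (hg.comp e.measurable)
    (hh.comp e.measurable) fun x y => ?_
  exact hfg _ _

/-! ### Log-Laplace transforms of the localized measures -/

/-- Smoothness enters the argument only through this bound on second differences. -/
lemma IsSmoothWith.abs_add_sub_two_mul_le {L : ℝ} {V : Space d → ℝ} (hV : IsSmoothWith L V)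
    (c h : Space d) : |V (c + h) + V (c - h) - 2 * V c| ≤ L * ‖h‖ ^ 2 := by
  obtain ⟨hd, hL⟩ := hV
  set φ : ℝ → ℝ := fun t => V (c + t • h) + V (c - t • h) - 2 * V c
  have hφ : ∀ t, HasDerivAt φ (⟪∇ V (c + t • h) - ∇ V (c - t • h), h⟫) t := by
    intro t
    have h1 : HasDerivAt (fun t : ℝ => V (c + t • h)) (⟪∇ V (c + t • h), h⟫) t := by
      have := (hd (c + t • h)).hasGradientAt.hasFDerivAt.comp_hasDerivAt t
        (((hasDerivAt_id t).smul_const h).const_add c)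
      simpa [Function.comp_def] using this
    have h2 : HasDerivAt (fun t : ℝ => V (c - t • h)) (-⟪∇ V (c - t • h), h⟫) t := by
      have := (hd (c - t • h)).hasGradientAt.hasFDerivAt.comp_hasDerivAt t
        (((hasDerivAt_id t).smul_const h).const_sub c)
      simpa [Function.comp_def] using this
    have := (h1.add h2).sub_const (2 * V c)
    rw [inner_sub_left, sub_eq_add_neg]
    exact this
  have key := image_norm_le_of_norm_deriv_right_le_deriv_boundary (f := φ) (a := 0) (b := 1)
    (f' := fun t => ⟪∇ V (c + t • h) - ∇ V (c - t • h), h⟫)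
    (B := fun t => L * ‖h‖ ^ 2 * t ^ 2) (B' := fun t => L * ‖h‖ ^ 2 * (2 * t))
    (fun t _ => (hφ t).continuousAt.continuousWithinAt) (fun t _ => (hφ t).hasDerivWithinAt)
    (by simp [φ]; ring_nf) (fun t => by simpa using (hasDerivAt_pow 2 t).const_mul _)
    (fun t ht => by
      refine (norm_inner_le_norm _ _).trans ?_
      refine (mul_le_mul_of_nonneg_right (hL _ _) (norm_nonneg h)).trans_eq ?_
      have : c + t • h - (c - t • h) = (2 * t) • h := by module
      rw [this, norm_smul, Real.norm_of_nonneg (by linarith [ht.1])]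
      ring)
  simpa [φ] using key (right_mem_Icc.2 zero_le_one)

/-- The partition function of the localization of `μ` at time `s` and observation `y`; up to a
Gaussian factor it is the density of `s X + √s ζ` with `X ∼ μ`. -/
def slPartition (μ : Measure (Space d)) (s : ℝ) (y : Space d) : ℝ := ∫ x, slWeight s y x ∂μ

lemma integrable_slWeight {μ : Measure (Space d)} [IsFiniteMeasure μ] {s : ℝ} (hs : 0 < s)
    (y : Space d) : Integrable (slWeight s y) μ :=
  Integrable.of_bound (by fun_prop) (Real.exp (‖y‖ ^ 2 / (2 * s))) (.of_forall fun x => by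
    rw [Real.norm_of_nonneg (slWeight_pos s y x).le]; exact slWeight_le hs y x)

lemma slPartition_pos {μ : Measure (Space d)} [IsProbabilityMeasure μ] {s : ℝ} (hs : 0 < s)
    (y : Space d) : 0 < slPartition μ s y :=
  integral_exp_pos (integrable_slWeight hs y)

lemma ofReal_slPartition {μ : Measure (Space d)} [IsFiniteMeasure μ] {s : ℝ} (hs : 0 < s)
    (y : Space d) :
    ENNReal.ofReal (slPartition μ s y) = ∫⁻ x, ENNReal.ofReal (slWeight s y x) ∂μ :=
  ofReal_integral_eq_lintegral_ofReal (integrable_slWeight hs y)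
    (.of_forall fun x => (slWeight_pos s y x).le)

/-- The logarithm of the partition function at time `s` has second differences at most `c ‖h‖²`.
Equivalently, every localization of `μ` at time `s` has covariance at most `c • Id`. -/
def TiltBound (μ : Measure (Space d)) (s c : ℝ) : Prop :=
  ∀ y h, slPartition μ s (y + h) * slPartition μ s (y - h) ≤
    Real.exp (c * ‖h‖ ^ 2) * slPartition μ s y ^ 2

/-- For `s > L` the localized measures are `(s - L)`-strongly log-concave; the covariance bound
`1 / (s - L)` is then a case of the Prékopa–Leindler inequality. -/
theorem tiltBound_of_isSmoothWith {μ : Measure (Space d)} [IsProbabilityMeasure μ] {V : Space d → ℝ}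
    (hμ : HasPotential μ V) {L s : ℝ} (hV : IsSmoothWith L V) (hs : 0 < s) (hL : L < s) :
    TiltBound μ s (1 / (s - L)) := by
  obtain ⟨Z, hZ, hμ⟩ := hμ
  intro y h
  have hVm : Measurable V := hV.1.continuous.measurable
  have rep : ∀ y, ENNReal.ofReal (slPartition μ s y) =
      ∫⁻ x, ENNReal.ofReal (Real.exp (-V x) / Z * slWeight s y x) := by
    intro y
    rw [ofReal_slPartition hs, hμ, lintegral_withDensity_eq_lintegral_mul _ (by fun_prop)
      (by fun_prop)]
    refine lintegral_congr fun x => ?_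
    rw [Pi.mul_apply, ← ENNReal.ofReal_mul (by positivity)]
  have pl := prekopa_leindler (d := d)
    (f := fun x => ENNReal.ofReal (Real.exp (-V x) / Z * slWeight s (y + h) x))
    (g := fun x => ENNReal.ofReal (Real.exp (-V x) / Z * slWeight s (y - h) x))
    (h := fun x => ENNReal.ofReal (Real.exp (1 / (s - L) * ‖h‖ ^ 2 / 2)) *
      ENNReal.ofReal (Real.exp (-V x) / Z * slWeight s y x))
    (by fun_prop) (by fun_prop) (by fun_prop) (by
      intro x x'
      set p := (2⁻¹ : ℝ) • (x + x') with hp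
      set q := (2⁻¹ : ℝ) • (x - x') with hq
      have hx : x = p + q := by rw [hp, hq]; module
      have hx' : x' = p - q := by rw [hp, hq]; module
      rw [← ENNReal.ofReal_mul (mul_nonneg (by positivity) (slWeight_pos _ _ _).le),
        ← ENNReal.ofReal_mul (by positivity), ← ENNReal.ofReal_pow (mul_nonneg (by positivity) (mul_nonneg
        (by positivity) (slWeight_pos _ _ _).le))]
      refine ENNReal.ofReal_le_ofReal ?_
      have e1 : Real.exp (-V x) / Z * slWeight s (y + h) x * (Real.exp (-V x') / Z *
          slWeight s (y - h) x') = Real.exp (-V x - V x' + (⟪y + h, x⟫ - s / 2 * ‖x‖ ^ 2) +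
            (⟪y - h, x'⟫ - s / 2 * ‖x'‖ ^ 2)) / Z ^ 2 := by
        rw [Real.exp_add, Real.exp_add, sub_eq_add_neg (-V x), Real.exp_add]
        unfold slWeight; field_simp
      have e2 : (Real.exp (1 / (s - L) * ‖h‖ ^ 2 / 2) * (Real.exp (-V p) / Z *
          slWeight s y p)) ^ 2 = Real.exp (1 / (s - L) * ‖h‖ ^ 2 + (-2 * V p) +
            2 * (⟪y, p⟫ - s / 2 * ‖p‖ ^ 2)) / Z ^ 2 := by
        rw [mul_pow, mul_pow, div_pow, ← Real.exp_nat_mul, ← Real.exp_nat_mul, slWeight,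
          ← Real.exp_nat_mul, Real.exp_add, Real.exp_add]
        push_cast
        ring_nf
      rw [e1, e2]
      refine div_le_div_of_nonneg_right (Real.exp_le_exp.2 ?_) (by positivity)
      have hsd := (abs_le.1 (hV.abs_add_sub_two_mul_le p q)).1
      rw [← hx, ← hx'] at hsd
      have hn : ‖x‖ ^ 2 + ‖x'‖ ^ 2 = 2 * ‖p‖ ^ 2 + 2 * ‖q‖ ^ 2 := by
        rw [hx, hx', norm_add_sq_real, norm_sub_sq_real]; ring
      have hi : ⟪y + h, x⟫ + ⟪y - h, x'⟫ = 2 * ⟪y, p⟫ + 2 * ⟪h, q⟫ := by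
        rw [hx, hx', inner_add_left, inner_sub_left, inner_add_right, inner_add_right,
          inner_sub_right, inner_sub_right]; ring
      have hm : 0 < s - L := by linarith
      have hy : 2 * ⟪h, q⟫ ≤ 1 / (s - L) * ‖h‖ ^ 2 + (s - L) * ‖q‖ ^ 2 := by
        have h1 := real_inner_le_norm h q
        have h2 : 1 / (s - L) * ‖h‖ ^ 2 + (s - L) * ‖q‖ ^ 2 - 2 * (‖h‖ * ‖q‖) =
          (‖h‖ - (s - L) * ‖q‖) ^ 2 / (s - L) := by field_simp; ring
        have h3 : 0 ≤ (‖h‖ - (s - L) * ‖q‖) ^ 2 / (s - L) := by positivity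
        linarith
      nlinarith)
  rw [lintegral_const_mul _ (by fun_prop), ← rep, ← rep, ← rep,
    ← ENNReal.ofReal_mul (slPartition_pos hs _).le, ← ENNReal.ofReal_mul (by positivity),
    ← ENNReal.ofReal_pow (mul_nonneg (by positivity) (slPartition_pos hs _).le),
    ENNReal.ofReal_le_ofReal_iff (by positivity)] at pl
  refine pl.trans_eq ?_
  rw [mul_pow, ← Real.exp_nat_mul]
  push_cast; ring_nf

lemma map_add_gaussian_eq_withDensity {μ : Measure (Space d)} [IsProbabilityMeasure μ] {v : ℝ}
    (hv : 0 < v) (a : ℝ) :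
    (μ.prod (stdGaussian (Space d))).map (fun p => a • p.1 + Real.sqrt v • p.2) =
      volume.withDensity (fun z => ∫⁻ x, ENNReal.ofReal (gaussDensity d v (z - a • x)) ∂μ) := by
  have hgm : Measurable (gaussDensity d v) := (continuous_gaussDensity v).measurable
  refine Measure.ext_of_lintegral _ fun F hF => ?_
  rw [lintegral_map hF (by fun_prop), lintegral_prod _ (by fun_prop),
    lintegral_withDensity_eq_lintegral_mul _ (by
      exact Measurable.lintegral_prod_right' (f := fun p : Space d × Space d =>
        ENNReal.ofReal (gaussDensity d v (p.1 - a • p.2))) (by fun_prop)) hF]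
  calc ∫⁻ x, ∫⁻ z, F (a • x + Real.sqrt v • z) ∂stdGaussian (Space d) ∂μ
      = ∫⁻ x, ∫⁻ y, F y * ENNReal.ofReal (gaussDensity d v (y - a • x)) ∂volume ∂μ := by
        apply lintegral_congr
        intro x
        rw [← lintegral_heatGaussian v (F := fun y => F (a • x + y)) (by fun_prop),
          heatGaussian_eq_withDensity hv,
          lintegral_withDensity_eq_lintegral_mul _ (by fun_prop) (by fun_prop),
          ← lintegral_add_right_eq_self (μ := (volume : Measure (Space d)))
            (fun y => F y * ENNReal.ofReal (gaussDensity d v (y - a • x))) (a • x)]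
        refine lintegral_congr fun y => ?_
        simp [mul_comm, add_comm]
    _ = ∫⁻ y, ∫⁻ x, F y * ENNReal.ofReal (gaussDensity d v (y - a • x)) ∂μ := by
        exact lintegral_lintegral_swap (by fun_prop)
    _ = _ := by
        refine lintegral_congr fun y => ?_
        rw [lintegral_const_mul _ (by fun_prop), Pi.mul_apply, mul_comm]

lemma gaussDensity_le {s : ℝ} (hs : 0 < s) (x : Space d) :
    gaussDensity d s x ≤ (2 * Real.pi * s) ^ (-(d : ℝ) / 2) := by
  unfold gaussDensity
  refine mul_le_of_le_one_right (by positivity) (Real.exp_le_one_iff.2 ?_)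
  have : 0 ≤ 1 / (2 * s) * ‖x‖ ^ 2 := by positivity
  linarith

/-- Tweedie's formula in second-difference form: smoothness of `-log` of the density of the
Ornstein–Uhlenbeck marginal bounds the covariance of the localized measures. -/
theorem tiltBound_of_ouSmooth {μ : Measure (Space d)} [IsProbabilityMeasure μ] {Lt : ℝ → ℝ}
    (hμ : OUSmooth μ Lt) {s : ℝ} (hs : 0 < s) :
    TiltBound μ s (1 / s + slSmoothness Lt s / (s * (1 + s))) := by
  set t := Real.log (Real.sqrt ((s + 1) / s)) with ht
  have hs1 : 0 < s + 1 := by linarith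
  have hq : 0 < (s + 1) / s := by positivity
  have hq1 : 1 ≤ (s + 1) / s := by rw [le_div_iff₀ hs]; linarith
  have ht0 : 0 ≤ t := Real.log_nonneg (Real.one_le_sqrt.2 hq1)
  have het : Real.exp (-t) = (Real.sqrt ((s + 1) / s))⁻¹ := by
    rw [Real.exp_neg, ht, Real.exp_log (Real.sqrt_pos.2 hq)]
  set a := Real.exp (-t) with ha
  have hapos : 0 < a := Real.exp_pos _
  have ha2 : a ^ 2 = s / (s + 1) := by
    rw [het, inv_pow, Real.sq_sqrt hq.le, inv_div]
  have hv : 1 - Real.exp (-2 * t) = 1 / (s + 1) := by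
    have : Real.exp (-2 * t) = a ^ 2 := by rw [ha, ← Real.exp_nat_mul]; congr 1; push_cast; ring
    rw [this, ha2]; field_simp; ring
  set v := 1 / (s + 1) with hvdef
  have hvpos : 0 < v := by positivity
  obtain ⟨U, ⟨Z, hZ, hU⟩, hUs⟩ := hμ t ht0
  change IsSmoothWith (slSmoothness Lt s) U at hUs
  set ℓ := slSmoothness Lt s
  rw [ouMarginal, hv, map_add_gaussian_eq_withDensity hvpos] at hU
  set q : Space d → ℝ := fun z => ∫ x, gaussDensity d v (z - a • x) ∂μ with hqdef
  have hgm := continuous_gaussDensity (d := d) v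
  have hbound : ∀ z x : Space d, ‖gaussDensity d v (z - a • x)‖ ≤
      (2 * Real.pi * v) ^ (-(d : ℝ) / 2) := fun z x => by
    rw [Real.norm_of_nonneg (gaussDensity_pos hvpos _).le]; exact gaussDensity_le hvpos _
  have hqi : ∀ z, Integrable (fun x => gaussDensity d v (z - a • x)) μ := fun z =>
    Integrable.of_bound (by fun_prop) _ (.of_forall (hbound z))
  have hqc : Continuous q := by
    refine continuous_of_dominated (bound := fun _ => (2 * Real.pi * v) ^ (-(d : ℝ) / 2))
      (fun z => by fun_prop) (fun z => .of_forall (hbound z)) (integrable_const _)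
      (.of_forall fun x => by fun_prop)
  have hq' : ∀ z, ∫⁻ x, ENNReal.ofReal (gaussDensity d v (z - a • x)) ∂μ =
      ENNReal.ofReal (q z) := fun z =>
    (ofReal_integral_eq_lintegral_ofReal (hqi z)
      (.of_forall fun x => (gaussDensity_pos hvpos _).le)).symm
  rw [show (fun z => ∫⁻ x, ENNReal.ofReal (gaussDensity d v (z - a • x)) ∂μ) =
    fun z => ENNReal.ofReal (q z) from funext hq'] at hU
  have hUm : Measurable U := hUs.1.continuous.measurable
  have hqpos : ∀ z, 0 ≤ q z := fun z => integral_nonneg fun x => (gaussDensity_pos hvpos _).le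
  have hae : (fun z => Real.exp (-U z) / Z) =ᵐ[volume] q := by
    have h1 := (withDensity_eq_iff_of_sigmaFinite (μ := (volume : Measure (Space d)))
      (by exact hqc.measurable.ennreal_ofReal.aemeasurable) (by
        exact Measurable.aemeasurable (by fun_prop))).1 hU
    filter_upwards [h1] with z hz
    exact ((ENNReal.ofReal_eq_ofReal_iff (hqpos z) (by positivity)).1 hz).symm
  have heq : (fun z => Real.exp (-U z) / Z) = q :=
    (Continuous.ae_eq_iff_eq volume (by
      have := hUs.1.continuous; fun_prop) hqc).1 hae
  -- `q` is, up to an explicit Gaussian factor, a rescaling of the partition function.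
  set C := (2 * Real.pi * v) ^ (-(d : ℝ) / 2)
  have hC : 0 < C := by positivity
  set κ := a * (s + 1) with hκ
  have hκpos : 0 < κ := by positivity
  have hκ2 : κ ^ 2 = s * (s + 1) := by rw [hκ, mul_pow, ha2]; field_simp
  have hD : ∀ z, Real.exp (-U z) / Z =
      C * Real.exp (-((s + 1) / 2) * ‖z‖ ^ 2) * slPartition μ s (κ • z) := by
    intro z
    rw [congrFun heq z, slPartition, ← integral_const_mul]
    refine integral_congr_ae (.of_forall fun x => ?_)
    simp only [gaussDensity, slWeight]
    change C * _ = _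
    rw [mul_assoc C, ← Real.exp_add]
    congr 2
    rw [norm_sub_sq_real, inner_smul_right, inner_smul_left, norm_smul, mul_pow,
      Real.norm_of_nonneg hapos.le, ha2, hvdef, hκ]
    simp
    field_simp
    ring
  intro y h
  set z := κ⁻¹ • y with hz
  set k := κ⁻¹ • h with hk
  have ey : y = κ • z := by rw [hz, smul_smul, mul_inv_cancel₀ hκpos.ne', one_smul]
  have eh : h = κ • k := by rw [hk, smul_smul, mul_inv_cancel₀ hκpos.ne', one_smul]
  have hD' : ∀ z, slPartition μ s (κ • z) =
      Real.exp (-U z + (s + 1) / 2 * ‖z‖ ^ 2) / (Z * C) := by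
    intro z
    have h1 := hD z
    have h2 : Real.exp (-((s + 1) / 2) * ‖z‖ ^ 2) * Real.exp ((s + 1) / 2 * ‖z‖ ^ 2) = 1 := by
      rw [← Real.exp_add]; simp
    rw [div_eq_iff hZ.ne'] at h1
    rw [Real.exp_add, eq_div_iff (by positivity), h1]
    linear_combination (-slPartition μ s (κ • z) * (Z * C)) * h2
  rw [ey, eh, ← smul_add, ← smul_sub, hD', hD', hD', norm_smul, mul_pow,
    Real.norm_of_nonneg hκpos.le, hκ2, div_mul_div_comm, ← Real.exp_add, div_pow,
    ← Real.exp_nat_mul, ← mul_div_assoc, ← Real.exp_add, ← sq]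
  refine div_le_div_of_nonneg_right (Real.exp_le_exp.2 ?_) (by positivity)
  have hsd := (abs_le.1 (hUs.abs_add_sub_two_mul_le z k)).1
  have hn : ‖z + k‖ ^ 2 + ‖z - k‖ ^ 2 = 2 * ‖z‖ ^ 2 + 2 * ‖k‖ ^ 2 := by
    rw [norm_add_sq_real, norm_sub_sq_real]; ring
  have e : (1 / s + ℓ / (s * (1 + s))) * (s * (s + 1) * ‖k‖ ^ 2) = (s + 1 + ℓ) * ‖k‖ ^ 2 := by
    field_simp; ring
  rw [e]
  push_cast
  nlinarith

/-- A density with large value at `x` is large at `x + z` or `x - z` for every `z` in the unit ball,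
by the bound on second differences; its total mass then bounds its value at `x`. -/
lemma exists_density_le {μ : Measure (Space d)} [IsProbabilityMeasure μ] {V : Space d → ℝ}
    {L Z : ℝ} (hV : IsSmoothWith L V) (hZ : 0 < Z)
    (hμ : μ = volume.withDensity (fun x => ENNReal.ofReal (Real.exp (-V x) / Z))) :
    ∃ M : ℝ, 0 < M ∧ ∀ x, Real.exp (-V x) / Z ≤ M := by
  have hVm : Measurable V := hV.1.continuous.measurable
  have hρ : Measurable fun x => ENNReal.ofReal (Real.exp (-V x) / Z) := by fun_prop
  set B : Set (Space d) := Metric.closedBall 0 1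
  have hvol0 : volume B ≠ 0 := (Metric.measure_closedBall_pos volume 0 one_pos).ne'
  have hvolt : volume B ≠ ∞ := measure_closedBall_lt_top.ne
  have hv : 0 < (volume B).toReal := ENNReal.toReal_pos hvol0 hvolt
  refine ⟨Real.exp (|L| / 2) / (volume B).toReal, by positivity, fun x => ?_⟩
  have htot : ∫⁻ z, ENNReal.ofReal (Real.exp (-V z) / Z) = 1 := by
    have : μ univ = 1 := measure_univ
    rwa [hμ, withDensity_apply _ MeasurableSet.univ, setLIntegral_univ] at this
  have h1 : ∫⁻ z, ENNReal.ofReal (Real.exp (-V (x + z)) / Z) = 1 := by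
    rw [lintegral_add_left_eq_self (μ := (volume : Measure (Space d)))
      (fun z => ENNReal.ofReal (Real.exp (-V z) / Z)) x]
    exact htot
  have h2 : ∫⁻ z, ENNReal.ofReal (Real.exp (-V (x - z)) / Z) = 1 := by
    rw [lintegral_sub_left_eq_self (μ := (volume : Measure (Space d)))
      (fun z => ENNReal.ofReal (Real.exp (-V z) / Z)) x]
    exact htot
  have h3 : ∫⁻ z in B, 2 * ENNReal.ofReal (Real.exp (-V x - |L| / 2) / Z) ≤ 2 := by
    calc _ ≤ ∫⁻ z in B, (ENNReal.ofReal (Real.exp (-V (x + z)) / Z) +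
          ENNReal.ofReal (Real.exp (-V (x - z)) / Z)) := by
            refine setLIntegral_mono (by fun_prop) fun z hz => ?_
            have hz1 : ‖z‖ ≤ 1 := by simpa [B] using hz
            have hsd := (abs_le.1 (hV.abs_add_sub_two_mul_le x z)).2
            have hz2 : L * ‖z‖ ^ 2 ≤ |L| := by
              calc L * ‖z‖ ^ 2 ≤ |L| * ‖z‖ ^ 2 := by gcongr; exact le_abs_self L
                _ ≤ |L| * 1 := by gcongr; exact pow_le_one₀ (norm_nonneg z) hz1
                _ = |L| := mul_one _
            have e0 : 2 * ENNReal.ofReal (Real.exp (-V x - |L| / 2) / Z) =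
                ENNReal.ofReal (2 * (Real.exp (-V x - |L| / 2) / Z)) := by
              rw [ENNReal.ofReal_mul (by norm_num), ENNReal.ofReal_ofNat]
            rw [← ENNReal.ofReal_add (by positivity) (by positivity), e0]
            refine ENNReal.ofReal_le_ofReal ?_
            rw [← add_div, ← mul_div_assoc]
            gcongr
            -- the arithmetic mean dominates the geometric mean
            have am : 2 * Real.exp ((-V (x + z) + -V (x - z)) / 2) ≤
                Real.exp (-V (x + z)) + Real.exp (-V (x - z)) := by
              have e1 := Real.exp_nat_mul (-V (x + z) / 2) 2
              have e2 := Real.exp_nat_mul (-V (x - z) / 2) 2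
              have e3 := Real.exp_add (-V (x + z) / 2) (-V (x - z) / 2)
              push_cast at e1 e2
              rw [mul_div_cancel₀ _ (two_ne_zero)] at e1 e2
              rw [e1, e2, add_div, e3]
              nlinarith [sq_nonneg (Real.exp (-V (x + z) / 2) - Real.exp (-V (x - z) / 2))]
            refine le_trans ?_ am
            gcongr
            linarith
      _ ≤ ∫⁻ z, (ENNReal.ofReal (Real.exp (-V (x + z)) / Z) +
          ENNReal.ofReal (Real.exp (-V (x - z)) / Z)) := setLIntegral_le_lintegral _ _
      _ = 2 := by rw [lintegral_add_left (by fun_prop), h1, h2]; norm_num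
  rw [setLIntegral_const, mul_assoc] at h3
  have h4 : ENNReal.ofReal (Real.exp (-V x - |L| / 2) / Z) * volume B ≤ 1 := by
    refine (ENNReal.mul_le_mul_iff_right (a := 2) (by norm_num) (by norm_num)).1 ?_
    simpa using h3
  rw [← ENNReal.ofReal_toReal hvolt, ← ENNReal.ofReal_mul (by positivity),
    ENNReal.ofReal_le_one, sub_eq_add_neg, Real.exp_add, Real.exp_neg (|L| / 2)] at h4
  rw [le_div_iff₀ hv]
  have h5 := mul_le_mul_of_nonneg_right h4 (Real.exp_pos (|L| / 2)).le
  rw [one_mul] at h5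
  refine le_trans (le_of_eq ?_) h5
  field_simp

/-! ### A fundamental theorem of calculus for Dini derivatives -/

open Filter Topology intervalIntegral in
/-- A continuous function increases by at most the integral of `φ` as soon as, to the right of every
point, difference quotients that are nearly bounded by `φ` occur frequently. -/
theorem sub_le_integral_of_frequently_slope_le {g φ : ℝ → ℝ} {a b : ℝ} (hab : a ≤ b)
    (hcont : ContinuousOn g (Icc a b)) (φint : IntegrableOn φ (Icc a b))
    (h : ∀ t ∈ Ico a b, ∀ y, φ t < y → ∃ᶠ u in 𝓝[>] t, g u - g t ≤ (u - t) * y) :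
    g b - g a ≤ ∫ y in a..b, φ y := by
  refine le_of_forall_pos_le_add fun ε εpos => ?_
  -- Bound `φ` from above by a lower semicontinuous function with almost the same integral.
  rcases exists_lt_lowerSemicontinuous_integral_lt φ φint εpos with
    ⟨G', f_lt_G', G'cont, G'int, G'lt_top, hG'⟩
  set s := {t | g t - g a ≤ ∫ u in a..t, (G' u).toReal} ∩ Icc a b
  have s_closed : IsClosed s := by
    have : ContinuousOn (fun t => (g t - g a, ∫ u in a..t, (G' u).toReal)) (Icc a b) := by
      rw [← uIcc_of_le hab] at G'int hcont ⊢
      exact (hcont.sub continuousOn_const).prodMk (continuousOn_primitive_interval G'int)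
    simp only [s, inter_comm]
    exact this.preimage_isClosed_of_isClosed isClosed_Icc OrderClosedTopology.isClosed_le'
  have main : Icc a b ⊆ {t | g t - g a ≤ ∫ u in a..t, (G' u).toReal} := by
    -- Real induction: every point of `s` left of `b` has points of `s` close to its right.
    refine s_closed.Icc_subset_of_forall_exists_gt
      (by simp only [integral_same, mem_ofPred_eq, sub_self, le_rfl]) fun t ht v t_lt_v => ?_
    obtain ⟨y, g'_lt_y', y_lt_G'⟩ : ∃ y : ℝ, (φ t : EReal) < y ∧ (y : EReal) < G' t :=
      EReal.lt_iff_exists_real_btwn.1 (f_lt_G' t)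
    have I1 : ∀ᶠ u in 𝓝[>] t, (u - t) * y ≤ ∫ w in t..u, (G' w).toReal := by
      have B : ∀ᶠ u in 𝓝 t, (y : EReal) < G' u := G'cont.lowerSemicontinuousAt _ _ y_lt_G'
      rcases mem_nhds_iff_exists_Ioo_subset.1 B with ⟨m, M, ⟨hm, hM⟩, H⟩
      have : Ioo t (min M b) ∈ 𝓝[>] t := Ioo_mem_nhdsGT (lt_min hM ht.right.right)
      filter_upwards [this] with u hu
      have I : Icc t u ⊆ Icc a b := Icc_subset_Icc ht.2.1 (hu.2.le.trans (min_le_right _ _))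
      calc
        (u - t) * y = ∫ _ in Icc t u, y := by
          simp only [MeasureTheory.integral_const, MeasurableSet.univ, measureReal_restrict_apply,
            univ_inter, hu.left.le, Real.volume_real_Icc_of_le, smul_eq_mul]
        _ ≤ ∫ w in t..u, (G' w).toReal := by
          rw [intervalIntegral.integral_of_le hu.1.le, ← integral_Icc_eq_integral_Ioc]
          apply setIntegral_mono_ae_restrict
          · simp
          · exact IntegrableOn.mono_set G'int I
          · have C1 : ∀ᵐ x : ℝ ∂volume.restrict (Icc t u), G' x < ⊤ :=
              ae_mono (Measure.restrict_mono I le_rfl) G'lt_top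
            have C2 : ∀ᵐ x : ℝ ∂volume.restrict (Icc t u), x ∈ Icc t u :=
              ae_restrict_mem measurableSet_Icc
            filter_upwards [C1, C2] with x G'x hx
            apply EReal.coe_le_coe_iff.1
            have : x ∈ Ioo m M := by
              simp only [hm.trans_le hx.left,
                (hx.right.trans_lt hu.right).trans_le (min_le_left M b), mem_Ioo, and_self_iff]
            refine (H this).out.le.trans_eq ?_
            exact (EReal.coe_toReal G'x.ne (f_lt_G' x).ne_bot).symm
    have I2 : ∃ᶠ u in 𝓝[>] t, g u - g t ≤ (u - t) * y :=
      h t ⟨ht.2.1, ht.2.2⟩ y (EReal.coe_lt_coe_iff.1 g'_lt_y')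
    have I4 : ∀ᶠ u in 𝓝[>] t, u ∈ Ioc t (min v b) := Ioc_mem_nhdsGT <| lt_min t_lt_v ht.2.2
    rcases (I2.and_eventually (I1.and I4)).exists with ⟨x, hx2, hx1, h'x⟩
    refine ⟨x, ?_, Ioc_subset_Ioc le_rfl (min_le_left _ _) h'x⟩
    calc
      g x - g a = g t - g a + (g x - g t) := by abel
      _ ≤ (∫ w in a..t, (G' w).toReal) + ∫ w in t..x, (G' w).toReal :=
        add_le_add ht.1 (hx2.trans hx1)
      _ = ∫ w in a..x, (G' w).toReal := by
        apply integral_add_adjacent_intervals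
        · rw [intervalIntegrable_iff_integrableOn_Ioc_of_le ht.2.1]
          exact IntegrableOn.mono_set G'int
            (Ioc_subset_Icc_self.trans (Icc_subset_Icc le_rfl ht.2.2.le))
        · rw [intervalIntegrable_iff_integrableOn_Ioc_of_le h'x.1.le]
          apply IntegrableOn.mono_set G'int
          exact Ioc_subset_Icc_self.trans (Icc_subset_Icc ht.2.1 (h'x.2.trans (min_le_right _ _)))
  calc
    g b - g a ≤ ∫ y in a..b, (G' y).toReal := main (right_mem_Icc.2 hab)
    _ ≤ (∫ y in a..b, φ y) + ε := by
      convert! hG'.le <;>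
        · rw [intervalIntegral.integral_of_le hab]
          simp only [integral_Icc_eq_integral_Ioc', Real.volume_singleton]

open Filter Topology in
/-- Integrated form of a bound `ψ` on upper right Dini derivatives. No measurability of `ψ` is
assumed: the right-hand side is a lower integral, and the upper derivative along the sequence
`1 / (n + 1)` is a measurable function below `ψ`. -/
theorem ofReal_sub_le_lintegral_of_slope_le {g ψ : ℝ → ℝ} {a b : ℝ} (hab : a ≤ b)
    (hg : ContinuousOn g (Icc a b))
    (h : ∀ s ∈ Ico a b, ∀ r, ψ s < r → ∀ᶠ u in 𝓝[>] s, g u - g s ≤ (u - s) * r) :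
    ENNReal.ofReal (g b - g a) ≤ ∫⁻ s in Ioc a b, ENNReal.ofReal (ψ s) := by
  set G : ℝ → ℝ := IccExtend hab ((Icc a b).domRestrict g)
  have hG : Continuous G := (continuousOn_iff_continuous_domRestrict.1 hg).Icc_extend'
  have hGg : ∀ s ∈ Icc a b, G s = g s := fun s hs => by
    simp [G, IccExtend_of_mem hab _ hs]
  set u : ℝ → ℕ → ℝ := fun s n => s + 1 / ((n : ℝ) + 1)
  have hu : ∀ s, Tendsto (u s) atTop (𝓝[>] s) := by
    intro s
    refine tendsto_nhdsWithin_iff.2 ⟨?_, .of_forall fun n => ?_⟩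
    · simpa [u] using (tendsto_one_div_add_atTop_nhds_zero_nat (𝕜 := ℝ)).const_add s
    · have : (0 : ℝ) < 1 / ((n : ℝ) + 1) := by positivity
      simpa [u] using this
  set q : ℕ → ℝ → ℝ≥0∞ := fun n s => ENNReal.ofReal (((n : ℝ) + 1) * (G (u s n) - G s))
  set D : ℝ → ℝ≥0∞ := fun s => limsup (fun n => q n s) atTop
  have hD : Measurable D := by
    refine Measurable.limsup fun n => ?_
    have : Continuous fun s => ((n : ℝ) + 1) * (G (u s n) - G s) := by fun_prop
    exact this.measurable.ennreal_ofReal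
  have hDψ : ∀ s ∈ Ico a b, D s ≤ ENNReal.ofReal (ψ s) := by
    intro s hs
    refine ENNReal.le_of_forall_pos_le_add fun ε hε _ => ?_
    have h1 := h s hs (ψ s + ε) (by simpa using hε)
    have h2 : ∀ᶠ u in 𝓝[>] s, u ∈ Ioc s b := Ioc_mem_nhdsGT hs.2
    refine (limsup_le_of_le (h := ((hu s).eventually (h1.and h2)).mono fun n hn => ?_)).trans
      ((ENNReal.ofReal_add_le (p := ψ s) (q := ε)).trans_eq (by simp))
    obtain ⟨h3, h4⟩ := hn
    refine ENNReal.ofReal_le_ofReal ?_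
    rw [hGg _ ⟨hs.1.trans h4.1.le, h4.2⟩, hGg _ ⟨hs.1, hs.2.le⟩]
    have hn : (0 : ℝ) < (n : ℝ) + 1 := by positivity
    calc ((n : ℝ) + 1) * (g (u s n) - g s) ≤ ((n : ℝ) + 1) * ((u s n - s) * (ψ s + ε)) := by
          gcongr
      _ = ψ s + ε := by simp only [u]; field_simp; ring
  refine le_trans ?_ (?_ : ∫⁻ s in Ioc a b, D s ≤ _)
  swap
  · rw [← setLIntegral_congr Ico_ae_eq_Ioc, ← setLIntegral_congr Ico_ae_eq_Ioc]
    exact setLIntegral_mono' measurableSet_Ico hDψ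
  by_cases hfin : ∫⁻ s in Ioc a b, D s = ∞
  · rw [hfin]; exact le_top
  have hint : IntegrableOn (fun s => (D s).toReal) (Ioc a b) :=
    integrable_toReal_of_lintegral_ne_top hD.aemeasurable hfin
  have key := sub_le_integral_of_frequently_slope_le hab hg
    ((integrableOn_Icc_iff_integrableOn_Ioc (f := fun s => (D s).toReal)).2 hint) (by
      intro t ht y hy
      have hDt : D t ≠ ∞ := ne_top_of_le_ne_top ENNReal.ofReal_ne_top (hDψ t ht)
      have hy0 : 0 < y := ENNReal.toReal_nonneg.trans_lt hy
      have h1 : limsup (fun n => q n t) atTop < ENNReal.ofReal y :=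
        (ENNReal.lt_ofReal_iff_toReal_lt hDt).2 hy
      have h2 : ∀ᶠ n in atTop, u t n ∈ Ioc t b := (hu t).eventually (Ioc_mem_nhdsGT ht.2)
      have h3 := eventually_lt_of_limsup_lt h1
      refine (hu t).frequently (Eventually.frequently ?_)
      filter_upwards [h2, h3] with n hn2 hn3
      have hn4 := (ENNReal.ofReal_lt_ofReal_iff hy0).1 hn3
      rw [hGg _ ⟨ht.1.trans hn2.1.le, hn2.2⟩, hGg _ ⟨ht.1, ht.2.le⟩] at hn4
      have hn : (0 : ℝ) < (n : ℝ) + 1 := by positivity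
      have e : u t n - t = 1 / ((n : ℝ) + 1) := by simp [u]
      rw [e, one_div, inv_mul_eq_div, le_div_iff₀ hn, mul_comm]
      exact hn4.le)
  rw [intervalIntegral.integral_of_le hab] at key
  refine (ENNReal.ofReal_le_ofReal key).trans ?_
  rw [ofReal_integral_eq_lintegral_ofReal hint (.of_forall fun _ => ENNReal.toReal_nonneg)]
  exact lintegral_mono fun s => ENNReal.ofReal_toReal_le

/-! ### Measures with uniformly sub-Gaussian symmetrization -/

lemma sq_integral_mul_le {α : Type*} [MeasurableSpace α] {ν : Measure α} {f g : α → ℝ}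
    (hf : MemLp f 2 ν) (hg : MemLp g 2 ν) :
    (∫ x, f x * g x ∂ν) ^ 2 ≤ (∫ x, f x ^ 2 ∂ν) * ∫ x, g x ^ 2 ∂ν := by
  have hfg : Integrable (fun x => f x * g x) ν := hf.integrable_mul hg
  have key : ∀ t : ℝ, 0 ≤ (∫ x, g x ^ 2 ∂ν) * (t * t) + (2 * ∫ x, f x * g x ∂ν) * t +
      ∫ x, f x ^ 2 ∂ν := by
    intro t
    have h0 : 0 ≤ ∫ x, (t * t * g x ^ 2 + 2 * t * (f x * g x) + f x ^ 2) ∂ν :=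
      integral_nonneg fun x => by
        have : t * t * g x ^ 2 + 2 * t * (f x * g x) + f x ^ 2 = (t * g x + f x) ^ 2 := by ring
        simp only [this]; positivity
    rw [integral_add ((hg.integrable_sq.const_mul _).fun_add (hfg.const_mul _)) hf.integrable_sq,
      integral_add (hg.integrable_sq.const_mul _) (hfg.const_mul _), integral_const_mul,
      integral_const_mul] at h0
    linarith
  have := discrim_le_zero key
  rw [discrim] at this
  nlinarith

lemma one_add_sq_div_two_le_cosh (u : ℝ) : 1 + u ^ 2 / 2 ≤ Real.cosh u := by
  have h1 : Real.cosh u = 1 + 2 * Real.sinh (u / 2) ^ 2 := by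
    have h2 := Real.cosh_two_mul (u / 2)
    have h3 := Real.cosh_sq (u / 2)
    rw [mul_div_cancel₀ _ two_ne_zero] at h2
    rw [h2, h3]; ring
  have h4 : (u / 2) ^ 2 ≤ Real.sinh (u / 2) ^ 2 := by
    rw [← sq_abs (Real.sinh _), ← sq_abs (u / 2), Real.abs_sinh]
    gcongr
    exact Real.self_le_sinh_iff.2 (abs_nonneg _)
  rw [h1]
  nlinarith

/-- The difference of two independent copies of `X ∼ ν` satisfies
`E exp ⟪h, X - X'⟫ ≤ exp (c ‖h‖²)`. -/
structure SubGaussianWith (ν : Measure (Space d)) (c : ℝ) : Prop where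
  integrable_exp : ∀ h : Space d, Integrable (fun x => Real.exp ⟪h, x⟫) ν
  memLp : MemLp (fun x : Space d => x) 2 ν
  mul_le : ∀ h : Space d, (∫ x, Real.exp ⟪h, x⟫ ∂ν) * (∫ x, Real.exp ⟪-h, x⟫ ∂ν) ≤
    Real.exp (c * ‖h‖ ^ 2)

section SubGaussianWith

variable {ν : Measure (Space d)} [IsProbabilityMeasure ν] {c : ℝ}

lemma SubGaussianWith.integrable_id (hν : SubGaussianWith ν c) :
    Integrable (fun x : Space d => x) ν := hν.memLp.integrable (by norm_num)

lemma SubGaussianWith.memLp_sub (hν : SubGaussianWith ν c) (x₀ : Space d) :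
    MemLp (fun x : Space d => x - x₀) 2 ν := hν.memLp.sub (memLp_const _)

lemma SubGaussianWith.memLp_inner (hν : SubGaussianWith ν c) (u : Space d) :
    MemLp (fun x : Space d => ⟪u, x - ∫ x, x ∂ν⟫) 2 ν :=
  (hν.memLp_sub _).const_inner u

lemma SubGaussianWith.integral_inner (hν : SubGaussianWith ν c) (u : Space d) :
    ∫ x, ⟪u, x - ∫ x, x ∂ν⟫ ∂ν = 0 := by
  rw [_root_.integral_inner (by exact hν.integrable_id.sub (integrable_const _)),
    integral_sub hν.integrable_id (integrable_const _)]
  simp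

/-- The covariance of `ν` is at most `c • Id`: the second-order term at `h = 0` of the defining bound. -/
lemma SubGaussianWith.integral_inner_sq_le (hν : SubGaussianWith ν c) (u : Space d) :
    ∫ x, ⟪u, x - ∫ x, x ∂ν⟫ ^ 2 ∂ν ≤ c * ‖u‖ ^ 2 := by
  set p : Space d → ℝ := fun x => ⟪u, x - ∫ x, x ∂ν⟫ with hp
  set σ := ∫ x, p x ^ 2 ∂ν with hσ
  have hpL : MemLp p 2 ν := hν.memLp_inner u
  have hp0 : ∫ x, p x ∂ν = 0 := hν.integral_inner u
  have hpp : ∫ z : Space d × Space d, (p z.1 - p z.2) ^ 2 ∂ν.prod ν = 2 * σ := by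
    have i1 : Integrable (fun z : Space d × Space d => p z.1 ^ 2) (ν.prod ν) :=
      hpL.integrable_sq.comp_fst ν
    have i2 : Integrable (fun z : Space d × Space d => p z.2 ^ 2) (ν.prod ν) :=
      hpL.integrable_sq.comp_snd ν
    have i3 : Integrable (fun z : Space d × Space d => p z.1 * p z.2) (ν.prod ν) :=
      (hpL.integrable (by norm_num)).mul_prod (hpL.integrable (by norm_num))
    have e : ∀ z : Space d × Space d, (p z.1 - p z.2) ^ 2 =
        p z.1 ^ 2 - 2 * (p z.1 * p z.2) + p z.2 ^ 2 := fun z => by ring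
    simp_rw [e]
    rw [integral_add (by exact i1.sub (i3.const_mul 2)) i2, integral_sub i1 (i3.const_mul 2),
      integral_const_mul, integral_prod_mul p p, hp0,
      integral_fun_fst (fun x => p x ^ 2), integral_fun_snd (fun x => p x ^ 2)]
    simp [← hσ]; ring
  have hI : Integrable (fun z : Space d × Space d => (p z.1 - p z.2) ^ 2) (ν.prod ν) :=
    ((hpL.comp_fst ν).sub (hpL.comp_snd ν)).integrable_sq
  have key : ∀ t : ℝ, 1 + t ^ 2 * σ ≤ Real.exp (t ^ 2 * (c * ‖u‖ ^ 2)) := by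
    intro t
    have h1 := hν.mul_le (t • u)
    rw [norm_smul, mul_pow, Real.norm_eq_abs, sq_abs] at h1
    have j1 : Integrable (fun z : Space d × Space d =>
        Real.exp ⟪t • u, z.1⟫ * Real.exp ⟪-(t • u), z.2⟫) (ν.prod ν) :=
      (hν.integrable_exp _).mul_prod (hν.integrable_exp _)
    have j2 : Integrable (fun z : Space d × Space d =>
        Real.exp ⟪-(t • u), z.1⟫ * Real.exp ⟪t • u, z.2⟫) (ν.prod ν) :=
      (hν.integrable_exp _).mul_prod (hν.integrable_exp _)
    have e : ∀ z : Space d × Space d, Real.cosh (t * (p z.1 - p z.2)) =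
        (Real.exp ⟪t • u, z.1⟫ * Real.exp ⟪-(t • u), z.2⟫ +
          Real.exp ⟪-(t • u), z.1⟫ * Real.exp ⟪t • u, z.2⟫) / 2 := by
      intro z
      rw [Real.cosh_eq, ← Real.exp_add, ← Real.exp_add]
      simp only [hp, inner_sub_right, inner_neg_left, inner_smul_left]
      simp only [conj_trivial]
      ring_nf
    have h2 : ∫ z : Space d × Space d, Real.cosh (t * (p z.1 - p z.2)) ∂ν.prod ν =
        (∫ x, Real.exp ⟪t • u, x⟫ ∂ν) * ∫ x, Real.exp ⟪-(t • u), x⟫ ∂ν := by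
      simp_rw [e]
      rw [integral_div, integral_add j1 j2,
        integral_prod_mul (fun x => Real.exp ⟪t • u, x⟫) (fun x => Real.exp ⟪-(t • u), x⟫),
        integral_prod_mul (fun x => Real.exp ⟪-(t • u), x⟫) (fun x => Real.exp ⟪t • u, x⟫)]
      ring
    have h3 : ∫ z : Space d × Space d, (1 + t ^ 2 / 2 * (p z.1 - p z.2) ^ 2) ∂ν.prod ν ≤
        ∫ z : Space d × Space d, Real.cosh (t * (p z.1 - p z.2)) ∂ν.prod ν := by
      refine integral_mono ((integrable_const _).add (hI.const_mul _)) ?_ fun z => ?_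
      · simp_rw [e]; exact (j1.add j2).div_const 2
      · refine le_trans (le_of_eq ?_) (one_add_sq_div_two_le_cosh _)
        ring
    rw [integral_add (integrable_const _) (hI.const_mul _), integral_const_mul, hpp, h2] at h3
    simp only [integral_const, probReal_univ, smul_eq_mul, mul_one] at h3
    calc 1 + t ^ 2 * σ = 1 + t ^ 2 / 2 * (2 * σ) := by ring
      _ ≤ _ := h3.trans (h1.trans_eq (by ring_nf))
  set C := c * ‖u‖ ^ 2
  -- Letting `t → 0` in `key`.
  have lim : Filter.Tendsto (fun t : ℝ => C + t * C ^ 2) (nhdsWithin 0 (Ioi 0)) (nhds C) := by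
    have : Filter.Tendsto (fun t : ℝ => C + t * C ^ 2) (nhds 0) (nhds (C + 0 * C ^ 2)) :=
      Continuous.tendsto (by fun_prop) 0
    simpa using this.mono_left nhdsWithin_le_nhds
  refine ge_of_tendsto lim ?_
  have hsmall : ∀ᶠ t : ℝ in nhdsWithin 0 (Ioi 0), t * |C| < 1 := by
    have : Filter.Tendsto (fun t : ℝ => t * |C|) (nhds 0) (nhds (0 * |C|)) :=
      Continuous.tendsto (by fun_prop) 0
    rw [zero_mul] at this
    exact (this.mono_left nhdsWithin_le_nhds).eventually (gt_mem_nhds one_pos)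
  filter_upwards [hsmall, self_mem_nhdsWithin] with t ht htpos
  have htpos : 0 < t := htpos
  have h1 := key (Real.sqrt t)
  rw [Real.sq_sqrt htpos.le] at h1
  have h2 := (abs_le.1 (Real.abs_exp_sub_one_sub_id_le (x := t * C)
    (by rw [abs_mul, abs_of_pos htpos]; exact ht.le))).2
  have h3 : t * σ ≤ t * (C + t * C ^ 2) := by nlinarith
  exact le_of_mul_le_mul_left h3 htpos

lemma SubGaussianWith.one_le_integral_exp (hν : SubGaussianWith ν c) (h : Space d) :
    1 ≤ ∫ x, Real.exp ⟪h, x - ∫ x, x ∂ν⟫ ∂ν := by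
  have hi : Integrable (fun x => Real.exp ⟪h, x - ∫ x, x ∂ν⟫) ν := by
    simp_rw [inner_sub_right, Real.exp_sub]
    exact (hν.integrable_exp h).div_const _
  have hp := (hν.memLp_inner h).integrable (by norm_num)
  calc (1 : ℝ) = ∫ x, (⟪h, x - ∫ x, x ∂ν⟫ + 1) ∂ν := by
        rw [integral_add hp (integrable_const _), hν.integral_inner]; simp
    _ ≤ _ := integral_mono (hp.add (integrable_const _)) hi fun x => Real.add_one_le_exp _

/-- By Jensen's inequality the second factor in the defining bound is at least one once `ν` is
centred. -/
lemma SubGaussianWith.lintegral_exp_inner_le (hν : SubGaussianWith ν c) (h : Space d) :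
    ∫⁻ x, ENNReal.ofReal (Real.exp ⟪h, x - ∫ x, x ∂ν⟫) ∂ν ≤
      ENNReal.ofReal (Real.exp (c * ‖h‖ ^ 2)) := by
  have hi : ∀ h : Space d, Integrable (fun x => Real.exp ⟪h, x - ∫ x, x ∂ν⟫) ν := fun h => by
    simp_rw [inner_sub_right, Real.exp_sub]
    exact (hν.integrable_exp h).div_const _
  rw [← ofReal_integral_eq_lintegral_ofReal (hi h) (.of_forall fun x => (Real.exp_pos _).le)]
  refine ENNReal.ofReal_le_ofReal ?_
  have h1 := hν.mul_le h
  have e : ∀ h : Space d, ∫ x, Real.exp ⟪h, x⟫ ∂ν =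
      Real.exp ⟪h, ∫ x, x ∂ν⟫ * ∫ x, Real.exp ⟪h, x - ∫ x, x ∂ν⟫ ∂ν := by
    intro h
    rw [← integral_const_mul]
    refine integral_congr_ae (.of_forall fun x => ?_)
    simp only [inner_sub_right]
    rw [← Real.exp_add]; congr 1; ring
  rw [e, e (-h)] at h1
  have e2 : Real.exp ⟪h, ∫ x, x ∂ν⟫ * Real.exp ⟪-h, ∫ x, x ∂ν⟫ = 1 := by
    rw [← Real.exp_add, inner_neg_left]; simp
  have h2 := hν.one_le_integral_exp (-h)
  have h3 : 0 ≤ ∫ x, Real.exp ⟪h, x - ∫ x, x ∂ν⟫ ∂ν := integral_nonneg fun x => (Real.exp_pos _).le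
  calc ∫ x, Real.exp ⟪h, x - ∫ x, x ∂ν⟫ ∂ν
      ≤ (∫ x, Real.exp ⟪h, x - ∫ x, x ∂ν⟫ ∂ν) * ∫ x, Real.exp ⟪-h, x - ∫ x, x ∂ν⟫ ∂ν :=
        le_mul_of_one_le_right h3 h2
    _ = (Real.exp ⟪h, ∫ x, x ∂ν⟫ * Real.exp ⟪-h, ∫ x, x ∂ν⟫) *
        ((∫ x, Real.exp ⟪h, x - ∫ x, x ∂ν⟫ ∂ν) * ∫ x, Real.exp ⟪-h, x - ∫ x, x ∂ν⟫ ∂ν) := by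
        rw [e2, one_mul]
    _ ≤ _ := le_trans (le_of_eq (by ring)) h1

/-- A bound, depending only on `d` and `c`, for `E exp (‖X - E X‖² / (8 c))`. -/
def squareExpBound (d : ℕ) (c : ℝ) : ℝ :=
  (∫⁻ h, ENNReal.ofReal (Real.exp (c * ‖h‖ ^ 2)) ∂heatGaussian d (1 / (4 * c))).toReal

lemma lintegral_exp_sq_heatGaussian (hc : 0 < c) :
    ∫⁻ h, ENNReal.ofReal (Real.exp (c * ‖h‖ ^ 2)) ∂heatGaussian d (1 / (4 * c)) =
      ENNReal.ofReal (squareExpBound d c) := by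
  refine (ENNReal.ofReal_toReal ?_).symm
  have hs : 0 < 1 / (4 * c) := by positivity
  rw [heatGaussian_eq_withDensity hs, lintegral_withDensity_eq_lintegral_mul _
    (continuous_gaussDensity _).measurable.ennreal_ofReal (by fun_prop)]
  have hs' : 0 < 1 / (2 * c) := by positivity
  -- The integrand is proportional to the density of variance `1 / (2 c)`.
  have hI := (integrable_gaussDensity (d := d) hs').const_mul
    ((2 * Real.pi * (1 / (4 * c))) ^ (-(d : ℝ) / 2) / (2 * Real.pi * (1 / (2 * c))) ^ (-(d : ℝ) / 2))
  refine ne_of_lt (lt_of_le_of_lt (le_of_eq ?_) hI.lintegral_lt_top)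
  refine lintegral_congr fun x => ?_
  rw [Pi.mul_apply, ← ENNReal.ofReal_mul (gaussDensity_pos hs _).le]
  congr 1
  unfold gaussDensity
  have hp : (2 * Real.pi * (1 / (2 * c))) ^ (-(d : ℝ) / 2) ≠ 0 := by positivity
  rw [mul_assoc, ← Real.exp_add, ← mul_assoc, div_mul_cancel₀ _ hp]
  congr 2
  field_simp
  ring

/-- The Gaussian mixture of the exponential bounds over `h`. -/
lemma SubGaussianWith.lintegral_exp_sq_le (hν : SubGaussianWith ν c) (hc : 0 < c) :
    ∫⁻ x, ENNReal.ofReal (Real.exp (1 / (8 * c) * ‖x - ∫ x, x ∂ν‖ ^ 2)) ∂ν ≤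
      ENNReal.ofReal (squareExpBound d c) := by
  have hs : 0 < 1 / (4 * c) := by positivity
  calc _ = ∫⁻ x, ∫⁻ h, ENNReal.ofReal (Real.exp ⟪h, x - ∫ x, x ∂ν⟫)
        ∂heatGaussian d (1 / (4 * c)) ∂ν := by
        refine lintegral_congr fun x => ?_
        rw [lintegral_exp_inner_heatGaussian hs]
        congr 3
        field_simp; norm_num
    _ = ∫⁻ h, ∫⁻ x, ENNReal.ofReal (Real.exp ⟪h, x - ∫ x, x ∂ν⟫) ∂ν
        ∂heatGaussian d (1 / (4 * c)) := lintegral_lintegral_swap (by fun_prop)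
    _ ≤ _ := by
        rw [← lintegral_exp_sq_heatGaussian hc]
        exact lintegral_mono fun h => hν.lintegral_exp_inner_le h

lemma SubGaussianWith.integrable_exp_sq (hν : SubGaussianWith ν c) (hc : 0 < c) :
    Integrable (fun x => Real.exp (1 / (8 * c) * ‖x - ∫ x, x ∂ν‖ ^ 2)) ν := by
  refine ⟨by fun_prop, ?_⟩
  rw [hasFiniteIntegral_iff_ofReal (.of_forall fun x => (Real.exp_pos _).le)]
  exact (hν.lintegral_exp_sq_le hc).trans_lt ENNReal.ofReal_lt_top

lemma SubGaussianWith.integral_exp_sq_le (hν : SubGaussianWith ν c) (hc : 0 < c) :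
    ∫ x, Real.exp (1 / (8 * c) * ‖x - ∫ x, x ∂ν‖ ^ 2) ∂ν ≤ squareExpBound d c := by
  rw [integral_eq_lintegral_of_nonneg_ae (.of_forall fun x => (Real.exp_pos _).le) (by fun_prop)]
  exact ENNReal.toReal_le_of_le_ofReal ENNReal.toReal_nonneg (hν.lintegral_exp_sq_le hc)

lemma SubGaussianWith.integral_norm_sq_sub_le (hν : SubGaussianWith ν c) (hc : 0 < c) :
    ∫ x, ‖x - ∫ x, x ∂ν‖ ^ 2 ∂ν ≤ 8 * c * squareExpBound d c := by
  have h1 : ∫ x, ‖x - ∫ x, x ∂ν‖ ^ 2 ∂ν ≤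
      ∫ x, 8 * c * Real.exp (1 / (8 * c) * ‖x - ∫ x, x ∂ν‖ ^ 2) ∂ν := by
    refine integral_mono ((hν.memLp_sub _).integrable_norm_pow (by norm_num))
      ((hν.integrable_exp_sq hc).const_mul _) fun x => ?_
    have h2 := Real.add_one_le_exp (1 / (8 * c) * ‖x - ∫ x, x ∂ν‖ ^ 2)
    have h3 : 8 * c * (1 / (8 * c) * ‖x - ∫ x, x ∂ν‖ ^ 2) = ‖x - ∫ x, x ∂ν‖ ^ 2 := by field_simp
    simp only
    nlinarith
  rw [integral_const_mul] at h1
  refine h1.trans ?_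
  gcongr
  exact hν.integral_exp_sq_le hc

end SubGaussianWith

/-! ### Posterior means and their second moment -/

/-- The posterior mean of `f` given the observation `y` at time `s`. -/
def slMean (μ : Measure (Space d)) (f : Space d → ℝ) (s : ℝ) (y : Space d) : ℝ :=
  (∫ x, f x * slWeight s y x ∂μ) / slPartition μ s y

/-- The second moment `E (E[f(X) | s X + √s ζ])²` of the posterior mean of `f` at time `s`, where
`X ∼ μ`. -/
def meanEnergy (μ : Measure (Space d)) (f : Space d → ℝ) (s : ℝ) : ℝ≥0∞ :=
  ∫⁻ y, ENNReal.ofReal (slMean μ f s y ^ 2 * slPartition μ s y) ∂heatGaussian d s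

section Basic

variable {μ : Measure (Space d)} [IsProbabilityMeasure μ] {f : Space d → ℝ} {s B : ℝ}

lemma measurable_slPartition_right (s : ℝ) : Measurable (slPartition μ s) := by
  have : StronglyMeasurable fun q : Space d × Space d => slWeight s q.1 q.2 :=
    Measurable.stronglyMeasurable (by fun_prop)
  exact this.integral_prod_right'.measurable

lemma measurable_integral_slWeight_right (hf : Measurable f) (s : ℝ) :
    Measurable fun y => ∫ x, f x * slWeight s y x ∂μ := by
  have : StronglyMeasurable fun q : Space d × Space d => f q.2 * slWeight s q.1 q.2 :=
    Measurable.stronglyMeasurable (by fun_prop)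
  exact this.integral_prod_right'.measurable

lemma measurable_slMean (hf : Measurable f) (s : ℝ) : Measurable (slMean μ f s) :=
  (measurable_integral_slWeight_right hf s).div (measurable_slPartition_right s)

lemma integrable_mul_slWeight (hf : Measurable f) (hB : ∀ x, |f x| ≤ B) (hs : 0 < s)
    (y : Space d) : Integrable (fun x => f x * slWeight s y x) μ :=
  (integrable_slWeight hs y).bdd_mul hf.aestronglyMeasurable (.of_forall hB)

lemma abs_slMean_le (hf : Measurable f) (hB : ∀ x, |f x| ≤ B) (hs : 0 < s) (y : Space d) :
    |slMean μ f s y| ≤ B := by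
  have hD := slPartition_pos (μ := μ) hs y
  rw [slMean, abs_div, abs_of_pos hD, div_le_iff₀ hD, slPartition, ← integral_const_mul]
  refine (abs_integral_le_integral_abs).trans ?_
  refine integral_mono (integrable_mul_slWeight hf hB hs y).abs
    ((integrable_slWeight hs y).const_mul _) fun x => ?_
  simp only [abs_mul, abs_of_pos (slWeight_pos s y x)]
  exact mul_le_mul_of_nonneg_right (hB x) (slWeight_pos s y x).le

lemma lintegral_slWeight (hs : 0 < s) (x : Space d) :
    ∫⁻ y, ENNReal.ofReal (slWeight s y x) ∂heatGaussian d s = 1 := by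
  simpa using lintegral_slWeight_heatGaussian hs x (F := fun _ => 1) measurable_const

lemma integrable_slWeight_prod (hs : 0 < s) :
    Integrable (fun p : Space d × Space d => slWeight s p.1 p.2) ((heatGaussian d s).prod μ) := by
  refine ⟨by fun_prop, ?_⟩
  rw [hasFiniteIntegral_iff_ofReal (.of_forall fun x => (slWeight_pos _ _ _).le),
    lintegral_prod_symm _ (by fun_prop)]
  simp [lintegral_slWeight hs]

lemma integrable_slPartition (hs : 0 < s) :
    Integrable (slPartition μ s) (heatGaussian d s) :=
  (integrable_slWeight_prod hs).integral_prod_left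

lemma integral_slWeight (hs : 0 < s) (x : Space d) :
    ∫ y, slWeight s y x ∂heatGaussian d s = 1 := by
  rw [integral_eq_lintegral_of_nonneg_ae (.of_forall fun y => (slWeight_pos s y x).le)
    (by fun_prop), lintegral_slWeight hs]
  simp

lemma integral_integral_slWeight (hf : Measurable f) (hB : ∀ x, |f x| ≤ B) (hs : 0 < s) :
    ∫ y, ∫ x, f x * slWeight s y x ∂μ ∂heatGaussian d s = ∫ x, f x ∂μ := by
  rw [integral_integral_swap]
  · simp_rw [integral_const_mul, integral_slWeight hs, mul_one]
  · exact (integrable_slWeight_prod hs).bdd_mul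
      (hf.comp measurable_snd).aestronglyMeasurable (.of_forall fun p => hB p.2)

lemma integrable_integral_slWeight (hf : Measurable f) (hB : ∀ x, |f x| ≤ B) (hs : 0 < s) :
    Integrable (fun y => ∫ x, f x * slWeight s y x ∂μ) (heatGaussian d s) :=
  ((integrable_slWeight_prod hs).bdd_mul
      (hf.comp measurable_snd).aestronglyMeasurable (.of_forall fun p => hB p.2)).integral_prod_left

lemma integral_slPartition (hs : 0 < s) : ∫ y, slPartition μ s y ∂heatGaussian d s = 1 := by
  have := integral_integral_slWeight (μ := μ) (f := fun _ => 1) (B := 1) measurable_const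
    (by simp) hs
  simpa [slPartition] using this

lemma slMean_mul_slPartition (hs : 0 < s) (y : Space d) :
    slMean μ f s y * slPartition μ s y = ∫ x, f x * slWeight s y x ∂μ :=
  div_mul_cancel₀ _ (slPartition_pos hs y).ne'

lemma integrable_slMean_sq (hf : Measurable f) (hB : ∀ x, |f x| ≤ B) (hs : 0 < s) :
    Integrable (fun y => slMean μ f s y ^ 2 * slPartition μ s y) (heatGaussian d s) := by
  refine (integrable_slPartition hs).bdd_mul (c := B ^ 2)
    ((measurable_slMean hf s).pow_const 2).aestronglyMeasurable (.of_forall fun y => ?_)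
  rw [norm_pow, Real.norm_eq_abs]
  exact pow_le_pow_left₀ (abs_nonneg _) (abs_slMean_le hf hB hs y) 2

lemma slMean_sq_nonneg (hs : 0 < s) (y : Space d) :
    0 ≤ slMean μ f s y ^ 2 * slPartition μ s y :=
  mul_nonneg (sq_nonneg _) (slPartition_pos hs y).le

lemma meanEnergy_eq_ofReal (hf : Measurable f) (hB : ∀ x, |f x| ≤ B) (hs : 0 < s) :
    meanEnergy μ f s =
      ENNReal.ofReal (∫ y, slMean μ f s y ^ 2 * slPartition μ s y ∂heatGaussian d s) :=
  (ofReal_integral_eq_lintegral_ofReal (integrable_slMean_sq hf hB hs)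
    (.of_forall fun y => slMean_sq_nonneg hs y)).symm

lemma slMean_add_const (hf : Measurable f) (hB : ∀ x, |f x| ≤ B) (hs : 0 < s) (e : ℝ)
    (y : Space d) : slMean μ (fun x => f x + e) s y = slMean μ f s y + e := by
  have hD := slPartition_pos (μ := μ) hs y
  unfold slMean
  simp_rw [add_mul]
  rw [integral_add (integrable_mul_slWeight hf hB hs y) ((integrable_slWeight hs y).const_mul e),
    integral_const_mul, add_div]
  congr 1
  exact mul_div_cancel_right₀ _ hD.ne'

/-- The second moment of the posterior mean splits like a second moment into the square of the mean
and a centred part. -/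
lemma meanEnergy_add_const (hf : Measurable f) (hB : ∀ x, |f x| ≤ B) (hs : 0 < s)
    (hf0 : ∫ x, f x ∂μ = 0) (e : ℝ) :
    meanEnergy μ (fun x => f x + e) s = ENNReal.ofReal (e ^ 2) + meanEnergy μ f s := by
  have hB' : ∀ x, |f x + e| ≤ B + |e| := fun x => (abs_add_le _ _).trans (by gcongr; exact hB x)
  rw [meanEnergy_eq_ofReal (hf.add_const e) hB' hs, meanEnergy_eq_ofReal hf hB hs,
    ← ENNReal.ofReal_add (sq_nonneg _) (integral_nonneg fun y => slMean_sq_nonneg hs y)]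
  congr 1
  have e1 : ∀ y, slMean μ (fun x => f x + e) s y ^ 2 * slPartition μ s y =
      slMean μ f s y ^ 2 * slPartition μ s y + 2 * e * (∫ x, f x * slWeight s y x ∂μ) +
        e ^ 2 * slPartition μ s y := by
    intro y
    rw [slMean_add_const hf hB hs, ← slMean_mul_slPartition hs]; ring
  have i1 := integrable_slMean_sq (μ := μ) hf hB hs
  have i2 := (integrable_integral_slWeight (μ := μ) hf hB hs).const_mul (2 * e)
  have i3 := (integrable_slPartition (μ := μ) hs).const_mul (e ^ 2)
  simp_rw [e1]
  rw [integral_add (by exact i1.add i2) i3, integral_add i1 i2, integral_const_mul,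
    integral_const_mul, integral_slPartition hs, integral_integral_slWeight hf hB hs, hf0]
  ring

end Basic

/-! ### A sharp one-step estimate -/

section OneStep

variable {ν : Measure (Space d)} [IsProbabilityMeasure ν] {c : ℝ} {f : Space d → ℝ} {δ B : ℝ}

lemma two_mul_abs_inner_le (a b : Space d) : 2 * |⟪a, b⟫| ≤ ‖a‖ ^ 2 + ‖b‖ ^ 2 := by
  have := abs_real_inner_le_norm a b
  nlinarith [sq_nonneg (‖a‖ - ‖b‖)]

lemma SubGaussianWith.integrable_exp_inner_prod (hν : SubGaussianWith ν c) (hc : 0 < c)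
    (hδ0 : 0 ≤ δ) (hδ : δ ≤ 1 / (16 * c)) :
    Integrable (fun p : Space d × Space d =>
      Real.exp (δ * ⟪p.1 - ∫ x, x ∂ν, p.2 - ∫ x, x ∂ν⟫)) (ν.prod ν) := by
  have h := (hν.integrable_exp_sq hc).mul_prod (hν.integrable_exp_sq hc)
  refine h.mono' (by fun_prop) (.of_forall fun p => ?_)
  rw [Real.norm_of_nonneg (Real.exp_pos _).le, ← Real.exp_add]
  refine Real.exp_le_exp.2 ?_
  set a := p.1 - ∫ x, x ∂ν
  set b := p.2 - ∫ x, x ∂ν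
  have h1 := two_mul_abs_inner_le a b
  have h2 := le_abs_self ⟪a, b⟫
  have h3 : δ ≤ 1 / (8 * c) := hδ.trans (one_div_le_one_div_of_le (by positivity) (by linarith))
  have h4 : 0 ≤ ‖a‖ ^ 2 + ‖b‖ ^ 2 := by positivity
  have h5 := mul_le_mul_of_nonneg_right h3 h4
  nlinarith

/-- Jensen's inequality bounds the partition function from below by that of a point mass; this turns
the second moment of the posterior mean into an explicit exponential kernel. -/
lemma SubGaussianWith.meanEnergy_le_kernel (hν : SubGaussianWith ν c) (hc : 0 < c)
    (hf : Measurable f) (hB : ∀ x, |f x| ≤ B) (hδ0 : 0 < δ) (hδ : δ ≤ 1 / (16 * c)) :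
    meanEnergy ν f δ ≤ ENNReal.ofReal
      (Real.exp (δ / 2 * ∫ x, ‖x - ∫ x, x ∂ν‖ ^ 2 ∂ν) * ∫ p : Space d × Space d,
        f p.1 * f p.2 * Real.exp (δ * ⟪p.1 - ∫ x, x ∂ν, p.2 - ∫ x, x ∂ν⟫) ∂ν.prod ν) := by
  set m := ∫ x, x ∂ν with hm
  set T := ∫ x, ‖x‖ ^ 2 ∂ν with hT
  have hsq : Integrable (fun x : Space d => ‖x‖ ^ 2) ν := hν.memLp.integrable_norm_pow (by norm_num)
  have hid := hν.integrable_id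
  have hTm : ∫ x, ‖x - m‖ ^ 2 ∂ν = T - ‖m‖ ^ 2 := by
    have hin : Integrable (fun x => ⟪x, m⟫) ν := hid.inner_const m
    simp_rw [norm_sub_sq_real]
    rw [integral_add (by exact hsq.sub (hin.const_mul 2)) (integrable_const _),
      integral_sub hsq (hin.const_mul 2), integral_const_mul]
    have : ∫ x, ⟪x, m⟫ ∂ν = ‖m‖ ^ 2 := by
      simp_rw [real_inner_comm m]
      rw [_root_.integral_inner hid, ← hm, real_inner_self_eq_norm_sq]
    rw [this]; simp; ring
  set W : Space d → Space d × Space d → ℝ := fun z p =>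
    slWeight δ z p.1 * slWeight δ z p.2 * Real.exp (-⟪z, m⟫ + δ / 2 * T) with hW
  have hWpos : ∀ z p, 0 < W z p := fun z p =>
    mul_pos (mul_pos (slWeight_pos _ _ _) (slWeight_pos _ _ _)) (Real.exp_pos _)
  have hWm : Measurable fun q : Space d × Space d × Space d => W q.1 q.2 := by
    simp only [hW]; fun_prop
  -- The Gaussian integral of `W` in `z`.
  have hWint : ∀ p : Space d × Space d, ∫⁻ z, ENNReal.ofReal (W z p) ∂heatGaussian d δ =
      ENNReal.ofReal (Real.exp (δ / 2 * (T - ‖m‖ ^ 2)) *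
        Real.exp (δ * ⟪p.1 - m, p.2 - m⟫)) := by
    rintro ⟨x, x'⟩
    have e : ∀ z, ENNReal.ofReal (W z (x, x')) =
        ENNReal.ofReal (Real.exp (δ / 2 * T - δ / 2 * ‖x‖ ^ 2 - δ / 2 * ‖x'‖ ^ 2)) *
          ENNReal.ofReal (Real.exp ⟪z, x + x' - m⟫) := by
      intro z
      rw [← ENNReal.ofReal_mul (Real.exp_pos _).le, ← Real.exp_add]
      simp only [hW, slWeight]
      rw [← Real.exp_add, ← Real.exp_add, inner_sub_right, inner_add_right]
      ring_nf
    simp_rw [e]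
    rw [lintegral_const_mul _ (by fun_prop), lintegral_exp_inner_heatGaussian hδ0,
      ← ENNReal.ofReal_mul (Real.exp_pos _).le, ← Real.exp_add, ← Real.exp_add]
    congr 2
    simp only [norm_sub_sq_real, norm_add_sq_real, inner_sub_left, inner_sub_right, inner_add_left,
      real_inner_self_eq_norm_sq, real_inner_comm x' m]
    ring
  have hWint' : ∀ p : Space d × Space d, ∫ z, W z p ∂heatGaussian d δ =
      Real.exp (δ / 2 * (T - ‖m‖ ^ 2)) * Real.exp (δ * ⟪p.1 - m, p.2 - m⟫) := by
    intro p
    rw [integral_eq_lintegral_of_nonneg_ae (.of_forall fun z => (hWpos z p).le)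
      (hWm.comp measurable_prodMk_right).aestronglyMeasurable, hWint,
      ENNReal.toReal_ofReal (by positivity)]
  have hker := (hν.integrable_exp_inner_prod hc hδ0.le hδ).const_mul
    (Real.exp (δ / 2 * (T - ‖m‖ ^ 2)))
  have hWI : Integrable (fun q : Space d × Space d × Space d => W q.1 q.2)
      ((heatGaussian d δ).prod (ν.prod ν)) := by
    refine ⟨hWm.aestronglyMeasurable, ?_⟩
    rw [hasFiniteIntegral_iff_ofReal (.of_forall fun q => (hWpos _ _).le),
      lintegral_prod_symm _ hWm.ennreal_ofReal.aemeasurable]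
    simp_rw [hWint]
    exact hker.lintegral_lt_top
  have hff : ∀ p : Space d × Space d, ‖f p.1 * f p.2‖ ≤ B * B := fun p => by
    rw [norm_mul]
    exact mul_le_mul (hB _) (hB _) (norm_nonneg _) ((abs_nonneg _).trans (hB p.1))
  have hFI : Integrable (fun q : Space d × Space d × Space d => f q.2.1 * f q.2.2 * W q.1 q.2)
      ((heatGaussian d δ).prod (ν.prod ν)) :=
    hWI.bdd_mul (Measurable.aestronglyMeasurable (by fun_prop)) (.of_forall fun q => hff q.2)
  -- Jensen's inequality for the partition function.
  have jensen : ∀ z, Real.exp (⟪z, m⟫ - δ / 2 * T) ≤ slPartition ν δ z := by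
    intro z
    have hin : Integrable (fun x => ⟪z, x⟫) ν := hid.const_inner z
    have h1 := ConvexOn.map_integral_le (μ := ν) (f := fun x => ⟪z, x⟫ - δ / 2 * ‖x‖ ^ 2)
      convexOn_exp Real.continuous_exp.continuousOn isClosed_univ (by simp)
      (hin.sub (hsq.const_mul _)) (integrable_slWeight hδ0 z)
    rwa [integral_sub hin (hsq.const_mul _), integral_const_mul, _root_.integral_inner hid] at h1
  have pointwise : ∀ z, slMean ν f δ z ^ 2 * slPartition ν δ z ≤
      ∫ p : Space d × Space d, f p.1 * f p.2 * W z p ∂ν.prod ν := by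
    intro z
    have hD := slPartition_pos (μ := ν) hδ0 z
    have e1 : ∫ p : Space d × Space d, f p.1 * f p.2 * W z p ∂ν.prod ν =
        (∫ x, f x * slWeight δ z x ∂ν) ^ 2 * Real.exp (-⟪z, m⟫ + δ / 2 * T) := by
      rw [sq, ← integral_prod_mul (fun x => f x * slWeight δ z x) (fun x => f x * slWeight δ z x),
        ← integral_mul_const]
      refine integral_congr_ae (.of_forall fun p => ?_)
      simp only [hW]; ring
    rw [e1, ← slMean_mul_slPartition hδ0]
    have h2 : 1 ≤ slPartition ν δ z * Real.exp (-⟪z, m⟫ + δ / 2 * T) := by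
      calc (1 : ℝ) = Real.exp (⟪z, m⟫ - δ / 2 * T) * Real.exp (-⟪z, m⟫ + δ / 2 * T) := by
            rw [← Real.exp_add]; simp
        _ ≤ _ := by gcongr; exact jensen z
    have h3 := slMean_sq_nonneg (μ := ν) (f := f) hδ0 z
    nlinarith
  calc meanEnergy ν f δ
      ≤ ∫⁻ z, ENNReal.ofReal (∫ p : Space d × Space d, f p.1 * f p.2 * W z p ∂ν.prod ν)
          ∂heatGaussian d δ := lintegral_mono fun z => ENNReal.ofReal_le_ofReal (pointwise z)
    _ = ENNReal.ofReal (∫ z, ∫ p : Space d × Space d, f p.1 * f p.2 * W z p ∂ν.prod ν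
          ∂heatGaussian d δ) := by
        rw [ofReal_integral_eq_lintegral_ofReal hFI.integral_prod_left]
        exact .of_forall fun z => (slMean_sq_nonneg hδ0 z).trans (pointwise z)
    _ = _ := by
        congr 1
        rw [integral_integral_swap hFI, ← integral_const_mul]
        refine integral_congr_ae (.of_forall fun p => ?_)
        simp only
        rw [integral_const_mul, hWint', hTm]
        ring

end OneStep

lemma sq_exp_sub_one_sub_le (t : ℝ) : (Real.exp t - 1 - t) ^ 2 ≤ t ^ 4 * Real.exp (2 * |t|) := by
  have h := Complex.norm_exp_sub_sum_le_norm_mul_exp (t : ℂ) 2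
  simp only [Finset.sum_range_succ, Finset.sum_range_zero, pow_zero, pow_one, Nat.factorial] at h
  have e : Complex.exp t - (0 + 1 / ((1 : ℕ) : ℂ) + (t : ℂ) / ((1 * 1 : ℕ) : ℂ)) =
      ((Real.exp t - 1 - t : ℝ) : ℂ) := by push_cast; ring
  have h' : |Real.exp t - 1 - t| ≤ |t| ^ 2 * Real.exp |t| := by
    rw [show (((0 + 1 : ℕ) * 1 : ℕ) : ℂ) = ((1 * 1 : ℕ) : ℂ) by norm_num] at h
    rw [e, Complex.norm_real, Complex.norm_real] at h
    simpa using h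
  calc (Real.exp t - 1 - t) ^ 2 = |Real.exp t - 1 - t| ^ 2 := (sq_abs _).symm
    _ ≤ (|t| ^ 2 * Real.exp |t|) ^ 2 := by gcongr
    _ = t ^ 4 * Real.exp (2 * |t|) := by
      rw [mul_pow, ← pow_mul, ← Real.exp_nat_mul]
      congr 1
      exact Even.pow_abs (by decide) t

section OneStep

variable {ν : Measure (Space d)} [IsProbabilityMeasure ν] {c : ℝ} {f : Space d → ℝ} {δ B : ℝ}

lemma memLp_of_bounded (hf : Measurable f) (hB : ∀ x, |f x| ≤ B) : MemLp f 2 ν :=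
  MemLp.of_bound hf.aestronglyMeasurable B (.of_forall hB)

/-- Bessel's inequality for the linear part of `f`. -/
lemma SubGaussianWith.norm_sq_integral_smul_le (hν : SubGaussianWith ν c) (hc : 0 < c)
    (hf : Measurable f) (hB : ∀ x, |f x| ≤ B) :
    ‖∫ x, f x • (x - ∫ x, x ∂ν) ∂ν‖ ^ 2 ≤ c * ∫ x, f x ^ 2 ∂ν := by
  set m := ∫ x, x ∂ν
  set v := ∫ x, f x • (x - m) ∂ν with hv
  have hI : Integrable (fun x => f x • (x - m)) ν :=
    ((hν.memLp_sub m).integrable (by norm_num)).bdd_smul B hf.aestronglyMeasurable (.of_forall hB)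
  have h1 : ∫ x, f x * ⟪v, x - m⟫ ∂ν = ‖v‖ ^ 2 := by
    rw [← real_inner_self_eq_norm_sq]
    conv_rhs => rw [hv]
    rw [← hv, ← _root_.integral_inner hI]
    simp_rw [inner_smul_right]
  have h2 := sq_integral_mul_le (memLp_of_bounded (ν := ν) hf hB) (hν.memLp_inner v)
  rw [h1] at h2
  have h3 := hν.integral_inner_sq_le v
  have h4 : 0 ≤ ∫ x, f x ^ 2 ∂ν := integral_nonneg fun x => sq_nonneg _
  have h5 : (‖v‖ ^ 2) ^ 2 ≤ (∫ x, f x ^ 2 ∂ν) * (c * ‖v‖ ^ 2) :=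
    h2.trans (mul_le_mul_of_nonneg_left h3 h4)
  rcases (sq_nonneg ‖v‖).eq_or_lt with h0 | h0
  · rw [← h0]; positivity
  · nlinarith

/-- Expansion of the kernel to second order. For centred `f` the constant term vanishes, the linear term
is the squared norm of `E f(X) (X - E X)`, and the remainder is estimated by Cauchy–Schwarz. -/
lemma SubGaussianWith.integral_kernel_le (hν : SubGaussianWith ν c) (hc : 0 < c)
    (hf : Measurable f) (hB : ∀ x, |f x| ≤ B) (hf0 : ∫ x, f x ∂ν = 0) (hδ0 : 0 < δ)
    (hδ : δ ≤ 1 / (16 * c)) :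
    ∫ p : Space d × Space d,
        f p.1 * f p.2 * Real.exp (δ * ⟪p.1 - ∫ x, x ∂ν, p.2 - ∫ x, x ∂ν⟫) ∂ν.prod ν ≤
      (δ * c + δ ^ 2 * (320 * c ^ 2 * squareExpBound d c)) * ∫ x, f x ^ 2 ∂ν := by
  set m := ∫ x, x ∂ν with hm
  set K := squareExpBound d c
  have hfL := memLp_of_bounded (ν := ν) hf hB
  have hfi : Integrable f ν := hfL.integrable (by norm_num)
  have hE := hν.integrable_exp_inner_prod hc hδ0.le hδ
  rw [← hm] at hE
  have hff : ∀ p : Space d × Space d, ‖f p.1 * f p.2‖ ≤ B * B := fun p => by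
    rw [norm_mul]
    exact mul_le_mul (hB _) (hB _) (norm_nonneg _) ((abs_nonneg _).trans (hB p.1))
  have hffm : Measurable fun p : Space d × Space d => f p.1 * f p.2 := by fun_prop
  have hI : Integrable (fun p : Space d × Space d => ⟪p.1 - m, p.2 - m⟫) (ν.prod ν) := by
    have h1 := ((hν.memLp_sub m).integrable_norm_pow (by norm_num)).comp_fst ν
    have h2 := ((hν.memLp_sub m).integrable_norm_pow (by norm_num)).comp_snd ν
    refine (h1.add h2).mono' (by fun_prop) (.of_forall fun p => ?_)
    have := two_mul_abs_inner_le (p.1 - m) (p.2 - m)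
    have h0 := abs_nonneg ⟪p.1 - m, p.2 - m⟫
    simp only [Real.norm_eq_abs, Pi.add_apply]
    linarith
  set R : Space d × Space d → ℝ := fun p =>
    Real.exp (δ * ⟪p.1 - m, p.2 - m⟫) - 1 - δ * ⟪p.1 - m, p.2 - m⟫ with hR
  have hRi : Integrable R (ν.prod ν) := (hE.sub (integrable_const 1)).sub (hI.const_mul δ)
  have hfm : AEStronglyMeasurable (fun p : Space d × Space d => f p.1 * f p.2) (ν.prod ν) :=
    hffm.aestronglyMeasurable
  have i0 : Integrable (fun p : Space d × Space d => f p.1 * f p.2) (ν.prod ν) := hfi.mul_prod hfi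
  have i1 := (hI.bdd_mul hfm (.of_forall hff)).const_mul δ
  have i2 := hRi.bdd_mul hfm (.of_forall hff)
  have split : ∀ p : Space d × Space d, f p.1 * f p.2 * Real.exp (δ * ⟪p.1 - m, p.2 - m⟫) =
      f p.1 * f p.2 + δ * (f p.1 * f p.2 * ⟪p.1 - m, p.2 - m⟫) + f p.1 * f p.2 * R p := fun p => by
    simp only [hR]; ring
  simp_rw [split]
  rw [integral_add (by exact i0.add i1) i2, integral_add i0 i1, integral_const_mul,
    integral_prod_mul f f, hf0, mul_zero, zero_add]
  -- The linear term of the exponential.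
  have first : ∫ p : Space d × Space d, f p.1 * f p.2 * ⟪p.1 - m, p.2 - m⟫ ∂ν.prod ν ≤
      c * ∫ x, f x ^ 2 ∂ν := by
    have hI' : Integrable (fun x => f x • (x - m)) ν :=
      ((hν.memLp_sub m).integrable (by norm_num)).bdd_smul B hf.aestronglyMeasurable (.of_forall hB)
    refine le_trans (le_of_eq ?_) (hν.norm_sq_integral_smul_le hc hf hB)
    rw [← hm, integral_prod _ (by
      exact hI.bdd_mul hfm (.of_forall hff)),
      ← real_inner_self_eq_norm_sq, ← _root_.integral_inner hI']
    refine integral_congr_ae (.of_forall fun x => ?_)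
    simp only
    rw [real_inner_comm, ← _root_.integral_inner hI']
    refine integral_congr_ae (.of_forall fun x' => ?_)
    simp only [inner_smul_left, inner_smul_right, conj_trivial]
    ring
  -- The remainder of the exponential.
  have hR2 : ∀ p, R p ^ 2 ≤ δ ^ 4 * (24 * (8 * c) ^ 4) *
      (Real.exp (1 / (8 * c) * ‖p.1 - m‖ ^ 2) * Real.exp (1 / (8 * c) * ‖p.2 - m‖ ^ 2)) := by
    intro p
    set u := |⟪p.1 - m, p.2 - m⟫| with hu
    have hu0 : 0 ≤ u := abs_nonneg _
    set κ := 1 / (8 * c) with hκ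
    have hκ0 : 0 < κ := by positivity
    have hκc : 8 * c * κ = 1 := by rw [hκ]; field_simp
    have hδκ : 2 * δ ≤ κ := by
      have : 1 / (16 * c) = κ / 2 := by rw [hκ]; field_simp; norm_num
      linarith
    have h1 : R p ^ 2 ≤ δ ^ 4 * u ^ 4 * Real.exp (2 * δ * u) := by
      refine (sq_exp_sub_one_sub_le _).trans_eq ?_
      rw [abs_mul, abs_of_pos hδ0, mul_pow, hu, Even.pow_abs (by decide)]
      ring_nf
    have h2 : (κ * u) ^ 4 ≤ 24 * Real.exp (κ * u) := by
      have := Real.pow_div_factorial_le_exp (x := κ * u) (by positivity) 4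
      rw [div_le_iff₀ (by positivity)] at this
      simpa [Nat.factorial, mul_comm] using this
    have h3 : u ^ 4 ≤ 24 * (8 * c) ^ 4 * Real.exp (κ * u) := by
      have : u ^ 4 = (8 * c) ^ 4 * (κ * u) ^ 4 := by
        rw [← mul_pow, ← mul_assoc, hκc, one_mul]
      rw [this]
      calc (8 * c) ^ 4 * (κ * u) ^ 4 ≤ (8 * c) ^ 4 * (24 * Real.exp (κ * u)) := by gcongr
        _ = _ := by ring
    have h4 := two_mul_abs_inner_le (p.1 - m) (p.2 - m)
    calc R p ^ 2 ≤ δ ^ 4 * u ^ 4 * Real.exp (2 * δ * u) := h1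
      _ ≤ δ ^ 4 * (24 * (8 * c) ^ 4 * Real.exp (κ * u)) * Real.exp (κ * u) := by gcongr
      _ = δ ^ 4 * (24 * (8 * c) ^ 4) * Real.exp (κ * (2 * u)) := by
        rw [mul_comm 2 u, ← mul_assoc κ, mul_two, Real.exp_add]; ring
      _ ≤ δ ^ 4 * (24 * (8 * c) ^ 4) * Real.exp (κ * (‖p.1 - m‖ ^ 2 + ‖p.2 - m‖ ^ 2)) := by
        gcongr
      _ = _ := by rw [mul_add, Real.exp_add]
  have hEE := ((hν.integrable_exp_sq hc).mul_prod (hν.integrable_exp_sq hc)).const_mul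
    (δ ^ 4 * (24 * (8 * c) ^ 4))
  have hK0 : 0 ≤ ∫ x, Real.exp (1 / (8 * c) * ‖x - m‖ ^ 2) ∂ν :=
    integral_nonneg fun x => (Real.exp_pos _).le
  have hKle : ∫ x, Real.exp (1 / (8 * c) * ‖x - m‖ ^ 2) ∂ν ≤ K := hν.integral_exp_sq_le hc
  have hRL : MemLp R 2 (ν.prod ν) := by
    rw [memLp_two_iff_integrable_sq hRi.1]
    refine hEE.mono' (by exact hRi.1.pow 2) (.of_forall fun p => ?_)
    rw [Real.norm_of_nonneg (sq_nonneg _)]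
    exact hR2 p
  have hR2int : ∫ p, R p ^ 2 ∂ν.prod ν ≤ δ ^ 4 * (24 * (8 * c) ^ 4) * (K * K) := by
    refine (integral_mono hRL.integrable_sq hEE hR2).trans ?_
    rw [integral_const_mul, integral_prod_mul
      (fun x => Real.exp (1 / (8 * c) * ‖x - ∫ x, x ∂ν‖ ^ 2))
      (fun x => Real.exp (1 / (8 * c) * ‖x - ∫ x, x ∂ν‖ ^ 2))]
    exact mul_le_mul_of_nonneg_left (mul_le_mul hKle hKle hK0 (hK0.trans hKle)) (by positivity)
  have hffL : MemLp (fun p : Space d × Space d => f p.1 * f p.2) 2 (ν.prod ν) :=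
    MemLp.of_bound hfm (B * B) (.of_forall hff)
  have hS0 : 0 ≤ ∫ x, f x ^ 2 ∂ν := integral_nonneg fun x => sq_nonneg _
  have second : ∫ p : Space d × Space d, f p.1 * f p.2 * R p ∂ν.prod ν ≤
      δ ^ 2 * (320 * c ^ 2 * K) * ∫ x, f x ^ 2 ∂ν := by
    have h1 := sq_integral_mul_le hffL hRL
    have h2 : ∫ p : Space d × Space d, (f p.1 * f p.2) ^ 2 ∂ν.prod ν = (∫ x, f x ^ 2 ∂ν) ^ 2 := by
      simp_rw [mul_pow]
      rw [integral_prod_mul (fun x => f x ^ 2) (fun x => f x ^ 2), sq]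
    rw [h2] at h1
    have hK : 0 ≤ K := hK0.trans hKle
    refine le_of_sq_le_sq ?_ (by positivity)
    calc _ ≤ (∫ x, f x ^ 2 ∂ν) ^ 2 * (δ ^ 4 * (24 * (8 * c) ^ 4) * (K * K)) :=
          h1.trans (mul_le_mul_of_nonneg_left hR2int (sq_nonneg _))
      _ ≤ _ := by
        have : 0 ≤ (∫ x, f x ^ 2 ∂ν) ^ 2 * δ ^ 4 * c ^ 4 * K ^ 2 := by positivity
        nlinarith
  calc _ ≤ δ * (c * ∫ x, f x ^ 2 ∂ν) + δ ^ 2 * (320 * c ^ 2 * K) * ∫ x, f x ^ 2 ∂ν :=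
        add_le_add (mul_le_mul_of_nonneg_left first hδ0.le) second
    _ = _ := by ring

/-- The rate at which one localization step of length `δ` resolves the variance. It is
`c δ + O(δ²)`, where the error depends only on `d` and `c`. -/
def stepRate (d : ℕ) (c δ : ℝ) : ℝ :=
  Real.exp (δ * (4 * c * squareExpBound d c)) *
    (δ * c + δ ^ 2 * (320 * c ^ 2 * squareExpBound d c))

/-- A localization step of length `δ` started at `ν` reduces the variance of `f` by at most the
factor `1 - c δ + O(δ²)`. -/
theorem SubGaussianWith.meanEnergy_le (hν : SubGaussianWith ν c) (hc : 0 < c)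
    (hf : Measurable f) (hB : ∀ x, |f x| ≤ B) (hδ0 : 0 < δ) (hδ : δ ≤ 1 / (16 * c)) :
    meanEnergy ν f δ ≤ ENNReal.ofReal ((∫ x, f x ∂ν) ^ 2 +
      stepRate d c δ * ((∫ x, f x ^ 2 ∂ν) - (∫ x, f x ∂ν) ^ 2)) := by
  set e := ∫ x, f x ∂ν with he
  set g : Space d → ℝ := fun x => f x - e
  have hfL := memLp_of_bounded (ν := ν) hf hB
  have hfi : Integrable f ν := hfL.integrable (by norm_num)
  have hg : Measurable g := hf.sub_const e
  have hgB : ∀ x, |g x| ≤ B + |e| := fun x => (abs_sub _ _).trans (by gcongr; exact hB x)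
  have hg0 : ∫ x, g x ∂ν = 0 := by
    simp only [g]; rw [integral_sub hfi (integrable_const _)]; simp [he]
  have hg2 : ∫ x, g x ^ 2 ∂ν = (∫ x, f x ^ 2 ∂ν) - e ^ 2 := by
    have : ∀ x, g x ^ 2 = f x ^ 2 - 2 * e * f x + e ^ 2 := fun x => by simp only [g]; ring
    simp_rw [this]
    rw [integral_add (by exact hfL.integrable_sq.sub (hfi.const_mul _)) (integrable_const _),
      integral_sub hfL.integrable_sq (hfi.const_mul _), integral_const_mul, ← he]
    simp; ring
  have hfg : f = fun x => g x + e := by ext x; simp [g]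
  have hg2' : 0 ≤ ∫ x, g x ^ 2 ∂ν := integral_nonneg fun x => sq_nonneg _
  have hK : 0 ≤ squareExpBound d c := ENNReal.toReal_nonneg
  have h1 := meanEnergy_add_const hg hgB hδ0 hg0 e
  rw [← hfg] at h1
  rw [h1, ← hg2, ENNReal.ofReal_add (sq_nonneg _) (by unfold stepRate; positivity)]
  gcongr
  refine (hν.meanEnergy_le_kernel hc hg hgB hδ0 hδ).trans (ENNReal.ofReal_le_ofReal ?_)
  rw [stepRate, mul_assoc]
  refine (mul_le_mul_of_nonneg_left (hν.integral_kernel_le hc hg hgB hg0 hδ0 hδ)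
    (Real.exp_pos _).le).trans (mul_le_mul_of_nonneg_right (Real.exp_le_exp.2 ?_) (by positivity))
  have := hν.integral_norm_sq_sub_le hc
  nlinarith

end OneStep

/-! ### Localized measures and the decay of the residual variance -/

/-- The law of `X ∼ μ` conditioned on `s X + √s ζ = y`. -/
def slPosterior (μ : Measure (Space d)) (s : ℝ) (y : Space d) : Measure (Space d) :=
  μ.tilted (fun x => ⟪y, x⟫ - s / 2 * ‖x‖ ^ 2)

/-- The expected variance of `f` under the localized measures at time `s`, by the law of total
variance equal to `E f² - E (E[f(X) | s X + √s ζ])²`. -/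
def residualVar (μ : Measure (Space d)) (f : Space d → ℝ) (s : ℝ) : ℝ :=
  (∫ x, f x ^ 2 ∂μ) - (meanEnergy μ f s).toReal

lemma integral_slPosterior (μ : Measure (Space d)) (s : ℝ) (y : Space d) (g : Space d → ℝ) :
    ∫ x, g x ∂slPosterior μ s y = slMean μ g s y := by
  rw [slPosterior, integral_tilted, slMean, ← integral_div]
  refine integral_congr_ae (.of_forall fun x => ?_)
  simp only [smul_eq_mul, slWeight, slPartition]
  ring

lemma slWeight_mul_slWeight (s δ : ℝ) (y z x : Space d) :
    slWeight s y x * slWeight δ z x = slWeight (s + δ) (y + z) x := by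
  simp only [slWeight]
  rw [← Real.exp_add, inner_add_left]
  ring_nf

lemma slPartition_slPosterior (μ : Measure (Space d)) (s δ : ℝ) (y z : Space d) :
    slPartition (slPosterior μ s y) δ z = slPartition μ (s + δ) (y + z) / slPartition μ s y := by
  rw [slPartition, integral_slPosterior, slMean]
  simp_rw [mul_comm (slWeight δ z _), slWeight_mul_slWeight]
  rfl

section Posterior

variable {μ : Measure (Space d)} [IsProbabilityMeasure μ] {f : Space d → ℝ} {s δ c B : ℝ}

lemma isProbabilityMeasure_slPosterior (hs : 0 < s) (y : Space d) :
    IsProbabilityMeasure (slPosterior μ s y) :=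
  isProbabilityMeasure_tilted (integrable_slWeight hs y)

lemma integrable_slPosterior_iff (hs : 0 < s) (y : Space d) {g : Space d → ℝ} :
    Integrable g (slPosterior μ s y) ↔ Integrable (fun x => slWeight s y x * g x) μ :=
  integrable_tilted_iff (integrable_slWeight hs y) g

lemma slMean_slPosterior (hs : 0 < s) (δ : ℝ) (y z : Space d) :
    slMean (slPosterior μ s y) f δ z = slMean μ f (s + δ) (y + z) := by
  have hD := (slPartition_pos (μ := μ) hs y).ne'
  rw [slMean, slPartition_slPosterior, integral_slPosterior, slMean]
  simp_rw [mul_assoc, mul_comm (slWeight δ z _), slWeight_mul_slWeight]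
  rw [div_div_div_cancel_right₀ hD]
  rfl

/-- The Laplace transform of a localized measure is a quotient of partition functions. -/
lemma TiltBound.subGaussianWith (h : TiltBound μ s c) (hs : 0 < s) (y : Space d) :
    SubGaussianWith (slPosterior μ s y) c := by
  have e : ∀ v x : Space d, slWeight s y x * Real.exp ⟪v, x⟫ = slWeight s (y + v) x := by
    intro v x
    rw [slWeight, slWeight, ← Real.exp_add, inner_add_left]; ring_nf
  have hexp : ∀ v : Space d, ∫ x, Real.exp ⟪v, x⟫ ∂slPosterior μ s y =
      slPartition μ s (y + v) / slPartition μ s y := by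
    intro v
    rw [integral_slPosterior, slMean]
    simp_rw [mul_comm (Real.exp _), e]
    rfl
  refine ⟨fun v => ?_, ?_, fun v => ?_⟩
  · rw [integrable_slPosterior_iff hs]
    simp_rw [e]
    exact integrable_slWeight hs _
  · rw [memLp_two_iff_integrable_sq_norm (by fun_prop), integrable_slPosterior_iff hs]
    refine ((integrable_slWeight (half_pos hs) y).const_mul (4 / s)).mono' (by fun_prop)
      (.of_forall fun x => ?_)
    rw [Real.norm_of_nonneg (mul_nonneg (slWeight_pos _ _ _).le (sq_nonneg _))]
    have h1 := Real.add_one_le_exp (s / 4 * ‖x‖ ^ 2)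
    have h2 : slWeight (s / 2) y x = slWeight s y x * Real.exp (s / 4 * ‖x‖ ^ 2) := by
      rw [slWeight, slWeight, ← Real.exp_add]; ring_nf
    have h3 := slWeight_pos s y x
    have h4 : ‖x‖ ^ 2 = 4 / s * (s / 4 * ‖x‖ ^ 2) := by field_simp
    rw [h2, h4, mul_left_comm]
    gcongr
    rw [← h4]; linarith
  · have hD := slPartition_pos (μ := μ) hs y
    rw [hexp, hexp, div_mul_div_comm, ← sub_eq_add_neg, ← sq, div_le_iff₀ (by positivity)]
    exact h y v

lemma integral_slMean_mul_slPartition (hf : Measurable f) (hB : ∀ x, |f x| ≤ B) (hs : 0 < s) :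
    ∫ y, slMean μ f s y * slPartition μ s y ∂heatGaussian d s = ∫ x, f x ∂μ := by
  simp_rw [slMean_mul_slPartition hs]
  exact integral_integral_slWeight hf hB hs

lemma slMean_sq_le (hf : Measurable f) (hB : ∀ x, |f x| ≤ B) (hs : 0 < s) (y : Space d) :
    slMean μ f s y ^ 2 ≤ slMean μ (fun x => f x ^ 2) s y := by
  have := isProbabilityMeasure_slPosterior (μ := μ) hs y
  rw [← integral_slPosterior, ← integral_slPosterior]
  have h := sq_integral_mul_le (memLp_of_bounded (ν := slPosterior μ s y) hf hB)
    (memLp_const (1 : ℝ))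
  simpa using h

/-- The semigroup property of localization. -/
lemma meanEnergy_add (hf : Measurable f) (hs : 0 < s) (hδ : 0 < δ) :
    meanEnergy μ f (s + δ) = ∫⁻ y, ENNReal.ofReal (slPartition μ s y) *
      meanEnergy (slPosterior μ s y) f δ ∂heatGaussian d s := by
  rw [meanEnergy, ← lintegral_heatGaussian_add hs.le hδ.le (by
    exact (((measurable_slMean hf _).pow_const 2).mul
      (measurable_slPartition_right _)).ennreal_ofReal)]
  refine lintegral_congr fun y => ?_
  rw [meanEnergy, ← lintegral_const_mul' _ _ ENNReal.ofReal_ne_top]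
  refine lintegral_congr fun z => ?_
  have hD := slPartition_pos (μ := μ) hs y
  rw [← ENNReal.ofReal_mul hD.le, slMean_slPosterior hs, slPartition_slPosterior]
  congr 1
  field_simp

lemma meanEnergy_le_integral_sq (hf : Measurable f) (hB : ∀ x, |f x| ≤ B) (hs : 0 < s) :
    (meanEnergy μ f s).toReal ≤ ∫ x, f x ^ 2 ∂μ := by
  have hB2 : ∀ x, |f x ^ 2| ≤ B ^ 2 := fun x => by
    rw [abs_pow]; exact pow_le_pow_left₀ (abs_nonneg _) (hB x) 2
  rw [meanEnergy_eq_ofReal hf hB hs, ENNReal.toReal_ofReal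
    (integral_nonneg fun y => slMean_sq_nonneg hs y),
    ← integral_slMean_mul_slPartition (hf.pow_const 2) hB2 hs]
  refine integral_mono (integrable_slMean_sq hf hB hs) ?_ fun y =>
    mul_le_mul_of_nonneg_right (slMean_sq_le hf hB hs y) (slPartition_pos hs y).le
  simp_rw [slMean_mul_slPartition hs]
  exact integrable_integral_slWeight (hf.pow_const 2) hB2 hs

lemma residualVar_nonneg (hf : Measurable f) (hB : ∀ x, |f x| ≤ B) (hs : 0 < s) :
    0 ≤ residualVar μ f s := sub_nonneg.2 (meanEnergy_le_integral_sq hf hB hs)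

/-- If all localizations at time `s` have covariance at most `c • Id`, the residual variance decays
at rate at most `c` at time `s`. -/
theorem TiltBound.residualVar_sub_le (h : TiltBound μ s c) (hs : 0 < s) (hc : 0 < c)
    (hf : Measurable f) (hB : ∀ x, |f x| ≤ B) (hδ0 : 0 < δ) (hδ : δ ≤ 1 / (16 * c)) :
    residualVar μ f s - residualVar μ f (s + δ) ≤ stepRate d c δ * residualVar μ f s := by
  have hB2 : ∀ x, |f x ^ 2| ≤ B ^ 2 := fun x => by
    rw [abs_pow]; exact pow_le_pow_left₀ (abs_nonneg _) (hB x) 2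
  have hf2 : Measurable fun x => f x ^ 2 := hf.pow_const 2
  have hK : 0 ≤ squareExpBound d c := ENNReal.toReal_nonneg
  have hρ : 0 ≤ stepRate d c δ := by unfold stepRate; positivity
  set ρ := stepRate d c δ
  set G := ∫ y, slMean μ f s y ^ 2 * slPartition μ s y ∂heatGaussian d s with hG
  have hG0 : 0 ≤ G := integral_nonneg fun y => slMean_sq_nonneg hs y
  have hGs : (meanEnergy μ f s).toReal = G := by
    rw [meanEnergy_eq_ofReal hf hB hs, ENNReal.toReal_ofReal hG0]
  have i1 := integrable_slMean_sq (μ := μ) hf hB hs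
  have i2 : Integrable (fun y => slMean μ (fun x => f x ^ 2) s y * slPartition μ s y)
      (heatGaussian d s) := by
    simp_rw [slMean_mul_slPartition hs]
    exact integrable_integral_slWeight hf2 hB2 hs
  have hpt : ∀ y, ENNReal.ofReal (slPartition μ s y) * meanEnergy (slPosterior μ s y) f δ ≤
      ENNReal.ofReal (slMean μ f s y ^ 2 * slPartition μ s y + ρ *
        (slMean μ (fun x => f x ^ 2) s y * slPartition μ s y -
          slMean μ f s y ^ 2 * slPartition μ s y)) := by
    intro y
    have := isProbabilityMeasure_slPosterior (μ := μ) hs y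
    have h1 := (h.subGaussianWith hs y).meanEnergy_le hc hf hB hδ0 hδ
    rw [integral_slPosterior, integral_slPosterior] at h1
    refine (mul_le_mul_right h1 _).trans_eq ?_
    rw [← ENNReal.ofReal_mul (slPartition_pos hs y).le]
    congr 1; ring
  have hle : meanEnergy μ f (s + δ) ≤
      ENNReal.ofReal (G + ρ * ((∫ x, f x ^ 2 ∂μ) - G)) := by
    rw [meanEnergy_add hf hs hδ0]
    refine (lintegral_mono hpt).trans_eq ?_
    rw [← ofReal_integral_eq_lintegral_ofReal (by exact i1.add ((i2.sub i1).const_mul ρ))]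
    · rw [integral_add i1 (by exact (i2.sub i1).const_mul ρ), integral_const_mul,
        integral_sub i2 i1, integral_slMean_mul_slPartition hf2 hB2 hs]
    · refine .of_forall fun y => ?_
      have h1 := slMean_sq_nonneg (μ := μ) (f := f) hs y
      have h2 : 0 ≤ slMean μ (fun x => f x ^ 2) s y * slPartition μ s y -
          slMean μ f s y ^ 2 * slPartition μ s y := by
        rw [← sub_mul]
        exact mul_nonneg (sub_nonneg.2 (slMean_sq_le hf hB hs y)) (slPartition_pos hs y).le
      exact add_nonneg h1 (mul_nonneg hρ h2)
  have hA := residualVar_nonneg (μ := μ) hf hB hs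
  rw [residualVar, hGs] at hA
  have h2 := ENNReal.toReal_le_of_le_ofReal (add_nonneg hG0 (mul_nonneg hρ hA)) hle
  simp only [residualVar, hGs]
  linarith

/-! ### Continuity, and comparison with the noisy channel -/

lemma lintegral_mul_slPartition (hs : 0 < s) {F : Space d → ℝ≥0∞} (hF : Measurable F) :
    ∫⁻ y, F y * ENNReal.ofReal (slPartition μ s y) ∂heatGaussian d s =
      ∫⁻ x, ∫⁻ y, F (y + s • x) ∂heatGaussian d s ∂μ := by
  calc _ = ∫⁻ y, ∫⁻ x, F y * ENNReal.ofReal (slWeight s y x) ∂μ ∂heatGaussian d s := by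
        refine lintegral_congr fun y => ?_
        rw [ofReal_slPartition hs, lintegral_const_mul _ (by fun_prop)]
    _ = ∫⁻ x, ∫⁻ y, F y * ENNReal.ofReal (slWeight s y x) ∂heatGaussian d s ∂μ :=
        lintegral_lintegral_swap (by fun_prop)
    _ = _ := lintegral_congr fun x => lintegral_slWeight_heatGaussian hs x hF

lemma meanEnergy_eq_channel (hf : Measurable f) (hs : 0 < s) :
    meanEnergy μ f s = ∫⁻ p : Space d × Space d,
      ENNReal.ofReal (slMean μ f s (Real.sqrt s • p.2 + s • p.1) ^ 2)
        ∂μ.prod (stdGaussian (Space d)) := by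
  have hm := ((measurable_slMean (μ := μ) hf s).pow_const 2).ennreal_ofReal
  rw [lintegral_prod _ (by
    exact (hm.comp (g := fun y => ENNReal.ofReal (slMean μ f s y ^ 2))
      (f := fun p : Space d × Space d => Real.sqrt s • p.2 + s • p.1) (by fun_prop)).aemeasurable)]
  rw [meanEnergy]
  simp_rw [ENNReal.ofReal_mul (sq_nonneg (slMean μ f s _))]
  rw [lintegral_mul_slPartition hs hm]
  refine lintegral_congr fun x => ?_
  rw [lintegral_heatGaussian s (F := fun y => ENNReal.ofReal (slMean μ f s (y + s • x) ^ 2))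
    (hm.comp (by fun_prop))]

lemma continuousOn_integral_slWeight (hf : Measurable f) (hB : ∀ x, |f x| ≤ B) :
    ContinuousOn (fun p : ℝ × Space d => ∫ x, f x * slWeight p.1 p.2 x ∂μ)
      (Ioi 0 ×ˢ univ) := by
  rintro ⟨s, y⟩ ⟨hs, -⟩
  have hs : 0 < s := hs
  refine ContinuousAt.continuousWithinAt ?_
  have hnear : ∀ᶠ p : ℝ × Space d in nhds (s, y), s / 2 < p.1 ∧ ‖p.2‖ < ‖y‖ + 1 := by
    refine ((isOpen_lt (continuous_const (y := s / 2)) (continuous_fst (X := ℝ) (Y := Space d))).inter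
      (isOpen_lt (continuous_snd (X := ℝ) (Y := Space d)).norm
        (continuous_const (y := ‖y‖ + 1)))).mem_nhds ⟨?_, ?_⟩
    · show s / 2 < s; linarith
    · show ‖y‖ < ‖y‖ + 1; linarith
  refine continuousAt_of_dominated (bound := fun _ => B * Real.exp ((‖y‖ + 1) ^ 2 / (2 * (s / 2))))
    (.of_forall fun p => by fun_prop) ?_ (integrable_const _) (.of_forall fun x => ?_)
  · filter_upwards [hnear] with p hp
    refine .of_forall fun x => ?_
    have hp1 : 0 < p.1 := (half_pos hs).trans hp.1
    have hB0 : 0 ≤ B := (abs_nonneg _).trans (hB x)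
    rw [norm_mul, Real.norm_of_nonneg (slWeight_pos _ _ _).le]
    refine mul_le_mul (hB x) ((slWeight_le hp1 _ _).trans ?_) (slWeight_pos _ _ _).le hB0
    have h1 := hp.1
    have h2 := hp.2
    gcongr
  · exact (continuous_const.mul (continuous_slWeight.comp (by fun_prop :
      Continuous fun p : ℝ × Space d => (p.1, p.2, x)))).continuousAt

/-- After the Cameron–Martin change of variables the noise has a law independent of `s`, and dominated
convergence applies. -/
lemma continuousOn_residualVar (hf : Measurable f) (hB : ∀ x, |f x| ≤ B) :
    ContinuousOn (residualVar μ f) (Ioi 0) := by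
  refine continuousOn_const.sub ?_
  have hchan : ∀ s ∈ Ioi (0 : ℝ), (meanEnergy μ f s).toReal = ∫ p : Space d × Space d,
      slMean μ f s (Real.sqrt s • p.2 + s • p.1) ^ 2 ∂μ.prod (stdGaussian (Space d)) := by
    intro s hs
    rw [meanEnergy_eq_channel hf hs, integral_eq_lintegral_of_nonneg_ae
      (.of_forall fun p => sq_nonneg _)]
    exact (((measurable_slMean hf s).comp (by fun_prop)).pow_const 2).aestronglyMeasurable
  refine ContinuousOn.congr ?_ hchan
  refine continuousOn_of_dominated (bound := fun _ => B ^ 2)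
    (fun s hs => (((measurable_slMean hf s).comp (by fun_prop)).pow_const 2).aestronglyMeasurable)
    (fun s hs => .of_forall fun p => ?_) (integrable_const _) (.of_forall fun p => ?_)
  · rw [norm_pow, Real.norm_eq_abs]
    exact pow_le_pow_left₀ (abs_nonneg _) (abs_slMean_le hf hB hs _) 2
  · have hN := continuousOn_integral_slWeight (μ := μ) hf hB
    have hD := continuousOn_integral_slWeight (μ := μ) (f := fun _ => 1) (B := 1) measurable_const
      (by simp)
    have hmap : ContinuousOn (fun s : ℝ => (s, Real.sqrt s • p.2 + s • p.1)) (Ioi 0) := by fun_prop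
    have hmaps : MapsTo (fun s : ℝ => (s, Real.sqrt s • p.2 + s • p.1)) (Ioi 0)
        (Ioi 0 ×ˢ univ) := fun s hs => ⟨hs, mem_univ _⟩
    have h1 := hN.comp hmap hmaps
    have h2 := hD.comp hmap hmaps
    refine ((h1.div h2 fun s hs => ?_).pow 2).congr fun s hs => ?_
    · simpa [slPartition] using (slPartition_pos (μ := μ) hs _).ne'
    · simp [slMean, slPartition]

/-- The posterior mean is the best predictor of `f(X)`; it beats the predictor
`f(X + ζ / √s)`. -/
lemma residualVar_le_channel (hf : Measurable f) (hB : ∀ x, |f x| ≤ B) (hs : 0 < s) :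
    ENNReal.ofReal (residualVar μ f s) ≤ ∫⁻ x, ∫⁻ z,
      ENNReal.ofReal ((f x - f (x + (1 / Real.sqrt s) • z)) ^ 2) ∂stdGaussian (Space d) ∂μ := by
  have hB2 : ∀ x, |f x ^ 2| ≤ B ^ 2 := fun x => by
    rw [abs_pow]; exact pow_le_pow_left₀ (abs_nonneg _) (hB x) 2
  have hf2 : Measurable fun x => f x ^ 2 := hf.pow_const 2
  have i1 := integrable_slMean_sq (μ := μ) hf hB hs
  have i2 : Integrable (fun y => slMean μ (fun x => f x ^ 2) s y * slPartition μ s y)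
      (heatGaussian d s) := by
    simp_rw [slMean_mul_slPartition hs]
    exact integrable_integral_slWeight hf2 hB2 hs
  have e1 : residualVar μ f s = ∫ y, (slMean μ (fun x => f x ^ 2) s y * slPartition μ s y -
      slMean μ f s y ^ 2 * slPartition μ s y) ∂heatGaussian d s := by
    rw [integral_sub i2 i1, integral_slMean_mul_slPartition hf2 hB2 hs, residualVar,
      meanEnergy_eq_ofReal hf hB hs,
      ENNReal.toReal_ofReal (integral_nonneg fun y => slMean_sq_nonneg hs y)]
  rw [e1, ofReal_integral_eq_lintegral_ofReal (by exact i2.sub i1) (.of_forall fun y => by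
    show 0 ≤ _ - _
    rw [← sub_mul]
    exact mul_nonneg (sub_nonneg.2 (slMean_sq_le hf hB hs y)) (slPartition_pos hs y).le)]
  have hpt : ∀ y, ENNReal.ofReal (slMean μ (fun x => f x ^ 2) s y * slPartition μ s y -
      slMean μ f s y ^ 2 * slPartition μ s y) ≤
      ∫⁻ x, ENNReal.ofReal ((f x - f (s⁻¹ • y)) ^ 2) * ENNReal.ofReal (slWeight s y x) ∂μ := by
    intro y
    set b := f (s⁻¹ • y)
    have hD := slPartition_pos (μ := μ) hs y
    have iw := integrable_slWeight (μ := μ) hs y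
    have ifw := integrable_mul_slWeight (μ := μ) hf hB hs y
    have if2w := integrable_mul_slWeight (μ := μ) hf2 hB2 hs y
    have e2 : ∀ x, (f x - b) ^ 2 * slWeight s y x =
        f x ^ 2 * slWeight s y x - 2 * b * (f x * slWeight s y x) + b ^ 2 * slWeight s y x :=
      fun x => by ring
    have i3 : Integrable (fun x => (f x - b) ^ 2 * slWeight s y x) μ := by
      simp_rw [e2]
      exact (if2w.sub (ifw.const_mul _)).add (iw.const_mul _)
    have e3 : ∫ x, (f x - b) ^ 2 * slWeight s y x ∂μ =
        slMean μ (fun x => f x ^ 2) s y * slPartition μ s y -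
          2 * b * (slMean μ f s y * slPartition μ s y) + b ^ 2 * slPartition μ s y := by
      simp_rw [e2]
      rw [integral_add (by exact if2w.sub (ifw.const_mul _)) (iw.const_mul _),
        integral_sub if2w (ifw.const_mul _), integral_const_mul, integral_const_mul,
        slMean_mul_slPartition hs, slMean_mul_slPartition hs, slPartition]
    simp_rw [← ENNReal.ofReal_mul (sq_nonneg (f _ - b))]
    rw [← ofReal_integral_eq_lintegral_ofReal i3 (.of_forall fun x =>
      mul_nonneg (sq_nonneg _) (slWeight_pos _ _ _).le), e3]
    refine ENNReal.ofReal_le_ofReal ?_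
    nlinarith [mul_nonneg (sq_nonneg (slMean μ f s y - b)) hD.le]
  refine (lintegral_mono hpt).trans_eq ?_
  rw [lintegral_lintegral_swap (by fun_prop)]
  refine lintegral_congr fun x => ?_
  rw [lintegral_slWeight_heatGaussian hs x
    (F := fun y => ENNReal.ofReal ((f x - f (s⁻¹ • y)) ^ 2)) (by fun_prop),
    lintegral_heatGaussian s (by fun_prop)]
  refine lintegral_congr fun z => ?_
  have e4 : s⁻¹ • (Real.sqrt s • z + s • x) = x + (1 / Real.sqrt s) • z := by
    have h1 : s⁻¹ * Real.sqrt s = 1 / Real.sqrt s := by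
      have := Real.sq_sqrt hs.le
      have h2 := (Real.sqrt_pos.2 hs).ne'
      field_simp
      linarith
    rw [smul_add, smul_smul, smul_smul, inv_mul_cancel₀ hs.ne', one_smul, h1, add_comm]
  rw [e4]

end Posterior

/-! ### Grönwall's inequality for the residual variance -/

section Decay

variable {μ : Measure (Space d)} [IsProbabilityMeasure μ] {f : Space d → ℝ} {B : ℝ}

lemma stepRate_nonneg {c δ : ℝ} (hc : 0 < c) (hδ : 0 ≤ δ) : 0 ≤ stepRate d c δ := by
  have hK : 0 ≤ squareExpBound d c := ENNReal.toReal_nonneg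
  unfold stepRate; positivity

lemma stepRate_zero (c : ℝ) : stepRate d c 0 = 0 := by simp [stepRate]

lemma hasDerivAt_stepRate (c : ℝ) : HasDerivAt (stepRate d c) c 0 := by
  have h1 : HasDerivAt (fun δ : ℝ => Real.exp (δ * (4 * c * squareExpBound d c)))
      (Real.exp (0 * (4 * c * squareExpBound d c)) * (1 * (4 * c * squareExpBound d c))) 0 :=
    ((hasDerivAt_id (0 : ℝ)).mul_const _).exp
  have h2 : HasDerivAt (fun δ : ℝ => δ * c + δ ^ 2 * (320 * c ^ 2 * squareExpBound d c))
      (1 * c + (2 : ℕ) * (0 : ℝ) ^ (2 - 1) * 1 * (320 * c ^ 2 * squareExpBound d c)) 0 :=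
    ((hasDerivAt_id (0 : ℝ)).mul_const _).add (((hasDerivAt_id (0 : ℝ)).pow 2).mul_const _)
  exact (h1.mul h2).congr_deriv (by simp)

open Filter Topology in
/-- The logarithmic decay rate of the residual variance is at most the covariance bound. -/
lemma TiltBound.eventually_neg_log_sub_le {s c : ℝ} (h : TiltBound μ s c) (hs : 0 < s) (hc : 0 < c)
    (hf : Measurable f) (hB : ∀ x, |f x| ≤ B) {ε : ℝ} (hε : 0 < ε) {η : ℝ → ℝ} {η' : ℝ}
    (hη : HasDerivAt η η' s) {r : ℝ} (hr : c - η' < r) :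
    ∀ᶠ u in 𝓝[>] s, (-Real.log (residualVar μ f u + ε) - η u) -
      (-Real.log (residualVar μ f s + ε) - η s) ≤ (u - s) * r := by
  set A := residualVar μ f with hA
  -- A differentiable majorant of the increment.
  set F : ℝ → ℝ := fun u => stepRate d c (u - s) / (1 - stepRate d c (u - s)) - (η u - η s)
  have hF : HasDerivAt F (c - η') s := by
    have h0 : HasDerivAt (fun u => stepRate d c (u - s)) c s := by
      have h1 : HasDerivAt (stepRate d c) c (s - s) := by
        rw [sub_self]; exact hasDerivAt_stepRate c
      simpa using h1.comp_sub_const s s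
    have h2 := (h0.div ((hasDerivAt_const s (1 : ℝ)).sub h0)
      (by simp [stepRate_zero])).sub (hη.sub_const (η s))
    exact h2.congr_deriv (by simp [stepRate_zero])
  have hF0 : F s = 0 := by simp [F, stepRate_zero]
  have e1 := hF.hasDerivWithinAt.limsup_slope_le' (s := Ioi s) (notMem_Ioi.2 le_rfl) hr
  have hρ : Tendsto (fun u => stepRate d c (u - s)) (𝓝[>] s) (𝓝 0) := by
    have h1 : ContinuousAt (fun u => stepRate d c (u - s)) s := by unfold stepRate; fun_prop
    have h2 : Tendsto (fun u => stepRate d c (u - s)) (𝓝 s) (𝓝 (stepRate d c (s - s))) := h1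
    rw [sub_self, stepRate_zero] at h2
    exact h2.mono_left nhdsWithin_le_nhds
  have e2 : ∀ᶠ u in 𝓝[>] s, stepRate d c (u - s) < 1 := hρ.eventually (gt_mem_nhds one_pos)
  have e3 : ∀ᶠ u in 𝓝[>] s, u ∈ Ioc s (s + 1 / (16 * c)) :=
    Ioc_mem_nhdsGT (by have : 0 < 1 / (16 * c) := by positivity
                       linarith)
  filter_upwards [e1, e2, e3] with u h1 h2 h3
  have hu : 0 < u - s := sub_pos.2 h3.1
  have hu0 : 0 < u := hs.trans h3.1
  have step := h.residualVar_sub_le hs hc hf hB hu (by linarith [h3.2])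
  rw [add_sub_cancel] at step
  set ρ := stepRate d c (u - s)
  have hρ0 : 0 ≤ ρ := stepRate_nonneg hc hu.le
  have hAs : 0 ≤ A s := residualVar_nonneg hf hB hs
  have hAu : 0 ≤ A u := residualVar_nonneg hf hB hu0
  have hlow : (1 - ρ) * (A s + ε) ≤ A u + ε := by nlinarith
  have h1ρ : 0 < 1 - ρ := sub_pos.2 h2
  have hlog : Real.log (A s + ε) - Real.log (A u + ε) ≤ ρ / (1 - ρ) := by
    have h4 := Real.log_le_log (by positivity) hlow
    rw [Real.log_mul h1ρ.ne' (by positivity)] at h4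
    have h5 := Real.one_sub_inv_le_log_of_pos h1ρ
    have h6 : ρ / (1 - ρ) = -(1 - (1 - ρ)⁻¹) := by field_simp; ring
    linarith
  have h7 : F u ≤ (u - s) * r := by
    have := mul_le_mul_of_nonneg_left h1.le hu.le
    rwa [← smul_eq_mul, sub_smul_slope, vsub_eq_sub, hF0, sub_zero] at this
  simp only [F] at h7
  linarith

/-- Grönwall's inequality for the residual variance. The function `η` carries the explicit part of
the covariance bound `c`, and only the rest has to be integrated. -/
theorem residualVar_le_of_tiltBound {a b : ℝ} (ha : 0 < a) (hab : a ≤ b) {c η η' : ℝ → ℝ}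
    (hc : ∀ s ∈ Ico a b, 0 < c s) (h : ∀ s ∈ Ico a b, TiltBound μ s (c s))
    (hη : ∀ s ∈ Icc a b, HasDerivAt η (η' s) s)
    (hfin : ∫⁻ s in Ioc a b, ENNReal.ofReal (c s - η' s) ≠ ∞)
    (hf : Measurable f) (hB : ∀ x, |f x| ≤ B) :
    residualVar μ f a ≤ Real.exp ((∫⁻ s in Ioc a b, ENNReal.ofReal (c s - η' s)).toReal +
      (η b - η a)) * residualVar μ f b := by
  set A := residualVar μ f
  set I := (∫⁻ s in Ioc a b, ENNReal.ofReal (c s - η' s)).toReal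
  have hAa : 0 ≤ A a := residualVar_nonneg hf hB ha
  have hAb : 0 ≤ A b := residualVar_nonneg hf hB (ha.trans_le hab)
  have hsub : Icc a b ⊆ Ioi 0 := fun s hs => ha.trans_le hs.1
  have key : ∀ ε > 0, A a + ε ≤ Real.exp (I + (η b - η a)) * (A b + ε) := by
    intro ε hε
    have hcont : ContinuousOn (fun u => -Real.log (A u + ε) - η u) (Icc a b) := by
      refine ContinuousOn.sub (ContinuousOn.neg (ContinuousOn.log
        (((continuousOn_residualVar hf hB).mono hsub).add continuousOn_const) fun u hu => ?_))
        fun u hu => (hη u hu).continuousAt.continuousWithinAt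
      have : 0 ≤ A u := residualVar_nonneg hf hB (hsub hu)
      positivity
    have h1 := ofReal_sub_le_lintegral_of_slope_le hab hcont (ψ := fun s => c s - η' s)
      fun s hs r hr => (h s hs).eventually_neg_log_sub_le (hsub ⟨hs.1, hs.2.le⟩) (hc s hs) hf hB hε
        (hη s ⟨hs.1, hs.2.le⟩) hr
    have h2 : Real.log (A a + ε) - Real.log (A b + ε) - (η b - η a) ≤ I := by
      have h3 := (ENNReal.ofReal_le_iff_le_toReal hfin).1 h1
      linarith
    have h4 : Real.log (A a + ε) ≤ (I + (η b - η a)) + Real.log (A b + ε) := by linarith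
    have h5 := Real.exp_le_exp.2 h4
    rwa [Real.exp_add, Real.exp_log (by positivity), Real.exp_log (by positivity)] at h5
  set E := Real.exp (I + (η b - η a))
  refine le_of_forall_pos_le_add fun ε hε => ?_
  have hE : 0 < E := Real.exp_pos _
  have h6 := key (ε / E) (by positivity)
  have h7 : E * (ε / E) = ε := by field_simp
  have h8 : 0 < ε / E := by positivity
  rw [mul_add, h7] at h6
  linarith

end Decay

/-! ### Most of the variance is left after a short time -/

section Initial

variable {μ : Measure (Space d)} [IsProbabilityMeasure μ] {f : Space d → ℝ} {B s lam : ℝ}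

/-- Jensen's inequality for `t ↦ 1 / t`, from its tangent line at the partition function. -/
lemma ofReal_inv_slPartition_le (hs : 0 < s) (y : Space d) :
    ENNReal.ofReal (1 / slPartition μ s y) ≤ ∫⁻ x, ENNReal.ofReal (1 / slWeight s y x) ∂μ := by
  set D := slPartition μ s y
  have hD : 0 < D := slPartition_pos hs y
  have h1 : ∀ x, ENNReal.ofReal (1 / D) + ENNReal.ofReal (1 / D) ≤
      ENNReal.ofReal (1 / slWeight s y x) +
        ENNReal.ofReal (1 / D ^ 2) * ENNReal.ofReal (slWeight s y x) := by
    intro x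
    have hw := slWeight_pos s y x
    rw [← ENNReal.ofReal_add (by positivity) (by positivity), ← ENNReal.ofReal_mul (by positivity),
      ← ENNReal.ofReal_add (by positivity) (by positivity)]
    refine ENNReal.ofReal_le_ofReal ?_
    have e : 1 / slWeight s y x + 1 / D ^ 2 * slWeight s y x - (1 / D + 1 / D) =
        (slWeight s y x - D) ^ 2 / (slWeight s y x * D ^ 2) := by field_simp; ring
    have : 0 ≤ (slWeight s y x - D) ^ 2 / (slWeight s y x * D ^ 2) := by positivity
    linarith
  have h2 := lintegral_mono (μ := μ) h1
  rw [lintegral_const, measure_univ, mul_one, lintegral_add_left (by fun_prop),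
    lintegral_const_mul _ (by fun_prop), ← ofReal_slPartition hs, ← ENNReal.ofReal_mul
    (by positivity)] at h2
  have e : 1 / D ^ 2 * D = 1 / D := by field_simp
  change _ ≤ _ + ENNReal.ofReal (1 / D ^ 2 * D) at h2
  rw [e] at h2
  exact (ENNReal.add_le_add_iff_right ENNReal.ofReal_ne_top).1 h2

/-- Jensen's inequality replaces the reciprocal partition function by an average over an independent
copy `X'`; the Gaussian integral in `y` is then `E exp (s ‖X - X'‖²)`, which splits by
`‖x - x'‖² ≤ 2 ‖x‖² + 2 ‖x'‖²`. -/
lemma lintegral_sq_slWeight_div_le (hlam : NormSubGaussian μ lam) (hs : 0 < s)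
    (hs' : s ≤ Real.log 2 / (4 * lam ^ 2)) :
    ∫⁻ y, (∫⁻ x, ENNReal.ofReal (slWeight s y x ^ 2) ∂μ) * ENNReal.ofReal (1 / slPartition μ s y)
      ∂heatGaussian d s ≤ ENNReal.ofReal (Real.exp (4 * s * lam ^ 2)) := by
  obtain ⟨hl, hsub⟩ := hlam
  have hmom : ∫⁻ x, ENNReal.ofReal (Real.exp (2 * s * ‖x‖ ^ 2)) ∂μ ≤
      ENNReal.ofReal (Real.exp (2 * s * lam ^ 2)) := by
    have h1 := hsub (Real.sqrt (2 * s)) ⟨le_trans (by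
      rw [neg_nonpos]; positivity) (Real.sqrt_nonneg _), ?_⟩
    · rwa [Real.sq_sqrt (by positivity)] at h1
    · rw [Real.sqrt_le_left (by positivity)]
      have hlog := Real.log_two_lt_d9
      rw [le_div_iff₀ (by positivity)] at hs'
      rw [div_pow, one_pow, le_div_iff₀ (by positivity)]
      nlinarith
  calc _ ≤ ∫⁻ y, (∫⁻ x, ENNReal.ofReal (slWeight s y x ^ 2) ∂μ) *
        (∫⁻ x, ENNReal.ofReal (1 / slWeight s y x) ∂μ) ∂heatGaussian d s := by
        gcongr with y
        exact ofReal_inv_slPartition_le hs y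
    _ = ∫⁻ y, ∫⁻ p : Space d × Space d, ENNReal.ofReal (slWeight s y p.1 ^ 2) *
          ENNReal.ofReal (1 / slWeight s y p.2) ∂μ.prod μ ∂heatGaussian d s := by
        refine lintegral_congr fun y => ?_
        exact (lintegral_prod_mul (f := fun x => ENNReal.ofReal (slWeight s y x ^ 2))
          (g := fun x => ENNReal.ofReal (1 / slWeight s y x)) (by fun_prop) (by fun_prop)).symm
    _ = ∫⁻ p : Space d × Space d, ∫⁻ y, ENNReal.ofReal (slWeight s y p.1 ^ 2) *
          ENNReal.ofReal (1 / slWeight s y p.2) ∂heatGaussian d s ∂μ.prod μ :=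
        lintegral_lintegral_swap (by fun_prop)
    _ = ∫⁻ p : Space d × Space d, ENNReal.ofReal (Real.exp (s * ‖p.1 - p.2‖ ^ 2)) ∂μ.prod μ := by
        refine lintegral_congr fun p => ?_
        have e : ∀ y, ENNReal.ofReal (slWeight s y p.1 ^ 2) * ENNReal.ofReal (1 / slWeight s y p.2) =
            ENNReal.ofReal (Real.exp (-s * ‖p.1‖ ^ 2 + s / 2 * ‖p.2‖ ^ 2)) *
              ENNReal.ofReal (Real.exp ⟪y, (2 : ℝ) • p.1 - p.2⟫) := by
          intro y
          rw [← ENNReal.ofReal_mul (by positivity), ← ENNReal.ofReal_mul (by positivity), slWeight,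
            slWeight, one_div, ← Real.exp_neg, ← Real.exp_nat_mul, ← Real.exp_add, ← Real.exp_add,
            inner_sub_right, inner_smul_right]
          congr 2; push_cast; ring
        simp_rw [e]
        rw [lintegral_const_mul _ (by fun_prop), lintegral_exp_inner_heatGaussian hs,
          ← ENNReal.ofReal_mul (by positivity), ← Real.exp_add]
        congr 2
        rw [norm_sub_sq_real, norm_sub_sq_real, norm_smul, inner_smul_left]
        simp; ring
    _ ≤ ∫⁻ p : Space d × Space d, ENNReal.ofReal (Real.exp (2 * s * ‖p.1‖ ^ 2)) *
          ENNReal.ofReal (Real.exp (2 * s * ‖p.2‖ ^ 2)) ∂μ.prod μ := by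
        refine lintegral_mono fun p => ?_
        simp only
        rw [← ENNReal.ofReal_mul (by positivity), ← Real.exp_add]
        refine ENNReal.ofReal_le_ofReal (Real.exp_le_exp.2 ?_)
        have h1 := norm_sub_sq_real p.1 p.2
        have h2 := norm_add_sq_real p.1 p.2
        have h3 := sq_nonneg ‖p.1 + p.2‖
        nlinarith
    _ = (∫⁻ x, ENNReal.ofReal (Real.exp (2 * s * ‖x‖ ^ 2)) ∂μ) *
          ∫⁻ x, ENNReal.ofReal (Real.exp (2 * s * ‖x‖ ^ 2)) ∂μ :=
        lintegral_prod_mul (f := fun x => ENNReal.ofReal (Real.exp (2 * s * ‖x‖ ^ 2)))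
          (g := fun x => ENNReal.ofReal (Real.exp (2 * s * ‖x‖ ^ 2))) (by fun_prop) (by fun_prop)
    _ ≤ ENNReal.ofReal (Real.exp (2 * s * lam ^ 2)) *
          ENNReal.ofReal (Real.exp (2 * s * lam ^ 2)) := mul_le_mul' hmom hmom
    _ = _ := by
        rw [← ENNReal.ofReal_mul (by positivity), ← Real.exp_add]
        ring_nf

/-- For centred `f`, the posterior mean carries at most the fraction `e^{4 s λ²} - 1` of the
variance, by a `χ²`-information bound for the channel `x ↦ s x + √s ζ`. -/
lemma meanEnergy_le_of_normSubGaussian (hlam : NormSubGaussian μ lam) (hs : 0 < s)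
    (hs' : s ≤ Real.log 2 / (4 * lam ^ 2)) (hf : Measurable f) (hB : ∀ x, |f x| ≤ B)
    (hf0 : ∫ x, f x ∂μ = 0) :
    meanEnergy μ f s + ENNReal.ofReal (∫ x, f x ^ 2 ∂μ) ≤
      ENNReal.ofReal (∫ x, f x ^ 2 ∂μ) * ENNReal.ofReal (Real.exp (4 * s * lam ^ 2)) := by
  set V := ∫ x, f x ^ 2 ∂μ
  have hV : 0 ≤ V := integral_nonneg fun x => sq_nonneg _
  have hwB : ∀ y x : Space d, |slWeight s y x| ≤ Real.exp (‖y‖ ^ 2 / (2 * s)) := fun y x =>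
    (abs_of_pos (slWeight_pos s y x)).trans_le (slWeight_le hs y x)
  have hpt : ∀ y, ENNReal.ofReal (slMean μ f s y ^ 2 * slPartition μ s y) +
      ENNReal.ofReal V * ENNReal.ofReal (slPartition μ s y) ≤ ENNReal.ofReal V *
      ((∫⁻ x, ENNReal.ofReal (slWeight s y x ^ 2) ∂μ) *
        ENNReal.ofReal (1 / slPartition μ s y)) := by
    intro y
    set D := slPartition μ s y with hDdef
    have hD : 0 < D := slPartition_pos hs y
    have hwL : MemLp (slWeight s y) 2 μ := memLp_of_bounded (by fun_prop) (hwB y)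
    have hwi := integrable_slWeight (μ := μ) hs y
    have hfL := memLp_of_bounded (ν := μ) hf hB
    have h1 := sq_integral_mul_le hfL (hwL.sub (memLp_const D))
    have e1 : ∫ x, f x * (slWeight s y - fun _ => D : Space d → ℝ) x ∂μ = slMean μ f s y * D := by
      have : ∀ x, f x * (slWeight s y - fun _ => D : Space d → ℝ) x = f x * slWeight s y x - f x * D :=
        fun x => by simp [mul_sub]
      simp_rw [this]
      rw [integral_sub (integrable_mul_slWeight hf hB hs y)
        ((hfL.integrable (by norm_num)).mul_const D), integral_mul_const, hf0,
        ← slMean_mul_slPartition hs]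
      simp [← hDdef]
    have e2 : ∫ x, (slWeight s y - fun _ => D : Space d → ℝ) x ^ 2 ∂μ =
        (∫ x, slWeight s y x ^ 2 ∂μ) - D ^ 2 := by
      have : ∀ x, (slWeight s y - fun _ => D : Space d → ℝ) x ^ 2 =
          slWeight s y x ^ 2 - 2 * D * slWeight s y x + D ^ 2 :=
        fun x => by simp only [Pi.sub_apply]; ring
      simp_rw [this]
      rw [integral_add (by exact hwL.integrable_sq.sub (hwi.const_mul _)) (integrable_const _),
        integral_sub hwL.integrable_sq (hwi.const_mul _), integral_const_mul]
      change _ - 2 * D * D + _ = _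
      simp; ring
    rw [e1, e2] at h1
    change _ ≤ V * _ at h1
    rw [← ofReal_integral_eq_lintegral_ofReal hwL.integrable_sq (.of_forall fun x => sq_nonneg _),
      ← ENNReal.ofReal_mul (p := ∫ x, slWeight s y x ^ 2 ∂μ)
        (integral_nonneg fun x => sq_nonneg _), ← ENNReal.ofReal_mul hV,
      ← ENNReal.ofReal_mul hV, ← ENNReal.ofReal_add (slMean_sq_nonneg hs y) (by positivity)]
    refine ENNReal.ofReal_le_ofReal ?_
    rw [mul_one_div, mul_div_assoc', le_div_iff₀ hD]
    nlinarith
  have h2 := lintegral_mono (μ := heatGaussian d s) hpt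
  rw [lintegral_add_right _ (by
      exact (measurable_slPartition_right s).ennreal_ofReal.const_mul _),
    lintegral_const_mul' _ _ ENNReal.ofReal_ne_top, lintegral_const_mul' _ _ ENNReal.ofReal_ne_top,
    ← ofReal_integral_eq_lintegral_ofReal (integrable_slPartition hs)
      (.of_forall fun y => (slPartition_pos hs y).le), integral_slPartition hs, ENNReal.ofReal_one,
    mul_one] at h2
  exact h2.trans (mul_le_mul_right (lintegral_sq_slWeight_div_le hlam hs hs') _)

/-- The lower end of the time interval: at time `s` at least the fraction `2 - e^{4 s λ²}` of the
variance is still unresolved. -/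
theorem variance_le_residualVar (hlam : NormSubGaussian μ lam) (hs : 0 < s)
    (hs' : s ≤ Real.log 2 / (4 * lam ^ 2)) (hf : Measurable f) (hB : ∀ x, |f x| ≤ B) :
    (2 - Real.exp (4 * s * lam ^ 2)) * ((∫ x, f x ^ 2 ∂μ) - (∫ x, f x ∂μ) ^ 2) ≤
      residualVar μ f s := by
  set e := ∫ x, f x ∂μ with he
  set g : Space d → ℝ := fun x => f x - e
  have hfL := memLp_of_bounded (ν := μ) hf hB
  have hfi : Integrable f μ := hfL.integrable (by norm_num)
  have hg : Measurable g := hf.sub_const e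
  have hgB : ∀ x, |g x| ≤ B + |e| := fun x => (abs_sub _ _).trans (by gcongr; exact hB x)
  have hg0 : ∫ x, g x ∂μ = 0 := by
    simp only [g]; rw [integral_sub hfi (integrable_const _)]; simp [he]
  have hg2 : ∫ x, g x ^ 2 ∂μ = (∫ x, f x ^ 2 ∂μ) - e ^ 2 := by
    have : ∀ x, g x ^ 2 = f x ^ 2 - 2 * e * f x + e ^ 2 := fun x => by simp only [g]; ring
    simp_rw [this]
    rw [integral_add (by exact hfL.integrable_sq.sub (hfi.const_mul _)) (integrable_const _),
      integral_sub hfL.integrable_sq (hfi.const_mul _), integral_const_mul, ← he]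
    simp; ring
  have hfg : f = fun x => g x + e := by ext x; simp [g]
  have h1 := meanEnergy_add_const hg hgB hs hg0 e
  rw [← hfg] at h1
  have h2 := meanEnergy_le_of_normSubGaussian hlam hs hs' hg hgB hg0
  set V := ∫ x, g x ^ 2 ∂μ
  have hV : 0 ≤ V := integral_nonneg fun x => sq_nonneg _
  have hfin : meanEnergy μ g s ≠ ∞ := by
    rw [meanEnergy_eq_ofReal hg hgB hs]; exact ENNReal.ofReal_ne_top
  rw [← ENNReal.ofReal_toReal hfin] at h1 h2
  set G := (meanEnergy μ g s).toReal
  have hG : 0 ≤ G := ENNReal.toReal_nonneg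
  rw [← ENNReal.ofReal_add hG hV, ← ENNReal.ofReal_mul hV,
    ENNReal.ofReal_le_ofReal_iff (by positivity)] at h2
  rw [← ENNReal.ofReal_add (sq_nonneg _) hG] at h1
  rw [residualVar, h1, ENNReal.toReal_ofReal (by positivity), ← hg2]
  have : ∫ x, f x ^ 2 ∂μ = V + e ^ 2 := by linarith
  rw [this]
  nlinarith

end Initial

/-! ### Difference quotients along a Gaussian channel and the Dirichlet energy -/

section Channel

lemma measurable_gradient (f : Space d → ℝ) : Measurable (∇ f) :=
  (InnerProductSpace.toDual ℝ (Space d)).symm.continuous.measurable.comp (measurable_fderiv ℝ f)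

lemma hasDerivAt_comp_line {f : Space d → ℝ} (hf : Differentiable ℝ f) (x h : Space d) (t : ℝ) :
    HasDerivAt (fun t : ℝ => f (x + t • h)) ⟪∇ f (x + t • h), h⟫ t := by
  have h1 : HasDerivAt (fun t : ℝ => x + t • h) h t := by
    simpa using ((hasDerivAt_id t).smul_const h).const_add x
  have h2 := (hf (x + t • h)).hasGradientAt.hasFDerivAt.comp_hasDerivAt t h1
  rwa [InnerProductSpace.toDual_apply_apply] at h2

lemma enorm_sq_eq_ofReal (a : ℝ) : ‖a‖ₑ ^ 2 = ENNReal.ofReal (a ^ 2) := by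
  rw [Real.enorm_eq_ofReal_abs, ← ENNReal.ofReal_pow (abs_nonneg a), sq_abs]

lemma eLpNorm_two_sq {α E : Type*} [MeasurableSpace α] [NormedAddCommGroup E] (g : α → E)
    (ν : Measure α) : eLpNorm g 2 ν ^ 2 = ∫⁻ x, ‖g x‖ₑ ^ 2 ∂ν := by
  have := eLpNorm_nnreal_pow_eq_lintegral (f := g) (μ := ν) (p := 2) (by norm_num)
  simpa using this

/-- The fundamental theorem of calculus along a segment, followed by Cauchy-Schwarz. No
integrability of the gradient is needed: the right-hand side may be infinite. -/
lemma enorm_sub_sq_le_lintegral_line {f : Space d → ℝ} (hf : Differentiable ℝ f) (x h : Space d) :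
    ‖f x - f (x + h)‖ₑ ^ 2 ≤ ∫⁻ t in Ioc (0 : ℝ) 1, ‖⟪∇ f (x + t • h), h⟫‖ₑ ^ 2 := by
  set φ : ℝ → ℝ := fun t => ⟪∇ f (x + t • h), h⟫
  have hφm : Measurable φ := by
    have := measurable_gradient f
    fun_prop
  rcases eq_or_ne (∫⁻ t in Ioc (0 : ℝ) 1, ‖φ t‖ₑ ^ 2) ∞ with htop | hfin
  · exact htop ▸ le_top
  have hL : MemLp φ 2 (volume.restrict (Ioc (0 : ℝ) 1)) := by
    refine ⟨hφm.aestronglyMeasurable, ?_⟩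
    by_contra hcon
    rw [not_lt, top_le_iff] at hcon
    rw [← eLpNorm_two_sq, hcon] at hfin
    simp at hfin
  have hint : Integrable φ (volume.restrict (Ioc (0 : ℝ) 1)) := hL.integrable (by norm_num)
  have h1 := intervalIntegral.integral_eq_sub_of_hasDerivAt (a := 0) (b := 1)
    (fun t _ => hasDerivAt_comp_line hf x h t)
    ((intervalIntegrable_iff_integrableOn_Ioc_of_le zero_le_one).2 hint)
  rw [intervalIntegral.integral_of_le zero_le_one, one_smul, zero_smul, add_zero] at h1
  have h2 := sq_integral_mul_le hL (memLp_const (1 : ℝ))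
  simp only [mul_one, one_pow] at h2
  rw [h1] at h2
  simp only [enorm_sq_eq_ofReal]
  rw [← ofReal_integral_eq_lintegral_ofReal hL.integrable_sq (.of_forall fun t => sq_nonneg _)]
  refine ENNReal.ofReal_le_ofReal ?_
  simp only [integral_const, measureReal_restrict_apply_univ, Real.volume_real_Ioc, smul_eq_mul,
    mul_one] at h2
  norm_num at h2
  linarith [sq_abs (f x - f (x + h)), sub_sq_comm (f x) (f (x + h))]

variable (d) in
/-- The law of a direction and a time, standard Gaussian and uniform on the unit interval. -/
def lineMeasure : Measure (Space d × ℝ) :=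
  (stdGaussian (Space d)).prod (volume.restrict (Ioc (0 : ℝ) 1))

instance : IsProbabilityMeasure (volume.restrict (Ioc (0 : ℝ) 1)) := ⟨by simp⟩

instance : IsProbabilityMeasure (lineMeasure d) := by unfold lineMeasure; infer_instance

/-- The directional component of the vector field `G` along the segments `x + t ε z`. -/
def lineSlope (G : Space d → Space d) (ε : ℝ) (p : Space d × Space d × ℝ) : ℝ :=
  ⟪G (p.1 + (p.2.2 * ε) • p.2.1), p.2.1⟫

lemma measurable_lineSlope {G : Space d → Space d} (hG : Measurable G) (ε : ℝ) :
    Measurable (lineSlope G ε) := by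
  unfold lineSlope; fun_prop

/-- The factor `s` cancels the squared length scale `1 / s` of the segments `x + t ζ / √s`. -/
lemma lintegral_channel_le {f : Space d → ℝ} (hf : Differentiable ℝ f) (μ : Measure (Space d))
    [SFinite μ] {s : ℝ} (hs : 0 < s) :
    ENNReal.ofReal s * ∫⁻ x, ∫⁻ z, ENNReal.ofReal ((f x - f (x + (1 / Real.sqrt s) • z)) ^ 2)
      ∂stdGaussian (Space d) ∂μ ≤
    eLpNorm (lineSlope (∇ f) (1 / Real.sqrt s)) 2 (μ.prod (lineMeasure d)) ^ 2 := by
  have hm := measurable_lineSlope (measurable_gradient f) (1 / Real.sqrt s)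
  rw [eLpNorm_two_sq, lintegral_prod _ (by fun_prop), ← lintegral_const_mul' _ _ ENNReal.ofReal_ne_top]
  refine lintegral_mono fun x => ?_
  simp only
  rw [lineMeasure, lintegral_prod _ (by fun_prop), ← lintegral_const_mul' _ _ ENNReal.ofReal_ne_top]
  refine lintegral_mono fun z => ?_
  simp only
  rw [← enorm_sq_eq_ofReal]
  refine (mul_le_mul_right (enorm_sub_sq_le_lintegral_line hf x _) _).trans ?_
  rw [← lintegral_const_mul' _ _ ENNReal.ofReal_ne_top]
  refine lintegral_mono fun t => le_of_eq ?_
  simp only [lineSlope]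
  rw [inner_smul_right, smul_smul, enorm_sq_eq_ofReal, enorm_sq_eq_ofReal, ← ENNReal.ofReal_mul hs.le,
    mul_pow, div_pow, Real.sq_sqrt hs.le]
  congr 1
  field_simp

lemma enorm_inner_le (x y : Space d) : ‖(⟪x, y⟫ : ℝ)‖ₑ ≤ ‖x‖ₑ * ‖y‖ₑ := by
  simp only [enorm_eq_nnnorm]
  exact_mod_cast nnnorm_inner_le_nnnorm (𝕜 := ℝ) x y

lemma lintegral_enorm_sq_lineMeasure_ne_top :
    ∫⁻ q, ‖q.1‖ₑ ^ 2 ∂lineMeasure d ≠ ∞ := by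
  rw [lineMeasure, lintegral_prod _ (by fun_prop)]
  simp only [lintegral_const, measure_univ, mul_one]
  have h := lintegral_norm_sq_stdGaussian_lt_top (d := d)
  convert h.ne using 3
  rw [← enorm_sq_eq_ofReal, enorm_norm]

variable {μ : Measure (Space d)} {M : ℝ≥0∞}

/-- If `μ` has bounded density, then the slopes of `G` are controlled by the `L²` norm of `G` with
respect to Lebesgue measure, uniformly in the length of the segments. -/
lemma eLpNorm_lineSlope_le [SFinite μ] (hM : μ ≤ M • volume) {G : Space d → Space d}
    (hG : Measurable G) (ε : ℝ) :
    eLpNorm (lineSlope G ε) 2 (μ.prod (lineMeasure d)) ≤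
      (1 + M * ∫⁻ q, ‖q.1‖ₑ ^ 2 ∂lineMeasure d) * eLpNorm G 2 volume := by
  set m := ∫⁻ q, ‖q.1‖ₑ ^ 2 ∂lineMeasure d
  have hm := measurable_lineSlope hG ε
  rw [← ENNReal.pow_le_pow_left_iff two_ne_zero, mul_pow, eLpNorm_two_sq, eLpNorm_two_sq,
    lintegral_prod_symm _ (by fun_prop)]
  calc _ ≤ ∫⁻ q, (M * ∫⁻ x, ‖G x‖ₑ ^ 2) * ‖q.1‖ₑ ^ 2 ∂lineMeasure d := by
        refine lintegral_mono fun q => ?_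
        calc _ ≤ ∫⁻ x, ‖G (x + (q.2 * ε) • q.1)‖ₑ ^ 2 * ‖q.1‖ₑ ^ 2 ∂(M • volume) := by
              refine lintegral_mono' hM fun x => ?_
              simp only [lineSlope]
              rw [← mul_pow]
              gcongr
              exact enorm_inner_le _ _
          _ = _ := by
              rw [lintegral_smul_measure, lintegral_mul_const _ (by fun_prop),
                lintegral_add_right_eq_self (fun x => ‖G x‖ₑ ^ 2)]
              simp [mul_assoc]
    _ = (M * m) * ∫⁻ x, ‖G x‖ₑ ^ 2 := by
        rw [lintegral_const_mul _ (by fun_prop)]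
        ring
    _ ≤ _ := by
        gcongr
        calc M * m ≤ 1 + M * m := le_add_self
          _ = (1 + M * m) * 1 := (mul_one _).symm
          _ ≤ (1 + M * m) * (1 + M * m) := by gcongr; exact le_self_add
          _ = _ := (sq _).symm

lemma eLpNorm_le_of_le_smul_volume (hM : μ ≤ M • volume) (G : Space d → Space d) :
    eLpNorm G 2 μ ≤ (1 + M) * eLpNorm G 2 volume := by
  rw [← ENNReal.pow_le_pow_left_iff two_ne_zero, mul_pow, eLpNorm_two_sq, eLpNorm_two_sq]
  calc _ ≤ ∫⁻ x, ‖G x‖ₑ ^ 2 ∂(M • volume) := lintegral_mono' hM le_rfl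
    _ = M * ∫⁻ x, ‖G x‖ₑ ^ 2 := by rw [lintegral_smul_measure, smul_eq_mul]
    _ ≤ _ := by
        gcongr
        calc M ≤ 1 + M := le_add_self
          _ = (1 + M) * 1 := (mul_one _).symm
          _ ≤ (1 + M) * (1 + M) := by gcongr; exact le_self_add
          _ = _ := (sq _).symm

open Filter Topology

/-- For a continuous compactly supported vector field the slopes converge as the segments shrink,
and averaging over the Gaussian direction gives the `L²` norm. -/
lemma tendsto_eLpNorm_lineSlope [IsProbabilityMeasure μ] {g : Space d → Space d}
    (hg : Continuous g) (hgc : HasCompactSupport g) :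
    Tendsto (fun ε => eLpNorm (lineSlope g ε) 2 (μ.prod (lineMeasure d))) (𝓝 0)
      (𝓝 (eLpNorm g 2 μ)) := by
  obtain ⟨C, hC⟩ := hg.bounded_above_of_compact_support hgc
  have hC' : ∀ x, ‖g x‖ₑ ≤ ENNReal.ofReal C := fun x => by
    rw [← ofReal_norm]; exact ENNReal.ofReal_le_ofReal (hC x)
  have hlim : ∫⁻ p, ‖lineSlope g 0 p‖ₑ ^ 2 ∂μ.prod (lineMeasure d) = ∫⁻ x, ‖g x‖ₑ ^ 2 ∂μ := by
    have hm := measurable_lineSlope hg.measurable 0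
    rw [lintegral_prod _ (by fun_prop)]
    refine lintegral_congr fun x => ?_
    simp only [lineSlope, mul_zero, zero_smul, add_zero]
    rw [lineMeasure, lintegral_prod _ (by fun_prop)]
    simp only [lintegral_const, measure_univ, mul_one, enorm_sq_eq_ofReal]
    rw [lintegral_inner_sq_stdGaussian, ← enorm_sq_eq_ofReal, enorm_norm]
  have h1 : Tendsto (fun ε => ∫⁻ p, ‖lineSlope g ε p‖ₑ ^ 2 ∂μ.prod (lineMeasure d)) (𝓝 0)
      (𝓝 (∫⁻ p, ‖lineSlope g 0 p‖ₑ ^ 2 ∂μ.prod (lineMeasure d))) := by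
    refine tendsto_lintegral_filter_of_dominated_convergence
      (fun p => ENNReal.ofReal C ^ 2 * ‖p.2.1‖ₑ ^ 2) (.of_forall fun ε => ?_)
      (.of_forall fun ε => .of_forall fun p => ?_) ?_ (.of_forall fun p => ?_)
    · have hm := measurable_lineSlope hg.measurable ε
      fun_prop
    · rw [← mul_pow]
      gcongr
      exact (enorm_inner_le _ _).trans (by gcongr; exact hC' _)
    · rw [lintegral_prod _ (by fun_prop)]
      simp only [lintegral_const, measure_univ, mul_one]
      rw [lintegral_const_mul _ (by fun_prop)]
      exact ENNReal.mul_ne_top (by simp) lintegral_enorm_sq_lineMeasure_ne_top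
    · have : Continuous fun ε => ‖lineSlope g ε p‖ₑ ^ 2 := by
        unfold lineSlope
        fun_prop
      exact this.tendsto 0
  rw [hlim] at h1
  have h2 := (ENNReal.continuous_rpow_const (y := 1 / 2)).tendsto _ |>.comp h1
  have e : ∀ a : ℝ≥0∞, (a ^ 2) ^ (1 / 2 : ℝ) = a := fun a => by
    rw [← ENNReal.rpow_natCast, ← ENNReal.rpow_mul]; norm_num
  simpa only [Function.comp_def, ← eLpNorm_two_sq, e] using h2

/-- The residual fluctuation of `f` across the channel is asymptotically at most the Dirichlet
energy. -/
theorem eventually_channel_le [IsProbabilityMeasure μ] (hMt : M ≠ ∞) (hM : μ ≤ M • volume)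
    {f : Space d → ℝ} (hf : Differentiable ℝ f) (hL : MemLp (∇ f) 2 volume) {r : ℝ≥0∞}
    (hr : ∫⁻ x, ‖∇ f x‖ₑ ^ 2 ∂μ < r) :
    ∀ᶠ s in atTop, ENNReal.ofReal s * ∫⁻ x, ∫⁻ z, ENNReal.ofReal
      ((f x - f (x + (1 / Real.sqrt s) • z)) ^ 2) ∂stdGaussian (Space d) ∂μ ≤ r := by
  set m := ∫⁻ q, ‖q.1‖ₑ ^ 2 ∂lineMeasure d
  have hGm := measurable_gradient f
  set N := eLpNorm (∇ f) 2 μ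
  -- The approximation error, in `N`, that still leaves room below `r`.
  obtain ⟨κ, hκ, hNκ⟩ : ∃ κ : ℝ≥0∞, 0 < κ ∧ (N + κ) ^ 2 < r := by
    have h1 : Tendsto (fun κ : ℝ≥0∞ => (N + κ) ^ 2) (𝓝[>] 0) (𝓝 ((N + 0) ^ 2)) := by
      have : Continuous fun κ : ℝ≥0∞ => (N + κ) ^ 2 := by fun_prop
      exact (this.tendsto 0).mono_left nhdsWithin_le_nhds
    rw [add_zero, eLpNorm_two_sq] at h1
    obtain ⟨κ, h2, h3⟩ := ((h1.eventually (gt_mem_nhds hr)).and self_mem_nhdsWithin).exists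
    exact ⟨κ, h3, h2⟩
  have hC : (1 + M) + (1 + M * m) ≠ ∞ := by
    have := lintegral_enorm_sq_lineMeasure_ne_top (d := d)
    finiteness
  set C := (1 + M) + (1 + M * m) with hCdef
  have hC0 : C ≠ 0 := by simp [hCdef]
  have hκ2 : κ / 2 ≠ 0 := by simp [hκ.ne']
  obtain ⟨g, hgc, hgd, hg, -⟩ := hL.exists_hasCompactSupport_eLpNorm_sub_le (by norm_num)
    (ε := κ / 2 / C) (by simp [hκ2, hC])
  have hHm : Measurable (∇ f - g) := hGm.sub hg.measurable
  have hN : eLpNorm g 2 μ ≤ N + (1 + M) * (κ / 2 / C) := by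
    have e : g = ∇ f - (∇ f - g) := by simp
    conv_lhs => rw [e]
    refine (eLpNorm_sub_le hGm.aestronglyMeasurable hHm.aestronglyMeasurable (by norm_num)).trans ?_
    gcongr
    exact (eLpNorm_le_of_le_smul_volume hM _).trans (by gcongr)
  have hN' : N + (1 + M) * (κ / 2 / C) < N + (1 + M) * (κ / 2 / C) + κ / 2 := by
    have hκN : N + κ ≠ ∞ := fun h => by simp [h] at hNκ
    have h1 := ENNReal.add_ne_top.1 hκN
    have h2 : 1 + M ≠ ∞ := by finiteness
    exact ENNReal.lt_add_right (by have := h1.1; have := h1.2; finiteness) hκ2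
  have hε : Tendsto (fun s : ℝ => 1 / Real.sqrt s) atTop (𝓝 0) := by
    simp_rw [one_div]; exact tendsto_inv_atTop_zero.comp Real.tendsto_sqrt_atTop
  have ev := (hε.eventually ((tendsto_eLpNorm_lineSlope (μ := μ) hg hgc).eventually
    (gt_mem_nhds (hN.trans_lt hN'))))
  filter_upwards [ev, eventually_gt_atTop 0] with s h1 hs
  refine (lintegral_channel_le hf μ hs).trans (le_trans ?_ hNκ.le)
  gcongr
  set ε := 1 / Real.sqrt s
  have e : lineSlope (∇ f) ε = lineSlope g ε + lineSlope (∇ f - g) ε := by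
    ext p; simp [lineSlope, inner_sub_left]
  rw [e]
  calc _ ≤ _ := eLpNorm_add_le (measurable_lineSlope hg.measurable _).aestronglyMeasurable
        (measurable_lineSlope hHm _).aestronglyMeasurable (by norm_num)
    _ ≤ (N + (1 + M) * (κ / 2 / C) + κ / 2) + (1 + M * m) * (κ / 2 / C) := by
        gcongr
        exact (eLpNorm_lineSlope_le hM hHm ε).trans (by gcongr)
    _ = N + (κ / 2 + C * (κ / 2 / C)) := by rw [hCdef]; ring
    _ = N + κ := by rw [ENNReal.mul_div_cancel hC0 hC, ENNReal.add_halves]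

end Channel

/-! ### The Poincaré inequality for bounded test functions -/

section BoundedTest

variable {μ : Measure (Space d)} {V : Space d → ℝ} {L lam : ℝ} {Lt : ℝ → ℝ} {s₀ : ℝ}

lemma IsSmoothWith.nonneg [Nontrivial (Space d)] (h : IsSmoothWith L V) : 0 ≤ L := by
  obtain ⟨x, y, hxy⟩ := exists_pair_ne (Space d)
  have h1 : 0 < ‖x - y‖ := norm_pos_iff.2 (sub_ne_zero.2 hxy)
  exact nonneg_of_mul_nonneg_left ((norm_nonneg _).trans (h.2 x y)) h1

lemma OUSmooth.nonneg [Nontrivial (Space d)] (h : OUSmooth μ Lt) {t : ℝ} (ht : 0 ≤ t) :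
    0 ≤ Lt t := by
  obtain ⟨U, -, hU⟩ := h t ht
  exact hU.nonneg

lemma log_sqrt_nonneg {s : ℝ} (hs : 0 < s) : 0 ≤ Real.log (Real.sqrt ((s + 1) / s)) := by
  refine Real.log_nonneg (Real.one_le_sqrt.2 ?_)
  rw [le_div_iff₀ hs]; linarith

lemma OUSmooth.slSmoothness_nonneg [Nontrivial (Space d)] (h : OUSmooth μ Lt) {s : ℝ}
    (hs : 0 < s) : 0 ≤ slSmoothness Lt s := h.nonneg (log_sqrt_nonneg hs)

lemma exists_le_smul_volume [IsProbabilityMeasure μ] (hμ : HasPotential μ V)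
    (hV : IsSmoothWith L V) : ∃ M : ℝ≥0∞, M ≠ ∞ ∧ μ ≤ M • volume := by
  obtain ⟨Z, hZ, hμ⟩ := hμ
  obtain ⟨M, -, hM⟩ := exists_density_le hV hZ hμ
  refine ⟨ENNReal.ofReal M, ENNReal.ofReal_ne_top, ?_⟩
  rw [← withDensity_const]
  conv_lhs => rw [hμ]
  exact withDensity_mono (.of_forall fun x => ENNReal.ofReal_le_ofReal (hM x))

variable {f : Space d → ℝ} {B : ℝ}

/-- Up to time `b = max s₀ (2 L)` the covariance bound coming from the smoothness of the
Ornstein–Uhlenbeck potentials is used, and after it the bound `1 / (s - L)`; the residual variance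
at late times is controlled by the Dirichlet energy. -/
theorem residualVar_le_energy [Nontrivial (Space d)] [IsProbabilityMeasure μ]
    (hμ : HasPotential μ V) (hV : IsSmoothWith L V) (hLt : OUSmooth μ Lt) (hs : 0 < s₀)
    (hfin : ∫⁻ s in Ioc s₀ (2 * L), ENNReal.ofReal (slSmoothness Lt s / (s * (1 + s))) ≠ ∞)
    (hf : Differentiable ℝ f) (hB : ∀ x, |f x| ≤ B) (hG : MemLp (∇ f) 2 volume) :
    ENNReal.ofReal (residualVar μ f s₀) ≤ ENNReal.ofReal (2 / s₀ * Real.exp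
      (∫⁻ s in Ioc s₀ (2 * L), ENNReal.ofReal (slSmoothness Lt s / (s * (1 + s)))).toReal) *
        ∫⁻ x, ‖∇ f x‖ₑ ^ 2 ∂μ := by
  have hL : 0 ≤ L := hV.nonneg
  have hfm : Measurable f := hf.continuous.measurable
  set I := (∫⁻ s in Ioc s₀ (2 * L), ENNReal.ofReal (slSmoothness Lt s / (s * (1 + s)))).toReal
    with hI
  set b := max s₀ (2 * L) with hb
  have hsb : s₀ ≤ b := le_max_left _ _
  have hLb : 2 * L ≤ b := le_max_right _ _
  have hb0 : 0 < b := hs.trans_le hsb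
  have hbL : 0 < b - L := by linarith
  have hIoc : Ioc s₀ b = Ioc s₀ (2 * L) := by
    ext s
    simp only [mem_Ioc, hb, le_max_iff]
    constructor
    · rintro ⟨h1, h2 | h2⟩
      · exact absurd h1 h2.not_gt
      · exact ⟨h1, h2⟩
    · exact fun h => ⟨h.1, Or.inr h.2⟩
  have hrate : ∀ s ∈ Ioc s₀ b, ENNReal.ofReal (1 / s + slSmoothness Lt s / (s * (1 + s)) - s⁻¹) =
      ENNReal.ofReal (slSmoothness Lt s / (s * (1 + s))) := fun s _ => by
    rw [one_div, add_sub_cancel_left]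
  have hint := setLIntegral_congr_fun (μ := volume) measurableSet_Ioc hrate
  rw [hIoc] at hint
  have early := residualVar_le_of_tiltBound (μ := μ) (f := f) hs hsb
    (c := fun s => 1 / s + slSmoothness Lt s / (s * (1 + s))) (η := Real.log) (η' := fun s => s⁻¹)
    (fun s hs' => by
      have h0 : 0 < s := hs.trans_le hs'.1
      have := hLt.slSmoothness_nonneg h0
      positivity)
    (fun s hs' => tiltBound_of_ouSmooth hLt (hs.trans_le hs'.1))
    (fun s hs' => Real.hasDerivAt_log (hs.trans_le hs'.1).ne')
    (by rw [hIoc, hint]; exact hfin) hfm hB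
  rw [hIoc, hint, ← hI, Real.exp_add, Real.exp_sub, Real.exp_log hb0, Real.exp_log hs] at early
  have late : ∀ S, b ≤ S → residualVar μ f b ≤ (S - L) / (b - L) * residualVar μ f S := by
    intro S hS
    have hzero : ∫⁻ s in Ioc b S, ENNReal.ofReal (1 / (s - L) - 1 / (s - L)) = 0 := by simp
    have h := residualVar_le_of_tiltBound (μ := μ) (f := f) hb0 hS
      (c := fun s => 1 / (s - L)) (η := fun s => Real.log (s - L)) (η' := fun s => 1 / (s - L))
      (fun s hs' => by have : 0 < s - L := by linarith [hs'.1]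
                       positivity)
      (fun s hs' => tiltBound_of_isSmoothWith hμ hV (hb0.trans_le hs'.1) (by linarith [hs'.1]))
      (fun s hs' => ((hasDerivAt_id s).sub_const L).log (by
        have := hs'.1
        simp only [id]; linarith))
      (by rw [hzero]; simp) hfm hB
    rwa [hzero, ENNReal.toReal_zero, zero_add, Real.exp_sub, Real.exp_log (by linarith),
      Real.exp_log hbL] at h
  have hK : 0 < 2 / s₀ * Real.exp I := by positivity
  have total : ∀ S, b ≤ S →
      residualVar μ f s₀ ≤ 2 / s₀ * Real.exp I * (S * residualVar μ f S) := by
    intro S hS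
    have hRS : 0 ≤ residualVar μ f S := residualVar_nonneg hfm hB (hb0.trans_le hS)
    have h1 : b / (b - L) ≤ 2 := by rw [div_le_iff₀ hbL]; linarith
    calc residualVar μ f s₀ ≤ Real.exp I * (b / s₀) * residualVar μ f b := early
      _ ≤ Real.exp I * (b / s₀) * ((S - L) / (b - L) * residualVar μ f S) := by
          gcongr; exact late S hS
      _ = Real.exp I / s₀ * (b / (b - L)) * ((S - L) * residualVar μ f S) := by
          field_simp
      _ ≤ Real.exp I / s₀ * 2 * (S * residualVar μ f S) := by
          have : 0 ≤ S - L := by linarith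
          gcongr
          linarith
      _ = _ := by ring
  obtain ⟨M, hMt, hM⟩ := exists_le_smul_volume hμ hV
  set K := ENNReal.ofReal (2 / s₀ * Real.exp I)
  have hK0 : K ≠ 0 := (ENNReal.ofReal_pos.2 hK).ne'
  have hKt : K ≠ ∞ := ENNReal.ofReal_ne_top
  rw [mul_comm, ← ENNReal.div_le_iff hK0 hKt]
  refine le_of_forall_gt_imp_ge_of_dense fun r hr => ?_
  rw [ENNReal.div_le_iff hK0 hKt, mul_comm]
  obtain ⟨S, h1, h2⟩ := ((eventually_channel_le hMt hM hf hG hr).and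
    (Filter.eventually_ge_atTop b)).exists
  have hS0 : 0 < S := hb0.trans_le h2
  calc ENNReal.ofReal (residualVar μ f s₀)
      ≤ K * (ENNReal.ofReal S * ENNReal.ofReal (residualVar μ f S)) := by
        rw [← ENNReal.ofReal_mul hS0.le, ← ENNReal.ofReal_mul hK.le]
        exact ENNReal.ofReal_le_ofReal (total S h2)
    _ ≤ K * r := by
        gcongr
        exact (mul_le_mul_right (residualVar_le_channel hfm hB hS0) _).trans h1

lemma ereal_exp_coe_of_ne_top {a : ℝ≥0∞} (ha : a ≠ ∞) :
    EReal.exp (a : EReal) = ENNReal.ofReal (Real.exp a.toReal) := by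
  lift a to NNReal using ha
  exact EReal.exp_coe a

/-- The Poincaré inequality with constant `piBound` for bounded functions. -/
theorem evariance_le_of_bounded [Nontrivial (Space d)] [IsProbabilityMeasure μ]
    (hμ : HasPotential μ V) (hV : IsSmoothWith L V) (hLt : OUSmooth μ Lt)
    (hlam : NormSubGaussian μ lam) (hs : 0 < s₀) (hs' : s₀ < Real.log 2 / (4 * lam ^ 2))
    (hfin : ∫⁻ s in Ioc s₀ (2 * L), ENNReal.ofReal (slSmoothness Lt s / (s * (1 + s))) ≠ ∞)
    (hf : Differentiable ℝ f) (hB : ∀ x, |f x| ≤ B) (hG : MemLp (∇ f) 2 volume) :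
    evariance f μ ≤ piBound L lam Lt s₀ * ∫⁻ x, ‖∇ f x‖ₑ ^ 2 ∂μ := by
  have hl := hlam.1
  have hfm : Measurable f := hf.continuous.measurable
  have hq : 0 < 2 - Real.exp (4 * s₀ * lam ^ 2) := by
    rw [lt_div_iff₀ (by positivity)] at hs'
    have h1 : Real.exp (4 * s₀ * lam ^ 2) < Real.exp (Real.log 2) :=
      Real.exp_lt_exp.2 (by linarith)
    rw [Real.exp_log two_pos] at h1
    linarith
  have h1 := variance_le_residualVar hlam hs hs'.le hfm hB
  have h2 := residualVar_le_energy hμ hV hLt hs hfin hf hB hG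
  have h3 := (ENNReal.ofReal_le_ofReal h1).trans h2
  have hfL : MemLp f 2 μ := memLp_of_bounded hfm hB
  have hvar : evariance f μ = ENNReal.ofReal ((∫ x, f x ^ 2 ∂μ) - (∫ x, f x ∂μ) ^ 2) := by
    rw [← hfL.ofReal_variance_eq, variance_eq_sub hfL]
    rfl
  rw [ENNReal.ofReal_mul hq.le, ← hvar, mul_comm,
    ← ENNReal.le_div_iff_mul_le (Or.inl (ENNReal.ofReal_pos.2 hq).ne')
      (Or.inl ENNReal.ofReal_ne_top)] at h3
  refine h3.trans (le_of_eq ?_)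
  rw [piBound, ereal_exp_coe_of_ne_top hfin, ENNReal.ofReal_mul (by positivity)]
  simp only [div_eq_mul_inv, one_mul]
  ring

end BoundedTest

/-! ### Truncation: from bounded to general test functions -/

section Truncation

variable {μ : Measure (Space d)}

open Filter Topology

/-- The square of the difference of two independent copies integrates to twice the variance. -/
lemma lintegral_sub_sq_eq_two_mul_evariance [IsProbabilityMeasure μ] {f : Space d → ℝ}
    (hf : MemLp f 2 μ) :
    ∫⁻ x, ∫⁻ y, ENNReal.ofReal ((f x - f y) ^ 2) ∂μ ∂μ = 2 * evariance f μ := by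
  set m := ∫ y, f y ∂μ with hm
  set W := ∫ y, f y ^ 2 ∂μ with hW
  have hi : Integrable f μ := hf.integrable (by norm_num)
  have hsq := hf.integrable_sq
  have h1 : ∀ x, ∫⁻ y, ENNReal.ofReal ((f x - f y) ^ 2) ∂μ =
      ENNReal.ofReal (f x ^ 2 - 2 * m * f x + W) := by
    intro x
    have e : (fun y => (f x - f y) ^ 2) = fun y => f x ^ 2 - 2 * f x * f y + f y ^ 2 := by
      ext y; ring
    have i1 : Integrable (fun y => f x ^ 2 - 2 * f x * f y) μ :=
      (integrable_const _).sub (hi.const_mul _)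
    rw [← ofReal_integral_eq_lintegral_ofReal (by rw [e]; exact i1.add hsq)
      (.of_forall fun y => sq_nonneg _), e, integral_add i1 hsq,
      integral_sub (integrable_const _) (hi.const_mul _), integral_const_mul, ← hm, ← hW]
    simp; ring_nf
  have hW' : m ^ 2 ≤ W := by
    have := variance_eq_sub hf
    have h0 := variance_nonneg f μ
    simp only [Pi.pow_apply] at this
    linarith
  have i1 : Integrable (fun x => f x ^ 2 - 2 * m * f x) μ := hsq.sub (hi.const_mul _)
  simp_rw [h1]
  rw [← ofReal_integral_eq_lintegral_ofReal (by exact i1.add (integrable_const W))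
    (.of_forall fun x => by simp only [Pi.zero_apply]; nlinarith [sq_nonneg (f x - m)]),
    integral_add i1 (integrable_const W), integral_sub hsq (hi.const_mul _), integral_const_mul,
    ← hm, ← hW, ← hf.ofReal_variance_eq, variance_eq_sub hf]
  simp only [Pi.pow_apply]
  have e2 : 2 * ENNReal.ofReal (W - m ^ 2) = ENNReal.ofReal (2 * (W - m ^ 2)) := by
    rw [ENNReal.ofReal_mul zero_le_two, ENNReal.ofReal_ofNat]
  rw [← hm, ← hW, e2]
  congr 1
  simp; ring

/-- By Fubini, `f` has finite quadratic distance to one of its own values. -/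
lemma memLp_of_lintegral_sub_sq_ne_top [IsProbabilityMeasure μ] {f : Space d → ℝ}
    (hfm : Measurable f)
    (h : ∫⁻ x, ∫⁻ y, ENNReal.ofReal ((f x - f y) ^ 2) ∂μ ∂μ ≠ ∞) : MemLp f 2 μ := by
  have hm : Measurable fun x => ∫⁻ y, ENNReal.ofReal ((f x - f y) ^ 2) ∂μ :=
    Measurable.lintegral_prod_right' (f := fun p : Space d × Space d =>
      ENNReal.ofReal ((f p.1 - f p.2) ^ 2)) (by fun_prop)
  obtain ⟨x, hx⟩ := (ae_lt_top hm h).exists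
  have h1 : MemLp (fun y => f x - f y) 2 μ := by
    refine ⟨by fun_prop, ?_⟩
    by_contra hcon
    rw [not_lt, top_le_iff] at hcon
    have h2 := eLpNorm_two_sq (fun y => f x - f y) μ
    simp only [enorm_sq_eq_ofReal] at h2
    rw [← h2, hcon] at hx
    simp at hx
  have h3 := (memLp_const (f x)).sub h1
  convert h3 using 1
  ext y; simp

/-- The smooth truncation of a real number at level `k`. -/
def softClip (k r : ℝ) : ℝ := k * Real.arctan (r / k)

lemma hasDerivAt_softClip {k : ℝ} (hk : 0 < k) (r : ℝ) :
    HasDerivAt (softClip k) (1 / (1 + (r / k) ^ 2)) r := by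
  have h1 : HasDerivAt (fun r => r / k) (1 / k) r := (hasDerivAt_id r).div_const k
  have h2 : HasDerivAt (softClip k) (k * (1 / (1 + (r / k) ^ 2) * (1 / k))) r :=
    h1.arctan.const_mul k
  exact h2.congr_deriv (by field_simp)

lemma abs_softClip_le {k : ℝ} (hk : 0 < k) (r : ℝ) : |softClip k r| ≤ 2 * k := by
  rw [softClip, abs_mul, abs_of_pos hk, mul_comm]
  gcongr
  have h1 := Real.arctan_lt_pi_div_two (r / k)
  have h2 := Real.neg_pi_div_two_lt_arctan (r / k)
  have h3 := Real.pi_lt_four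
  rw [abs_le]; constructor <;> linarith

lemma tendsto_softClip (r : ℝ) : Tendsto (fun k => softClip k r) atTop (𝓝 r) := by
  have h1 : HasDerivAt (fun t => Real.arctan (t * r)) r 0 := by
    have h2 : HasDerivAt (fun t : ℝ => t * r) r 0 := by
      simpa using (hasDerivAt_id (0 : ℝ)).mul_const r
    have h3 : HasDerivAt (fun t => Real.arctan (t * r)) (1 / (1 + (0 * r) ^ 2) * r) 0 :=
      h2.arctan
    exact h3.congr_deriv (by simp)
  have h3 := hasDerivAt_iff_tendsto_slope_zero.1 h1
  have h4 : Tendsto (fun k : ℝ => k⁻¹) atTop (𝓝[≠] 0) :=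
    tendsto_inv_atTop_nhdsGT_zero.mono_right (nhdsWithin_mono _ fun x hx => ne_of_gt hx)
  refine (h3.comp h4).congr fun k => ?_
  simp [softClip, div_eq_inv_mul]

variable (d) in
/-- A smooth cut-off function, equal to one on the unit ball. -/
def cutoff : ContDiffBump (0 : Space d) := ⟨1, 2, one_pos, one_lt_two⟩

variable (d) in
lemma exists_norm_fderiv_cutoff_le : ∃ C : ℝ, 0 ≤ C ∧ ∀ x, ‖fderiv ℝ (cutoff d) x‖ ≤ C := by
  have h1 : Continuous (fderiv ℝ (cutoff d)) :=
    (cutoff d).contDiff (n := 1).continuous_fderiv one_ne_zero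
  obtain ⟨C, hC⟩ := h1.bounded_above_of_compact_support ((cutoff d).hasCompactSupport.fderiv ℝ)
  exact ⟨C, (norm_nonneg _).trans (hC 0), hC⟩

/-- The truncation of `f`, in space and in value, at scale `k`. The cut-off in space takes place at
the larger scale `k²`, which makes its contribution to the gradient of order `1 / k`. -/
def truncation (f : Space d → ℝ) (k : ℝ) (x : Space d) : ℝ :=
  cutoff d ((k ^ 2)⁻¹ • x) * softClip k (f x)

variable {f : Space d → ℝ} {k : ℝ}

lemma exists_fderiv_truncation_le (hf : Differentiable ℝ f) {C : ℝ}
    (hC : ∀ x, ‖fderiv ℝ (cutoff d) x‖ ≤ C) (hk : 0 < k) (x : Space d) :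
    DifferentiableAt ℝ (truncation f k) x ∧ ‖∇ (truncation f k) x‖ ≤ ‖∇ f x‖ + 2 * C / k := by
  have h1 : HasFDerivAt (fun x => cutoff d ((k ^ 2)⁻¹ • x))
      ((k ^ 2)⁻¹ • fderiv ℝ (cutoff d) ((k ^ 2)⁻¹ • x)) x := by
    rw [← fderiv_comp_smul]
    refine DifferentiableAt.hasFDerivAt ?_
    have h2 : Differentiable ℝ (cutoff d) := (cutoff d).contDiff (n := 1).differentiable one_ne_zero
    fun_prop
  have h2 := (hasDerivAt_softClip hk (f x)).comp_hasFDerivAt x (hf x).hasFDerivAt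
  have h3 : HasFDerivAt (truncation f k) _ x := h1.mul h2
  refine ⟨h3.differentiableAt, ?_⟩
  have e : ∀ g : Space d → ℝ, ‖∇ g x‖ = ‖fderiv ℝ g x‖ := fun g =>
    (InnerProductSpace.toDual ℝ (Space d)).symm.norm_map _
  rw [e, e, h3.fderiv]
  refine (norm_add_le _ _).trans ?_
  have hχ0 := (cutoff d).nonneg (x := (k ^ 2)⁻¹ • x)
  have hχ1 := (cutoff d).le_one (x := (k ^ 2)⁻¹ • x)
  have hd : |1 / (1 + (f x / k) ^ 2)| ≤ 1 := by
    rw [abs_of_pos (by positivity), div_le_one (by positivity)]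
    linarith [sq_nonneg (f x / k)]
  have hC0 : 0 ≤ C := (norm_nonneg _).trans (hC 0)
  gcongr
  · rw [norm_smul, norm_smul, Real.norm_eq_abs, Real.norm_eq_abs, abs_of_nonneg hχ0]
    calc _ ≤ 1 * (1 * ‖fderiv ℝ f x‖) := by gcongr
      _ = _ := by ring
  · rw [norm_smul, norm_smul, Real.norm_eq_abs, Real.norm_eq_abs,
      abs_of_pos (a := (k ^ 2)⁻¹) (by positivity)]
    calc _ ≤ 2 * k * ((k ^ 2)⁻¹ * C) := by
          gcongr
          · exact abs_softClip_le hk _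
          · exact hC _
      _ = _ := by field_simp

lemma lintegral_gradient_truncation_le [IsProbabilityMeasure μ] (hf : Differentiable ℝ f) {C : ℝ}
    (hC0 : 0 ≤ C) (hC : ∀ x, ‖fderiv ℝ (cutoff d) x‖ ≤ C) (hk : 0 < k) :
    ∫⁻ x, ‖∇ (truncation f k) x‖ₑ ^ 2 ∂μ ≤
      (eLpNorm (∇ f) 2 μ + ENNReal.ofReal (2 * C / k)) ^ 2 := by
  rw [← eLpNorm_two_sq]
  gcongr
  have hc : 0 ≤ 2 * C / k := by positivity
  have hG := (measurable_gradient f).norm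
  calc eLpNorm (∇ (truncation f k)) 2 μ
      ≤ eLpNorm ((fun x => ‖∇ f x‖) + fun _ : Space d => 2 * C / k) 2 μ := by
        refine eLpNorm_mono fun x => ?_
        rw [Pi.add_apply, Real.norm_of_nonneg (add_nonneg (norm_nonneg _) hc)]
        exact (exists_fderiv_truncation_le hf hC hk x).2
    _ ≤ eLpNorm (fun x => ‖∇ f x‖) 2 μ + eLpNorm (fun _ : Space d => 2 * C / k) 2 μ :=
        eLpNorm_add_le hG.aestronglyMeasurable aestronglyMeasurable_const (by norm_num)
    _ = _ := by
        rw [eLpNorm_norm, eLpNorm_const _ (by norm_num) (IsProbabilityMeasure.ne_zero μ),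
          Real.enorm_of_nonneg hc]
        simp

lemma abs_truncation_le (hk : 0 < k) (x : Space d) : |truncation f k x| ≤ 2 * k := by
  rw [truncation, abs_mul, abs_of_nonneg (cutoff d).nonneg]
  calc _ ≤ 1 * (2 * k) := by
        gcongr
        · exact (cutoff d).le_one
        · exact abs_softClip_le hk _
    _ = _ := one_mul _

lemma hasCompactSupport_truncation (f : Space d → ℝ) (hk : 0 < k) :
    HasCompactSupport (truncation f k) := by
  have h1 : HasCompactSupport fun x => cutoff d ((k ^ 2)⁻¹ • x) :=
    (cutoff d).hasCompactSupport.comp_homeomorph (Homeomorph.smulOfNeZero (k ^ 2)⁻¹ (by positivity))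
  exact h1.mul_right

lemma tendsto_truncation (f : Space d → ℝ) (x : Space d) :
    Tendsto (fun k => truncation f k x) atTop (𝓝 (f x)) := by
  have h1 : Tendsto (fun k : ℝ => (k ^ 2)⁻¹ • x) atTop (𝓝 0) := by
    have := (tendsto_inv_atTop_zero.comp (tendsto_pow_atTop (α := ℝ) two_ne_zero)).smul_const x
    simpa using this
  have h2 : Tendsto (fun k : ℝ => cutoff d ((k ^ 2)⁻¹ • x)) atTop (𝓝 1) := by
    have h3 := ((cutoff d).continuous.tendsto 0).comp h1
    rwa [(cutoff d).one_of_mem_closedBall (by simp [cutoff])] at h3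
  simpa [truncation] using h2.mul (tendsto_softClip (f x))

/-- On compact sets the density of `μ` is bounded below, so that square integrability of a
compactly supported gradient with respect to `μ` and to Lebesgue measure are equivalent. -/
lemma memLp_gradient_volume {V : Space d → ℝ} (hμ : HasPotential μ V) (hV : Continuous V)
    {g : Space d → ℝ} (hg : HasCompactSupport g) (hfin : ∫⁻ x, ‖∇ g x‖ₑ ^ 2 ∂μ ≠ ∞) :
    MemLp (∇ g) 2 volume := by
  obtain ⟨Z, hZ, hμ⟩ := hμ
  have hm := measurable_gradient g
  have hρm : Measurable fun x => ENNReal.ofReal (Real.exp (-V x) / Z) := by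
    have := hV.measurable
    fun_prop
  refine ⟨hm.aestronglyMeasurable, ?_⟩
  obtain ⟨b, hb⟩ := (hg.isCompact.image hV).bddAbove
  set δ := ENNReal.ofReal (Real.exp (-b) / Z)
  have hδ : δ ≠ 0 := (ENNReal.ofReal_pos.2 (by positivity)).ne'
  have key : δ * ∫⁻ x, ‖∇ g x‖ₑ ^ 2 ≤ ∫⁻ x, ‖∇ g x‖ₑ ^ 2 ∂μ := by
    rw [hμ, lintegral_withDensity_eq_lintegral_mul _ hρm (by fun_prop),
      ← lintegral_const_mul _ (by fun_prop)]
    refine lintegral_mono fun x => ?_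
    rw [Pi.mul_apply]
    by_cases hx : x ∈ tsupport g
    · gcongr
      refine ENNReal.ofReal_le_ofReal ?_
      gcongr
      exact hb ⟨x, hx, rfl⟩
    · have : ∇ g x = 0 := by
        rw [gradient, notMem_tsupport_iff_eventuallyEq.1 hx |>.fderiv_eq]
        simp
      simp [this]
  by_contra hcon
  rw [not_lt, top_le_iff] at hcon
  rw [← eLpNorm_two_sq (∇ g) volume, hcon] at key
  simp [ENNReal.mul_top hδ] at key
  exact hfin key

/-- A Poincaré inequality for bounded functions extends to all differentiable functions. -/
theorem evariance_le_of_forall_bounded [IsProbabilityMeasure μ] {V : Space d → ℝ}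
    (hμ : HasPotential μ V) (hV : Continuous V) {C : ℝ≥0∞} (hC : C ≠ ∞)
    (h : ∀ (g : Space d → ℝ) (B : ℝ), Differentiable ℝ g → (∀ x, |g x| ≤ B) →
      MemLp (∇ g) 2 volume → evariance g μ ≤ C * ∫⁻ x, ‖∇ g x‖ₑ ^ 2 ∂μ)
    (hf : Differentiable ℝ f) (hE : ∫⁻ x, ‖∇ f x‖ₑ ^ 2 ∂μ ≠ ∞) :
    evariance f μ ≤ C * ∫⁻ x, ‖∇ f x‖ₑ ^ 2 ∂μ := by
  obtain ⟨A, hA0, hA⟩ := exists_norm_fderiv_cutoff_le d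
  have hfm : Measurable f := hf.continuous.measurable
  set N := eLpNorm (∇ f) 2 μ
  have hN : N ≠ ∞ := fun hcon => by
    rw [← eLpNorm_two_sq] at hE
    exact hE (by simp [N] at hcon; simp [hcon])
  set a : ℕ → ℝ := fun n => n + 1
  have ha : ∀ n, 0 < a n := fun n => by positivity
  have hat : Tendsto a atTop atTop :=
    tendsto_atTop_add_const_right _ _ tendsto_natCast_atTop_atTop
  set F : ℕ → Space d → ℝ := fun n => truncation f (a n)
  have hF : ∀ n, Differentiable ℝ (F n) := fun n x => (exists_fderiv_truncation_le hf hA (ha n) x).1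
  have hFm : ∀ n, Measurable (F n) := fun n => (hF n).continuous.measurable
  have hFE : ∀ n, ∫⁻ x, ‖∇ (F n) x‖ₑ ^ 2 ∂μ ≤ (N + ENNReal.ofReal (2 * A / a n)) ^ 2 := fun n =>
    lintegral_gradient_truncation_le hf hA0 hA (ha n)
  set D : ℝ≥0∞ := ∫⁻ x, ∫⁻ y, ENNReal.ofReal ((f x - f y) ^ 2) ∂μ ∂μ
  have hFD : ∀ n, ∫⁻ x, ∫⁻ y, ENNReal.ofReal ((F n x - F n y) ^ 2) ∂μ ∂μ ≤
      2 * (C * (N + ENNReal.ofReal (2 * A / a n)) ^ 2) := by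
    intro n
    have hb := abs_truncation_le (f := f) (ha n)
    rw [lintegral_sub_sq_eq_two_mul_evariance (memLp_of_bounded (hFm n) hb)]
    gcongr
    refine (h (F n) _ (hF n) hb (memLp_gradient_volume hμ hV
      (hasCompactSupport_truncation f (ha n)) ?_)).trans (by gcongr; exact hFE n)
    exact ne_top_of_le_ne_top (by finiteness) (hFE n)
  have hlim : Tendsto (fun n => 2 * (C * (N + ENNReal.ofReal (2 * A / a n)) ^ 2)) atTop
      (𝓝 (2 * (C * (N + ENNReal.ofReal 0) ^ 2))) := by
    have h1 : Tendsto (fun n => 2 * A / a n) atTop (𝓝 0) := hat.const_div_atTop _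
    have h2 := (ENNReal.continuous_ofReal.tendsto 0).comp h1
    exact ENNReal.Tendsto.const_mul (ENNReal.Tendsto.const_mul
      (ENNReal.Tendsto.pow (h2.const_add N)) (Or.inr hC)) (Or.inr (by norm_num))
  have hD : D ≤ 2 * (C * ∫⁻ x, ‖∇ f x‖ₑ ^ 2 ∂μ) := by
    rw [← eLpNorm_two_sq, ← add_zero (eLpNorm (∇ f) 2 μ), ← ENNReal.ofReal_zero, ← hlim.liminf_eq]
    have hpm : ∀ g : Space d → ℝ, Measurable g → Measurable fun p : Space d × Space d =>
      ENNReal.ofReal ((g p.1 - g p.2) ^ 2) := fun g hg => by fun_prop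
    calc D = ∫⁻ p : Space d × Space d, ENNReal.ofReal ((f p.1 - f p.2) ^ 2) ∂μ.prod μ :=
          (lintegral_prod _ (hpm f hfm).aemeasurable).symm
      _ = ∫⁻ p : Space d × Space d, liminf (fun n =>
            ENNReal.ofReal ((F n p.1 - F n p.2) ^ 2)) atTop ∂μ.prod μ := by
          refine lintegral_congr fun p => (Tendsto.liminf_eq ?_).symm
          have h1 := (tendsto_truncation f p.1).comp hat
          have h2 := (tendsto_truncation f p.2).comp hat
          exact (ENNReal.continuous_ofReal.tendsto _).comp ((h1.sub h2).pow 2)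
      _ ≤ liminf (fun n => ∫⁻ p : Space d × Space d,
            ENNReal.ofReal ((F n p.1 - F n p.2) ^ 2) ∂μ.prod μ) atTop :=
          lintegral_liminf_le fun n => hpm _ (hFm n)
      _ ≤ _ := by
          refine liminf_le_liminf (.of_forall fun n => ?_)
          rw [lintegral_prod _ (hpm _ (hFm n)).aemeasurable]
          exact hFD n
  have hDt : D ≠ ∞ := ne_top_of_le_ne_top (by finiteness) hD
  have hfL := memLp_of_lintegral_sub_sq_ne_top hfm hDt
  have h3 : 2 * evariance f μ ≤ 2 * (C * ∫⁻ x, ‖∇ f x‖ₑ ^ 2 ∂μ) := by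
    rw [← lintegral_sub_sq_eq_two_mul_evariance hfL]; exact hD
  exact (ENNReal.mul_le_mul_iff_right two_ne_zero (by norm_num)).1 h3

end Truncation

/-! ### The bound on the Poincaré constant and its minimization -/

section Conclusion

variable {μ : Measure (Space d)} {V : Space d → ℝ} {L lam : ℝ} {Lt : ℝ → ℝ} {s₀ : ℝ}

open Filter Topology

/-- On a one-point space the variance of every function vanishes. -/
lemma poincareConst_eq_zero_of_subsingleton [Subsingleton (Space d)] [IsProbabilityMeasure μ] :
    poincareConst μ = 0 := by
  refine le_antisymm (iSup₂_le fun f _ => ?_) bot_le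
  have hf : f = fun _ => f 0 := funext fun x => congrArg f (Subsingleton.elim x 0)
  have h : evariance f μ = 0 := by
    rw [hf, evariance_eq_lintegral_ofReal]
    simp
  simp [h]

lemma two_div_le_piBound (hs : 0 < s₀) : ENNReal.ofReal (2 / s₀) ≤ piBound L lam Lt s₀ := by
  have h1 : 1 ≤ 1 / ENNReal.ofReal (2 - Real.exp (4 * s₀ * lam ^ 2)) := by
    rw [one_div, ENNReal.one_le_inv, ← ENNReal.ofReal_one]
    refine ENNReal.ofReal_le_ofReal ?_
    have : 1 ≤ Real.exp (4 * s₀ * lam ^ 2) := Real.one_le_exp (by positivity)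
    linarith
  have h2 : 1 ≤ EReal.exp ((∫⁻ s in Ioc s₀ (2 * L),
      ENNReal.ofReal (slSmoothness Lt s / (s * (1 + s))) : ℝ≥0∞) : EReal) := by
    rw [← EReal.exp_zero]
    exact EReal.exp_monotone (EReal.coe_ennreal_nonneg _)
  calc ENNReal.ofReal (2 / s₀) = 1 * ENNReal.ofReal (2 / s₀) * 1 := by simp
    _ ≤ _ := by unfold piBound; gcongr

/-- A finite value of the bound forces `s₀` to be interior and the integral to be finite. -/
lemma of_piBound_ne_top (hlam : 0 < lam) (hs : s₀ ∈ Ioc 0 (Real.log 2 / (4 * lam ^ 2)))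
    (h : piBound L lam Lt s₀ ≠ ∞) : s₀ < Real.log 2 / (4 * lam ^ 2) ∧
      ∫⁻ s in Ioc s₀ (2 * L), ENNReal.ofReal (slSmoothness Lt s / (s * (1 + s))) ≠ ∞ := by
  have h2s : ENNReal.ofReal (2 / s₀) ≠ 0 := (ENNReal.ofReal_pos.2 (div_pos two_pos hs.1)).ne'
  constructor
  · refine lt_of_le_of_ne hs.2 fun he => h ?_
    have e : 4 * s₀ * lam ^ 2 = Real.log 2 := by rw [he]; field_simp
    rw [piBound, e, Real.exp_log two_pos, sub_self, ENNReal.ofReal_zero, ENNReal.div_zero one_ne_zero,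
      ENNReal.top_mul h2s, ENNReal.top_mul]
    rw [Ne, EReal.exp_eq_zero_iff]
    exact EReal.coe_ennreal_ne_bot _
  · intro hI
    refine h ?_
    rw [piBound, hI, EReal.coe_ennreal_top, EReal.exp_top, ENNReal.mul_top]
    simp [h2s]

/-- Test functions of infinite energy contribute the quotient `a / ∞ = 0` to the supremum. -/
theorem poincareConst_le_piBound [Nontrivial (Space d)] [IsProbabilityMeasure μ]
    (hμ : HasPotential μ V) (hV : IsSmoothWith L V) (hLt : OUSmooth μ Lt)
    (hlam : NormSubGaussian μ lam) (hs : s₀ ∈ Ioc 0 (Real.log 2 / (4 * lam ^ 2))) :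
    poincareConst μ ≤ piBound L lam Lt s₀ := by
  rcases eq_or_ne (piBound L lam Lt s₀) ∞ with h | h
  · exact h ▸ le_top
  obtain ⟨h1, h2⟩ := of_piBound_ne_top hlam.1 hs h
  refine iSup₂_le fun f hf => ?_
  by_cases hE : ∫⁻ x, ‖∇ f x‖ₑ ^ 2 ∂μ = ∞
  · rw [hE, ENNReal.div_top]; exact bot_le
  exact ENNReal.div_le_of_le_mul (evariance_le_of_forall_bounded hμ hV.1.continuous h
    (fun g B hg hB hG => evariance_le_of_bounded hμ hV hLt hlam hs.1 h1 h2 hg hB hG) hf hE)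

/-- The tail integral of an arbitrary function is lower semicontinuous in its lower limit. -/
lemma lowerSemicontinuous_setLIntegral_Ioc (φ : ℝ → ℝ≥0∞) (b : ℝ) :
    LowerSemicontinuous fun a => ∫⁻ s in Ioc a b, φ s := by
  intro a r hr
  -- The integral over `Ioc a b` is approached by the integrals over `Ioc (a + 1 / (n + 1)) b`.
  have hU : Ioc a b = ⋃ n : ℕ, Ioc (a + 1 / ((n : ℝ) + 1)) b := by
    ext s
    simp only [mem_Ioc, mem_iUnion]
    constructor
    · rintro ⟨h1, h2⟩
      obtain ⟨n, hn⟩ := exists_nat_one_div_lt (sub_pos.2 h1)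
      exact ⟨n, by linarith, h2⟩
    · rintro ⟨n, h1, h2⟩
      have : (0 : ℝ) < 1 / ((n : ℝ) + 1) := by positivity
      exact ⟨by linarith, h2⟩
  have hmono : Monotone fun n : ℕ => Ioc (a + 1 / ((n : ℝ) + 1)) b := fun m n hmn =>
    Ioc_subset_Ioc_left (by gcongr)
  change r < ∫⁻ s in Ioc a b, φ s at hr
  rw [hU, setLIntegral_iUnion_of_directed _ hmono.directed_le, lt_iSup_iff] at hr
  obtain ⟨n, hn⟩ := hr
  have hlt : a < a + 1 / ((n : ℝ) + 1) := by
    have : (0 : ℝ) < 1 / ((n : ℝ) + 1) := by positivity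
    linarith
  filter_upwards [Iio_mem_nhds hlt] with u hu
  exact hn.trans_le (lintegral_mono_set (Ioc_subset_Ioc_left (le_of_lt hu)))

lemma lowerSemicontinuousOn_piBound (L lam : ℝ) (Lt : ℝ → ℝ) :
    LowerSemicontinuousOn (piBound L lam Lt) (Ioi 0) := by
  rw [lowerSemicontinuousOn_iff_le_liminf]
  intro s hs
  have hA : ContinuousAt (fun s => 1 / ENNReal.ofReal (2 - Real.exp (4 * s * lam ^ 2)) *
      ENNReal.ofReal (2 / s)) s := by
    refine ENNReal.Tendsto.mul ?_ (Or.inr ENNReal.ofReal_ne_top) ?_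
      (Or.inl (ENNReal.ofReal_pos.2 (div_pos two_pos hs)).ne')
    · simp_rw [one_div]
      exact (((continuous_inv (G := ℝ≥0∞)).comp (ENNReal.continuous_ofReal.comp
        (by fun_prop : Continuous fun s : ℝ => 2 - Real.exp (4 * s * lam ^ 2)))).tendsto s)
    · exact (ENNReal.continuous_ofReal.tendsto _).comp
        (continuousAt_const.div continuousAt_id (ne_of_gt hs))
  have hI := (lowerSemicontinuous_setLIntegral_Ioc
    (fun s => ENNReal.ofReal (slSmoothness Lt s / (s * (1 + s)))) (2 * L)).lowerSemicontinuousOn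
      (Ioi 0)
  have hE := (continuous_coe_ennreal_ereal.comp_lowerSemicontinuousOn hI
    EReal.coe_ennreal_strictMono.monotone)
  have hE' := (EReal.expHomeomorph.continuous.comp_lowerSemicontinuousOn hE
    EReal.exp_monotone) s hs
  have h1 := lowerSemicontinuousWithinAt_iff_le_liminf.1 hE'
  have : (𝓝[Ioi 0] s).NeBot := by rw [isOpen_Ioi.nhdsWithin_eq hs]; infer_instance
  have h2 := (hA.tendsto.mono_left (nhdsWithin_le_nhds (s := Ioi 0))).liminf_eq
  refine le_trans ?_ ENNReal.le_liminf_mul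
  rw [h2]
  exact mul_le_mul_right h1 _

/-- The infimum over `s₀` is attained: `piBound` is lower semicontinuous, and `2 / s₀` keeps
minimizing sequences away from the origin. -/
theorem exists_isLeast_piBound (L : ℝ) (Lt : ℝ → ℝ) (hlam : 0 < lam) :
    ∃ s ∈ Ioc 0 (Real.log 2 / (4 * lam ^ 2)),
      IsLeast (piBound L lam Lt '' Ioc 0 (Real.log 2 / (4 * lam ^ 2))) (piBound L lam Lt s) := by
  set a := Real.log 2 / (4 * lam ^ 2)
  have hlog : 0 < Real.log 2 := Real.log_pos one_lt_two
  have ha : 0 < a := by positivity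
  by_cases hall : ∀ s ∈ Ioc 0 a, piBound L lam Lt s = ∞
  · refine ⟨a, ⟨ha, le_rfl⟩, ⟨a, ⟨ha, le_rfl⟩, rfl⟩, ?_⟩
    rintro _ ⟨s, hs, rfl⟩
    rw [hall s hs]; exact le_top
  push Not at hall
  obtain ⟨s₁, hs₁, hfin⟩ := hall
  set R := (piBound L lam Lt s₁).toReal with hR
  have hR0 : 0 ≤ R := ENNReal.toReal_nonneg
  -- Below `δ` the factor `2 / s` alone exceeds the value at `s₁`.
  set δ := min s₁ (2 / (R + 1)) with hδ
  have hδ0 : 0 < δ := lt_min hs₁.1 (by positivity)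
  obtain ⟨m, hm, hmin⟩ := ((lowerSemicontinuousOn_piBound L lam Lt).mono
    (show Icc δ a ⊆ Ioi 0 from fun s hs => hδ0.trans_le hs.1)).exists_isMinOn
      (show (Icc δ a).Nonempty from ⟨s₁, min_le_left _ _, hs₁.2⟩) isCompact_Icc
  refine ⟨m, ⟨hδ0.trans_le hm.1, hm.2⟩, ⟨m, ⟨hδ0.trans_le hm.1, hm.2⟩, rfl⟩, ?_⟩
  rintro _ ⟨s, hs, rfl⟩
  rcases le_or_gt δ s with h | h
  · exact hmin (show s ∈ Icc δ a from ⟨h, hs.2⟩)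
  · have hm₁ : piBound L lam Lt m ≤ piBound L lam Lt s₁ :=
      hmin (show s₁ ∈ Icc δ a from ⟨min_le_left _ _, hs₁.2⟩)
    refine hm₁.trans (le_trans ?_ (two_div_le_piBound hs.1))
    rw [← ENNReal.ofReal_toReal hfin, ← hR]
    refine ENNReal.ofReal_le_ofReal ?_
    have h3 : s < 2 / (R + 1) := h.trans_le (min_le_right _ _)
    rw [lt_div_iff₀ (by positivity)] at h3
    rw [le_div_iff₀ hs.1]
    nlinarith [hs.1]

/-- The integral of `1 / (s (1 + s)) = (log s - log (1 + s))'` away from the origin. -/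
lemma setLIntegral_div_mul_one_add_le {c a : ℝ} (hc : 0 ≤ c) (ha : 0 < a) (b : ℝ) :
    ∫⁻ s in Ioc a b, ENNReal.ofReal (c / (s * (1 + s))) ≤
      ENNReal.ofReal (c * Real.log ((1 + a) / a)) := by
  rcases le_or_gt b a with hba | hab
  · rw [Ioc_eq_empty hba.not_gt]; simp
  have hderiv : ∀ s ∈ uIcc a b, HasDerivAt (fun s => c * (Real.log s - Real.log (1 + s)))
      (c / (s * (1 + s))) s := by
    intro s hs
    rw [uIcc_of_le hab.le] at hs
    have h0 : 0 < s := ha.trans_le hs.1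
    have h1 : HasDerivAt (fun s => Real.log (1 + s)) (1 / (1 + s)) s :=
      ((hasDerivAt_id s).const_add 1).log (by simp only [id]; positivity)
    exact (((Real.hasDerivAt_log h0.ne').sub h1).const_mul c).congr_deriv (by field_simp; ring)
  have hcont : ContinuousOn (fun s => c / (s * (1 + s))) (Icc a b) := by
    refine continuousOn_const.div (by fun_prop) fun s hs => ?_
    have h0 : 0 < s := ha.trans_le hs.1
    positivity
  have hint : IntervalIntegrable (fun s => c / (s * (1 + s))) volume a b :=
    ContinuousOn.intervalIntegrable (by rwa [uIcc_of_le hab.le])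
  have h1 := intervalIntegral.integral_eq_sub_of_hasDerivAt hderiv hint
  rw [intervalIntegral.integral_of_le hab.le] at h1
  rw [← ofReal_integral_eq_lintegral_ofReal hint.1, h1]
  · refine ENNReal.ofReal_le_ofReal ?_
    have hb : 0 < b := ha.trans hab
    rw [← mul_sub, Real.log_div (by positivity) ha.ne']
    have : Real.log b ≤ Real.log (1 + b) := Real.log_le_log hb (by linarith)
    exact mul_le_mul_of_nonneg_left (by linarith) hc
  · filter_upwards [ae_restrict_mem measurableSet_Ioc] with s hs
    have h0 : 0 < s := ha.trans hs.1
    simp only [Pi.zero_apply]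
    positivity

/-- With a uniform bound on the smoothness constants the choice `s₀ = 1 / (8 Λ²)`,
`Λ = max 1 lam`, is good enough. -/
theorem piBound_le_of_bddAbove [Nontrivial (Space d)] (hLt : OUSmooth μ Lt) (hlam : 0 < lam)
    (hbdd : BddAbove (Lt '' Ici 0)) :
    ∃ s₀ ∈ Ioc 0 (Real.log 2 / (4 * lam ^ 2)), piBound L lam Lt s₀ ≤
      ENNReal.ofReal ((7 * max 1 lam) ^ (2 * (sSup (Lt '' Ici 0) + 1))) := by
  set ℓ := sSup (Lt '' Ici 0)
  have hle : ∀ t, 0 ≤ t → Lt t ≤ ℓ := fun t ht => le_csSup hbdd ⟨t, ht, rfl⟩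
  have hℓ : 0 ≤ ℓ := (hLt.nonneg le_rfl).trans (hle 0 le_rfl)
  set Λ := max 1 lam
  have hΛ1 : 1 ≤ Λ := le_max_left _ _
  have hΛl : lam ≤ Λ := le_max_right _ _
  have hΛ0 : 0 < Λ := one_pos.trans_le hΛ1
  have hΛ2 : 1 ≤ Λ ^ 2 := one_le_pow₀ hΛ1
  have hl2 : lam ^ 2 ≤ Λ ^ 2 := by gcongr
  set s₀ := 1 / (8 * Λ ^ 2) with hs₀
  have hs0 : 0 < s₀ := by positivity
  have hs4 : 4 * s₀ * lam ^ 2 ≤ 1 / 2 := by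
    rw [hs₀, mul_one_div, div_mul_eq_mul_div, div_le_iff₀ (by positivity)]
    nlinarith
  refine ⟨s₀, ⟨hs0, ?_⟩, ?_⟩
  · rw [le_div_iff₀ (by positivity)]
    have := Real.log_two_gt_d9
    nlinarith
  have hexp : Real.exp (4 * s₀ * lam ^ 2) ≤ 5 / 3 := by
    have h1 : Real.exp (4 * s₀ * lam ^ 2) ≤ Real.exp (1 / 2) := Real.exp_le_exp.2 hs4
    have h2 : Real.exp (1 / 2) ^ 2 ≤ (5 / 3) ^ 2 := by
      rw [← Real.exp_nat_mul]
      have := Real.exp_one_lt_d9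
      norm_num
      linarith
    exact h1.trans ((pow_le_pow_iff_left₀ (Real.exp_pos _).le (by norm_num) two_ne_zero).1 h2)
  have hfac : 1 / ENNReal.ofReal (2 - Real.exp (4 * s₀ * lam ^ 2)) ≤ ENNReal.ofReal 3 := by
    have hq : 0 < 2 - Real.exp (4 * s₀ * lam ^ 2) := by linarith
    rw [one_div, ← ENNReal.ofReal_inv_of_pos hq]
    refine ENNReal.ofReal_le_ofReal ?_
    rw [inv_le_comm₀ hq (by norm_num)]
    linarith
  have hquot : (1 + s₀) / s₀ ≤ 9 * Λ ^ 2 := by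
    have : (1 + s₀) / s₀ = 8 * Λ ^ 2 + 1 := by rw [hs₀]; field_simp
    rw [this]; linarith
  have hint : ∫⁻ s in Ioc s₀ (2 * L), ENNReal.ofReal (slSmoothness Lt s / (s * (1 + s))) ≤
      ENNReal.ofReal (ℓ * Real.log (9 * Λ ^ 2)) := by
    calc _ ≤ ∫⁻ s in Ioc s₀ (2 * L), ENNReal.ofReal (ℓ / (s * (1 + s))) := by
          refine setLIntegral_mono' measurableSet_Ioc fun s hs => ENNReal.ofReal_le_ofReal ?_
          have h0 : 0 < s := hs0.trans hs.1
          gcongr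
          exact hle _ (log_sqrt_nonneg h0)
      _ ≤ ENNReal.ofReal (ℓ * Real.log ((1 + s₀) / s₀)) :=
          setLIntegral_div_mul_one_add_le hℓ hs0 _
      _ ≤ _ := by
          refine ENNReal.ofReal_le_ofReal ?_
          gcongr
  have hEI : EReal.exp ((∫⁻ s in Ioc s₀ (2 * L),
      ENNReal.ofReal (slSmoothness Lt s / (s * (1 + s))) : ℝ≥0∞) : EReal) ≤
      ENNReal.ofReal ((9 * Λ ^ 2) ^ ℓ) := by
    have h9 : 0 ≤ ℓ * Real.log (9 * Λ ^ 2) := mul_nonneg hℓ (Real.log_nonneg (by linarith))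
    refine (EReal.exp_monotone (EReal.coe_ennreal_le_coe_ennreal_iff.2 hint)).trans_eq ?_
    rw [ereal_exp_coe_of_ne_top ENNReal.ofReal_ne_top, ENNReal.toReal_ofReal h9,
      Real.rpow_def_of_pos (by positivity), mul_comm]
  calc piBound L lam Lt s₀ ≤ ENNReal.ofReal 3 * ENNReal.ofReal (2 / s₀) *
        ENNReal.ofReal ((9 * Λ ^ 2) ^ ℓ) := by unfold piBound; gcongr
    _ = ENNReal.ofReal (48 * Λ ^ 2 * (9 * Λ ^ 2) ^ ℓ) := by
        rw [← ENNReal.ofReal_mul (by norm_num), ← ENNReal.ofReal_mul (by positivity)]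
        congr 2
        rw [hs₀]; field_simp; norm_num
    _ ≤ _ := by
        refine ENNReal.ofReal_le_ofReal ?_
        rw [Real.rpow_mul (by positivity), Real.rpow_add_one (by positivity)]
        have e : (7 * Λ) ^ (2 : ℝ) = 49 * Λ ^ 2 := by
          rw [Real.rpow_two]; ring
        rw [e, mul_comm]
        gcongr <;> norm_num

end Conclusion

end OUPoincare
end

open OUPoincare in
theorem mainTheorem2 :
    ∃ K : ℝ, 0 < K ∧
      ∀ (d : ℕ) (V : Space d → ℝ) (μ : Measure (Space d)) (L lam : ℝ) (Lt : ℝ → ℝ),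
        IsProbabilityMeasure μ → HasPotential μ V →
        IsSmoothWith L V → OUSmooth μ Lt → NormSubGaussian μ lam →
          (∃ B : ℝ≥0∞,
            IsLeast (piBound L lam Lt '' Ioc 0 (Real.log 2 / (4 * lam ^ 2))) B ∧
              poincareConst μ ≤ B) ∧
          (BddAbove (Lt '' Ici 0) →
            poincareConst μ ≤
              ENNReal.ofReal ((K * max 1 lam) ^ (2 * (sSup (Lt '' Ici 0) + 1)))) := by
  refine ⟨7, by norm_num, fun d V μ L lam Lt _ hμ hV hLt hlam => ?_⟩
  obtain ⟨s, hs, hmin⟩ := exists_isLeast_piBound L Lt hlam.1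
  rcases subsingleton_or_nontrivial (Space d) with hd | hd
  · rw [poincareConst_eq_zero_of_subsingleton]
    exact ⟨⟨_, hmin, bot_le⟩, fun _ => bot_le⟩
  · refine ⟨⟨_, hmin, poincareConst_le_piBound hμ hV hLt hlam hs⟩, fun hbdd => ?_⟩
    obtain ⟨s₀, h1, h2⟩ := piBound_le_of_bddAbove (L := L) hLt hlam.1 hbdd
    exact (poincareConst_le_piBound hμ hV hLt hlam h1).trans h2
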